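/- Let $n\in\{1,2\}$, $\alpha>0$, $\gamma\ge 0$, and set $V(x)=|x|^\alpha$, $\mathrm g(x,u)=\log|x-u|^{-1}$ (with $\mathrm g(x,x)=+\infty$) and $\vartheta(x)=\log(1+|x|)$ for $x,u\in\mathbb R^n$. For $\beta>0$ and $N\in\mathbb N$, consider the Gibbs measure on $(\mathbb R^n)^N$ $$\mathbb P_N(dx)=\frac{1}{Z_N}\exp\Big(-\beta\sum_{1\le i<j\le N}\mathrm g(x_i,x_j)-\sum_{j=1}^N V(x_j)\Big)\,dx_1\cdots dx_N .$$ Let $\nu_\gamma$ be the probability measure on $\mathbb R^n$ with density proportional to $e^{-V+\gamma\vartheta}$ and, for a probability measure $\mu$ on $\mathbb R^n$, let $$\mathscr F_\gamma(\mu)=\frac{\gamma}{2}\iint\big(\mathrm g(x,z)+\vartheta(x)+\vartheta(z)\big)\,\mu(dx)\,\mu(dz)+\mathrm H(\mu|\nu_\gamma),$$ where $\mathrm H$ is the relative entropy. Then $\mathscr F_\gamma$ has a unique minimizer $\mu_\gamma$ among probability measures on $\mathbb R^n$, the potential $\mathscr U^{\mu_\gamma}(x)=\int \mathrm g(x,z)\,\mu_\gamma(dz)$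 is given by a convergent integral for every $x$, and there is a constant $\mathrm L_\gamma>0$ such that $$\mu_\gamma(dx)=\mathrm L_\gamma^{-1}e^{-\gamma\,\mathscr U^{\mu_\gamma}(x)-V(x)}\,dx .$$ Let $\upsilon\in\mathbb R^n$ with $|\upsilon|=1$, let $e_1$ be the first vector of the canonical basis, let $\psi$ be a linear isometry of $\mathbb R^n$ with $\psi(e_1)=\upsilon$, and let $\beta=\beta_N>0$ be any sequence with $N\beta_N\to\gamma$. Set $$\eta_N=(\log N)^{1/\alpha}\Big(1+\frac{\beta_N N-n(\alpha-1)}{\alpha^2}\,\frac{\log\log N}{\log N}-\frac{\log(\alpha^n\mathrm L_\gamma)}{\alpha\log N}\Big),\qquad \varphi_N(x)=\eta_N\big(\upsilon+\alpha^{-1}\eta_N^{-\alpha}\psi(x)\big).$$ (For all large $N$, $\eta_N>0$ and $\varphi_N$ is a bijection of $\mathbb R^n$.) Then, under $\mathbb P_N$ with $\beta=\beta_N$, the point process $\Xi_N=\sum_{j=1}^N\delta_{\varphi_N^{-1}(x_j)}$ converges in distribution, as $N\to\infty$, to a Poisson point process on $\mathbb R^n$ with intensity $\theta(x)=e^{-e_1\cdot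 x}$ with respect to Lebesgue measure. Here convergence in distribution means that $\mathbb E_N\big[e^{-\Xi_N(f)}\big]\to\mathbb E\big[e^{-\Xi(f)}\big]$ for every continuous compactly supported $f:\mathbb R^n\to[0,\infty)$, and a Poisson point process with intensity $\theta$ is a point process $\Xi$ with $\mathbb E\big[e^{-\Xi(f)}\big]=\exp\big(\int(e^{-f}-1)\,\theta\,dx\big)$ for every Borel $f:\mathbb R^n\to[0,\infty)$. -/

import Mathlib

open MeasureTheory Filter Topology
open scoped ENNReal NNReal

noncomputable section

namespace LogGas

/-- Euclidean space `ℝⁿ`. -/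
abbrev Space (n : ℕ) : Type := EuclideanSpace ℝ (Fin n)

/-! ### The particle system -/

/-- The confining potential `V(x) = |x|^α`. -/
def potential {n : ℕ} (α : ℝ) (x : Space n) : ℝ := ‖x‖ ^ α

/-- The logarithmic kernel `g(x, u) = log |x - u|⁻¹`, with values in `(-∞, +∞]`. -/
def logKernel {n : ℕ} (x u : Space n) : EReal := ENNReal.log (edist x u)⁻¹

theorem logKernel_self {n : ℕ} (x : Space n) : logKernel x x = ⊤ := by
  simp [logKernel]

theorem logKernel_of_ne {n : ℕ} {x u : Space n} (h : x ≠ u) :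
    logKernel x u = ((-Real.log ‖x - u‖ : ℝ) : EReal) := by
  have h0 : edist x u ≠ 0 := by simpa [edist_eq_zero] using h
  rw [logKernel, ENNReal.log_pos_real (by simp) (by simpa using h0), ENNReal.toReal_inv,
    Real.log_inv, ← dist_eq_norm, edist_dist, ENNReal.toReal_ofReal dist_nonneg]

/-- The energy `H_N(x) = β ∑_{i<j} g(x_i, x_j) + ∑_j V(x_j)` of a configuration of `N` particles,
with values in `(-∞, +∞]`. -/
def energy {n N : ℕ} (α β : ℝ) (x : Fin N → Space n) : EReal :=
  (β : EReal) * (∑ i : Fin N, ∑ j ∈ Finset.Ioi i, logKernel (x i) (x j)) +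
    ((∑ j : Fin N, potential α (x j) : ℝ) : EReal)

/-- The partition function `Z_N = ∫ exp(-H_N(x)) dx₁ ⋯ dx_N`. -/
def partitionFunction (n N : ℕ) (α β : ℝ) : ℝ≥0∞ :=
  ∫⁻ x : Fin N → Space n, EReal.exp (-energy α β x)

/-- The Gibbs measure `P_N(dx) = Z_N⁻¹ exp(-H_N(x)) dx₁ ⋯ dx_N`. -/
def gibbs (n N : ℕ) (α β : ℝ) : Measure (Fin N → Space n) :=
  (partitionFunction n N α β)⁻¹ •
    (volume : Measure (Fin N → Space n)).withDensity fun x => EReal.exp (-energy α β x)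

/-! ### The free energy and the equilibrium measure -/

/-- `ϑ(x) = log (1 + |x|)`. -/
def logWeight {n : ℕ} (x : Space n) : ℝ := Real.log (1 + ‖x‖)

/-- `g̃(x, u) = g(x, u) + ϑ(x) + ϑ(u)`. -/
def weightedKernel {n : ℕ} (x u : Space n) : EReal :=
  logKernel x u + (logWeight x : EReal) + (logWeight u : EReal)

/-- The weighted kernel is nonnegative, so nothing is lost in passing to `ℝ≥0∞` below. -/
theorem weightedKernel_nonneg {n : ℕ} (x u : Space n) : 0 ≤ weightedKernel x u := by
  rcases eq_or_ne x u with rfl | h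
  · rw [weightedKernel, logKernel_self, EReal.top_add_coe, EReal.top_add_coe]
    exact le_top
  · rw [weightedKernel, logKernel_of_ne h, ← EReal.coe_add, ← EReal.coe_add]
    rw [EReal.coe_nonneg]
    have h1 : 0 < ‖x - u‖ := norm_pos_iff.2 (sub_ne_zero.2 h)
    have h2 : ‖x - u‖ ≤ (1 + ‖x‖) * (1 + ‖u‖) := by
      nlinarith [norm_sub_le x u, norm_nonneg x, norm_nonneg u,
        mul_nonneg (norm_nonneg x) (norm_nonneg u)]
    have h3 := Real.log_le_log h1 h2
    rw [Real.log_mul (by positivity) (by positivity)] at h3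
    simp only [logWeight]
    linarith

/-- The weighted energy `∬ g̃(x, z) μ(dz) μ(dx)`. -/
def weightedEnergy {n : ℕ} (μ : Measure (Space n)) : ℝ≥0∞ :=
  ∫⁻ x, ∫⁻ z, (weightedKernel x z).toENNReal ∂μ ∂μ

/-- The measure `exp(-(V - γ ϑ)) dx`. -/
def unnormalizedReference (n : ℕ) (α γ : ℝ) : Measure (Space n) :=
  (volume : Measure (Space n)).withDensity fun x =>
    ENNReal.ofReal (Real.exp (-(potential α x - γ * logWeight x)))

/-- The reference probability measure `ν_γ(dx) = C_γ⁻¹ exp(-(V - γ ϑ)) dx`. -/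
def reference (n : ℕ) (α γ : ℝ) : Measure (Space n) :=
  (unnormalizedReference n α γ Set.univ)⁻¹ • unnormalizedReference n α γ

/-- The free energy `F_γ(μ) = (γ/2) ∬ g̃ dμ dμ + H(μ | ν_γ)`. -/
def freeEnergy {n : ℕ} (α γ : ℝ) (μ : ProbabilityMeasure (Space n)) : ℝ≥0∞ :=
  ENNReal.ofReal (γ / 2) * weightedEnergy (μ : Measure (Space n)) +
    InformationTheory.klDiv (μ : Measure (Space n)) (reference n α γ)

/-- `μ` minimizes the free energy over all probability measures on `ℝⁿ`. -/
def IsEquilibrium {n : ℕ} (α γ : ℝ) (μ : ProbabilityMeasure (Space n)) : Prop :=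
  ∀ ν : ProbabilityMeasure (Space n), freeEnergy α γ μ ≤ freeEnergy α γ ν

/-- The logarithmic potential `U^μ(x) = ∫ g(x, z) μ(dz)`. -/
def logPotential {n : ℕ} (μ : Measure (Space n)) (x : Space n) : ℝ :=
  ∫ z, (logKernel x z).toReal ∂μ

/-- The self-consistent equation `μ(dx) = L⁻¹ exp(-γ U^μ(x) - V(x)) dx`, in which the potential
`U^μ(x)` is given by a convergent integral at every `x`. -/
def SelfConsistent {n : ℕ} (α γ L : ℝ) (μ : Measure (Space n)) : Prop :=
  (∀ x, Integrable (fun z => (logKernel x z).toReal) μ) ∧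
    μ = (volume : Measure (Space n)).withDensity fun x =>
      ENNReal.ofReal (L⁻¹ * Real.exp (-γ * logPotential μ x - potential α x))

/-! ### Point processes -/

section PointProcess

variable {Ω : Type*} [MeasurableSpace Ω] {n : ℕ}

/-- `Ξ` is a (simple) point process on `ℝⁿ` under `P`: a random measure which is almost surely of
the form `∑_{p ∈ Λ} δ_p` for a set `Λ` that meets every compact set in a finite set
(equivalently, a countable set without accumulation points). -/
structure IsPointProcess (P : Measure Ω) (Ξ : Ω → Measure (Space n)) : Prop where
  isProbabilityMeasure : IsProbabilityMeasure P
  measurable : Measurable Ξ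
  simple : ∀ᵐ ω ∂P, ∃ Λ : Set (Space n), (∀ K : Set (Space n), IsCompact K → (Λ ∩ K).Finite) ∧
    Ξ ω = Measure.sum fun p : Λ => Measure.dirac (p : Space n)

/-- The Laplace functional `f ↦ E[exp(-Ξ(f))]`, where `exp(-∞) = 0`. -/
def laplace (P : Measure Ω) (Ξ : Ω → Measure (Space n)) (f : Space n → ℝ≥0) : ℝ≥0∞ :=
  ∫⁻ ω, EReal.exp (-((∫⁻ x, (f x : ℝ≥0∞) ∂(Ξ ω) : ℝ≥0∞) : EReal)) ∂P

/-- `Ξ` is a Poisson point process with intensity measure `θ`: its Laplace functional is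
`exp(∫ (e^{-f} - 1) dθ) = exp(-∫ (1 - e^{-f}) dθ)` at every Borel function `f ≥ 0`. -/
structure IsPoissonProcess (P : Measure Ω) (Ξ : Ω → Measure (Space n))
    (θ : Measure (Space n)) : Prop where
  isPointProcess : IsPointProcess P Ξ
  laplace_eq : ∀ f : Space n → ℝ≥0, Measurable f →
    laplace P Ξ f =
      EReal.exp (-((∫⁻ x, ENNReal.ofReal (1 - Real.exp (-(f x : ℝ))) ∂θ : ℝ≥0∞) : EReal))

/-- The point processes `Ξ_N` (defined for all large `N`) converge in distribution to the point
process `Ξ`: their Laplace functionals converge at every continuous compactly supported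
`f ≥ 0`. -/
structure ConvergesInDistribution {Ω' : ℕ → Type*} [∀ N, MeasurableSpace (Ω' N)]
    (P' : ∀ N, Measure (Ω' N)) (Ξ' : ∀ N, Ω' N → Measure (Space n))
    (P : Measure Ω) (Ξ : Ω → Measure (Space n)) : Prop where
  isPointProcess : ∀ᶠ N in atTop, IsPointProcess (P' N) (Ξ' N)
  isPointProcess_limit : IsPointProcess P Ξ
  tendsto : ∀ f : Space n → ℝ≥0, Continuous f → HasCompactSupport f →
    Tendsto (fun N => laplace (P' N) (Ξ' N) f) atTop (𝓝 (laplace P Ξ f))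

end PointProcess

/-! ### Zooming at the edge -/

/-- The first vector `e₁` of the canonical basis of `ℝⁿ`. -/
def firstBasisVector (n : ℕ) [NeZero n] : Space n := EuclideanSpace.single 0 1

/-- The radius `η_N`. -/
def edgeRadius (n N : ℕ) (α β L : ℝ) : ℝ :=
  Real.log N ^ (1 / α) *
    (1 + (β * N - n * (α - 1)) / α ^ 2 * (Real.log (Real.log N) / Real.log N)
      - Real.log (α ^ n * L) / (α * Real.log N))

/-- The scaling map `φ(x) = η (υ + α⁻¹ η^{-α} ψ(x))`. -/
def zoom {n : ℕ} (α η : ℝ) (υ : Space n) (ψ : Space n ≃ₗᵢ[ℝ] Space n) (x : Space n) : Space n :=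
  η • (υ + (α⁻¹ * η ^ (-α)) • ψ x)

/-- The inverse of the scaling map. -/
def zoomInv {n : ℕ} (α η : ℝ) (υ : Space n) (ψ : Space n ≃ₗᵢ[ℝ] Space n) (y : Space n) :
    Space n :=
  ψ.symm ((α * η ^ α) • (η⁻¹ • y - υ))

theorem zoomInv_zoom {n : ℕ} {α η : ℝ} (hα : 0 < α) (hη : 0 < η) (υ : Space n)
    (ψ : Space n ≃ₗᵢ[ℝ] Space n) (x : Space n) : zoomInv α η υ ψ (zoom α η υ ψ x) = x := by
  have h : (η ^ α) * η ^ (-α) = 1 := by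
    rw [← Real.rpow_add hη, add_neg_cancel, Real.rpow_zero]
  have h2 : α * η ^ α * (α⁻¹ * η ^ (-α)) = 1 := by
    rw [mul_mul_mul_comm, mul_inv_cancel₀ hα.ne', h, one_mul]
  simp only [zoom, zoomInv, inv_smul_smul₀ hη.ne', add_sub_cancel_left, smul_smul, h2, one_smul,
    LinearIsometryEquiv.symm_apply_apply]

theorem zoom_zoomInv {n : ℕ} {α η : ℝ} (hα : 0 < α) (hη : 0 < η) (υ : Space n)
    (ψ : Space n ≃ₗᵢ[ℝ] Space n) (y : Space n) : zoom α η υ ψ (zoomInv α η υ ψ y) = y := by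
  have h : η ^ (-α) * (η ^ α) = 1 := by
    rw [← Real.rpow_add hη, neg_add_cancel, Real.rpow_zero]
  have h2 : α⁻¹ * η ^ (-α) * (α * η ^ α) = 1 := by
    rw [mul_mul_mul_comm, inv_mul_cancel₀ hα.ne', h, one_mul]
  simp only [zoom, zoomInv, LinearIsometryEquiv.apply_symm_apply, smul_smul, h2, one_smul,
    add_sub_cancel, smul_inv_smul₀ hη.ne']

/-- The edge process `∑_j δ_{φ⁻¹(x_j)}` of a configuration `x` of `N` particles. -/
def edgeProcess {n N : ℕ} (α η : ℝ) (υ : Space n) (ψ : Space n ≃ₗᵢ[ℝ] Space n)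
    (x : Fin N → Space n) : Measure (Space n) :=
  ∑ j : Fin N, Measure.dirac (zoomInv α η υ ψ (x j))

/-- The measure with density `θ(x) = exp(-e₁ · x)` with respect to Lebesgue measure on `ℝⁿ`. -/
def edgeIntensity (n : ℕ) [NeZero n] : Measure (Space n) :=
  (volume : Measure (Space n)).withDensity fun x =>
    ENNReal.ofReal (Real.exp (-(inner ℝ (firstBasisVector n) x)))

end LogGas

end

set_option linter.unusedSectionVars false

/-! The Laplace functional of the edge process at `f` is the mean of the product of the factors 1 -
χ(x_j), where χ = 1 - exp(-f∘φ⁻¹). Replace χ by tχ and call the mean G(t), so that G(0) = 1. The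
derivative G'(t) is minus a sum over k of the mean of χ(x_k) times the product over the other
particles. Split off the particle at a = x_k from the M = N - 1 others, at y. The Gibbs weight
factors as the weight of y times e^{-V(a)} ∏|a - y_j|^β. Suppose that this last product, divided by
(1+|a|)^{Mβ}, is close in mean to exp(-γ(U+ϑ)(a)), uniformly in a. Then all the means in question
reduce to one-body integrals times the same M-particle mean, and G' is close to -l G with l = ∫(1 -
e^{-f})θ. Hence G(1) tends to e^{-l}, which is the Poisson Laplace functional. This step is
`Solution.abs_thin_sub_exp_le` with its limit `Solution.tendsto_thin`. Uniformity in a is essential: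
the error is ε times the mass of χ, and N times that mass stays bounded.

The mean convergence of the insertion ratio is `Solution.exists_integral_abs_insertionRatio_sub_le`.
It rests on two estimates. First, the Gibbs law is at most the M-fold product of μ_γ times a factor
e^{ε(1+ϑ)} per particle (`Solution.exists_gibbsWeight_le`). Second, under μ_γ the variable log|x -
y| + U(x) is centred with exponential moments uniform in x, so large deviations of its empirical
mean are exponentially unlikely, with room to absorb that factor (`Solution.exists_chernoff`). In
the domination, Jensen's inequality bounds the partition function from below. The pointwise upper
bound comes from the positivity of the logarithmic energy of an empirical measure minus μ_γ, after
the kernel is regularized to -½log(d²+|x-z|²).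

That positivity is `two_mul_integral_regKernel_le`. Gaussians are convolution squares, inverse
powers are Gamma mixtures of Gaussians, and the logarithm is the derivative of the powers at
exponent zero, which is harmless between measures of equal mass.

The same convexity of the energy, with the entropy controlling the Hellinger distance at midpoints,
gives the equilibrium measure. Minimizing sequences are Cauchy, Fatou's lemma gives a minimizer,
zero excess gives uniqueness, and comparison with the Gibbs density of its own potential gives the
self-consistent equation (`exists_equilibrium`). The resulting density is at most a constant times
(1+|x|)^γ e^{-V}, which supplies every moment bound used later.

At the edge, the radius is chosen so that N times the Jacobian times the weight tends to L times θ
(`tendsto_edge_kernel`). The correction exp(-γ(U+ϑ)) tends to 1 because U+ϑ vanishes at infinity,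
and the factor L cancels against the limiting ratio of consecutive partition functions. The limit
process itself is built from independent Poisson clouds on annuli (`exists_isPoissonProcess`). -/

namespace LogGas

/-! ### Positive type of the regularized logarithmic kernel -/

/-- A kernel of positive type: `2 ∬ k dμ dν ≤ ∬ k dμ dμ + ∬ k dν dν` for all finite measures. -/
def PosType {E : Type*} [MeasurableSpace E] (k : E → E → ℝ≥0∞) : Prop :=
  ∀ (μ ν : Measure E) [IsFiniteMeasure μ] [IsFiniteMeasure ν],
    2 * ∫⁻ x, ∫⁻ z, k x z ∂ν ∂μ ≤ (∫⁻ x, ∫⁻ z, k x z ∂μ ∂μ) + ∫⁻ x, ∫⁻ z, k x z ∂ν ∂ν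

theorem ENNReal.two_mul_mul_le (a b : ℝ≥0∞) : 2 * (a * b) ≤ a * a + b * b := by
  rcases eq_or_ne a ⊤ with rfl | ha
  · rcases eq_or_ne b 0 with rfl | hb <;> simp
  rcases eq_or_ne b ⊤ with rfl | hb
  · rcases eq_or_ne a 0 with rfl | hb <;> simp
  lift a to ℝ≥0 using ha
  lift b to ℝ≥0 using hb
  norm_cast
  rw [← mul_assoc, ← sq, ← sq]
  exact two_mul_le_add_sq a b

section PosType

variable {E W : Type*} [MeasurableSpace E] [MeasurableSpace W]

/-- Tonelli factors the double integral as an integral over w of (∫Φ dμ)(∫Φ dν), and the claim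
becomes 2ab ≤ a² + b² for each w. -/
theorem posType_of_feature {Φ : E → W → ℝ≥0∞} {lam : Measure W} [SFinite lam]
    (hΦ : Measurable (Function.uncurry Φ)) :
    PosType fun x z => ∫⁻ w, Φ x w * Φ z w ∂lam := by
  have key : ∀ (μ ν : Measure E) [IsFiniteMeasure μ] [IsFiniteMeasure ν],
      ∫⁻ x, ∫⁻ z, ∫⁻ w, Φ x w * Φ z w ∂lam ∂ν ∂μ
        = ∫⁻ w, (∫⁻ x, Φ x w ∂μ) * ∫⁻ z, Φ z w ∂ν ∂lam := by
    intro μ ν _ _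
    have h1 : ∀ x w, Measurable fun z => Φ x w * Φ z w := fun x w => by fun_prop
    calc ∫⁻ x, ∫⁻ z, ∫⁻ w, Φ x w * Φ z w ∂lam ∂ν ∂μ
        = ∫⁻ x, ∫⁻ w, Φ x w * ∫⁻ z, Φ z w ∂ν ∂lam ∂μ := by
          refine lintegral_congr fun x => ?_
          rw [lintegral_lintegral_swap]
          · refine lintegral_congr fun w => ?_
            rw [lintegral_const_mul]
            fun_prop
          · fun_prop
      _ = _ := by
          rw [lintegral_lintegral_swap]
          · refine lintegral_congr fun w => ?_
            rw [lintegral_mul_const]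
            fun_prop
          · have : Measurable fun w => ∫⁻ z, Φ z w ∂ν := by
              apply Measurable.lintegral_prod_left' hΦ
            fun_prop
  intro μ ν _ _
  rw [key, key, key, ← lintegral_const_mul, ← lintegral_add_left]
  · exact lintegral_mono fun w => ENNReal.two_mul_mul_le _ _
  · have : Measurable fun w => ∫⁻ z, Φ z w ∂μ := by
      apply Measurable.lintegral_prod_left' hΦ
    fun_prop
  · have : Measurable fun w => ∫⁻ z, Φ z w ∂μ := by
      apply Measurable.lintegral_prod_left' hΦ
    have : Measurable fun w => ∫⁻ z, Φ z w ∂ν := by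
      apply Measurable.lintegral_prod_left' hΦ
    fun_prop

/-- The defining inequality is linear in the kernel, so it survives mixing once Tonelli has moved
the parameter outside. -/
theorem PosType.lintegral {k : W → E → E → ℝ≥0∞} {lam : Measure W} [SFinite lam]
    (hm : Measurable fun p : W × E × E => k p.1 p.2.1 p.2.2) (hk : ∀ᵐ w ∂lam, PosType (k w)) :
    PosType fun x z => ∫⁻ w, k w x z ∂lam := by
  have key : ∀ (μ ν : Measure E) [IsFiniteMeasure μ] [IsFiniteMeasure ν],
      ∫⁻ x, ∫⁻ z, ∫⁻ w, k w x z ∂lam ∂ν ∂μ = ∫⁻ w, ∫⁻ x, ∫⁻ z, k w x z ∂ν ∂μ ∂lam ∧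
      Measurable fun w => ∫⁻ x, ∫⁻ z, k w x z ∂ν ∂μ := by
    intro μ ν _ _
    have h2 : Measurable fun p : W × E => ∫⁻ z, k p.1 p.2 z ∂ν :=
      Measurable.lintegral_prod_right' (f := fun p : (W × E) × E => k p.1.1 p.1.2 p.2)
        (hm.comp (by fun_prop : Measurable fun p : (W × E) × E => (p.1.1, p.1.2, p.2)))
    refine ⟨?_, Measurable.lintegral_prod_right' h2⟩
    rw [lintegral_lintegral_swap (f := fun w x => ∫⁻ z, k w x z ∂ν) h2.aemeasurable]
    refine lintegral_congr fun x => ?_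
    exact lintegral_lintegral_swap
      (hm.comp (by fun_prop : Measurable fun p : E × W => (p.2, x, p.1))).aemeasurable
  intro μ ν _ _
  rw [(key μ ν).1, (key μ μ).1, (key ν ν).1, ← lintegral_const_mul _ (key μ ν).2,
    ← lintegral_add_left (key μ μ).2]
  exact lintegral_mono_ae (hk.mono fun w hw => hw μ ν)

theorem PosType.const_mul {k : E → E → ℝ≥0∞} (hk : PosType k)
    (hm : Measurable (Function.uncurry k)) (c : ℝ≥0∞) : PosType fun x z => c * k x z := by
  have key : ∀ (μ ν : Measure E) [IsFiniteMeasure μ] [IsFiniteMeasure ν],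
      ∫⁻ x, ∫⁻ z, c * k x z ∂ν ∂μ = c * ∫⁻ x, ∫⁻ z, k x z ∂ν ∂μ := by
    intro μ ν _ _
    rw [← lintegral_const_mul c (Measurable.lintegral_prod_right hm)]
    refine lintegral_congr fun x => ?_
    rw [lintegral_const_mul]
    exact hm.comp (by fun_prop : Measurable fun z => (x, z))
  intro μ ν _ _
  rw [key, key, key, mul_left_comm, ← mul_add]
  gcongr
  exact hk μ ν

end PosType

variable {n : ℕ}

theorem integrable_exp_neg_mul_sq_norm {b : ℝ} (hb : 0 < b) :
    Integrable fun w : Space n => Real.exp (-b * ‖w‖ ^ 2) := by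
  -- A non-integrable function would have integral 0, against the positive value in the Gaussian
  -- formula.
  by_contra h
  have h1 := GaussianFourier.integral_rexp_neg_mul_sq_norm (V := Space n) hb
  rw [integral_undef h] at h1
  have : 0 < (Real.pi / b) ^ ((Module.finrank ℝ (Space n) : ℝ) / 2) := by positivity
  linarith

/-- By the parallelogram law a Gaussian is, up to the constant `C`, the overlap of two Gaussians
with exponent 2s centred at x and z. This is a feature representation. -/
theorem posType_gaussian {s : ℝ} (hs : 0 < s) :
    PosType fun x z : Space n => ENNReal.ofReal (Real.exp (-s * ‖x - z‖ ^ 2)) := by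
  set C : ℝ≥0∞ := ∫⁻ w : Space n, ENNReal.ofReal (Real.exp (-(4 * s) * ‖w‖ ^ 2)) with hC
  have hC1 : C ≠ ⊤ := (integrable_exp_neg_mul_sq_norm (by positivity)).lintegral_lt_top.ne
  have hC0 : C ≠ 0 := by
    rw [hC, ← ofReal_integral_eq_lintegral_ofReal (integrable_exp_neg_mul_sq_norm (by positivity))
      (ae_of_all _ fun w => (Real.exp_pos _).le),
      GaussianFourier.integral_rexp_neg_mul_sq_norm (by positivity)]
    simp only [ne_eq, ENNReal.ofReal_eq_zero, not_le]
    positivity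
  have key : ∀ x z : Space n, ∫⁻ w : Space n, ENNReal.ofReal (Real.exp (-(2 * s) * ‖x - w‖ ^ 2)) *
      ENNReal.ofReal (Real.exp (-(2 * s) * ‖z - w‖ ^ 2))
      = C * ENNReal.ofReal (Real.exp (-s * ‖x - z‖ ^ 2)) := by
    intro x z
    have h1 : ∀ w : Space n, ENNReal.ofReal (Real.exp (-(2 * s) * ‖x - w‖ ^ 2)) *
      ENNReal.ofReal (Real.exp (-(2 * s) * ‖z - w‖ ^ 2)) =
        ENNReal.ofReal (Real.exp (-(4 * s) * ‖w - (2⁻¹ : ℝ) • (x + z)‖ ^ 2)) *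
          ENNReal.ofReal (Real.exp (-s * ‖x - z‖ ^ 2)) := by
      intro w
      rw [← ENNReal.ofReal_mul (Real.exp_pos _).le, ← ENNReal.ofReal_mul (Real.exp_pos _).le,
        ← Real.exp_add, ← Real.exp_add]
      congr 2
      have h2 := parallelogram_law_with_norm ℝ (x - w) (z - w)
      have h3 : x - w + (z - w) = (-2 : ℝ) • (w - (2⁻¹ : ℝ) • (x + z)) := by module
      have h4 : x - w - (z - w) = x - z := by abel
      rw [h3, h4, norm_smul, show ‖(-2 : ℝ)‖ = 2 by norm_num] at h2
      linear_combination s * h2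
    simp_rw [h1]
    rw [lintegral_mul_const _ (by fun_prop)]
    congr 1
    exact lintegral_sub_right_eq_self
      (fun w : Space n => ENNReal.ofReal (Real.exp (-(4 * s) * ‖w‖ ^ 2))) ((2⁻¹ : ℝ) • (x + z))
  have h := (posType_of_feature (lam := (volume : Measure (Space n)))
    (Φ := fun x w : Space n => ENNReal.ofReal (Real.exp (-(2 * s) * ‖x - w‖ ^ 2)))
    (by unfold Function.uncurry; fun_prop)).const_mul ?_ C⁻¹
  · convert h using 3 with x z
    rw [key, ← mul_assoc, ENNReal.inv_mul_cancel hC0 hC1, one_mul]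
  · simp_rw [key]
    unfold Function.uncurry
    fun_prop

/-- The Gamma integral A^{-e} = Γ(e)⁻¹ ∫ s^{e-1} e^{-sA} ds presents the inverse power as a positive
mixture of Gaussians in x - z. -/
theorem posType_rpow {d e : ℝ} (hd : 0 < d) (he : 0 < e) :
    PosType fun x z : Space n => ENNReal.ofReal ((d ^ 2 + ‖x - z‖ ^ 2) ^ (-e)) := by
  have h := PosType.lintegral (E := Space n) (lam := (volume : Measure ℝ).restrict (Set.Ioi 0))
    (k := fun s x z => ENNReal.ofReal (s ^ (e - 1) / Real.Gamma e * Real.exp (-s * d ^ 2)) *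
      ENNReal.ofReal (Real.exp (-s * ‖x - z‖ ^ 2))) (by fun_prop)
    ((ae_restrict_iff' measurableSet_Ioi).2 (ae_of_all _ fun s hs =>
      (posType_gaussian hs).const_mul (by unfold Function.uncurry; fun_prop) _))
  convert h using 3 with x z
  have hA : 0 < d ^ 2 + ‖x - z‖ ^ 2 := by positivity
  have hG := Real.Gamma_pos_of_pos he
  have h1 := Real.integral_rpow_mul_exp_neg_mul_Ioi he hA
  have h2 : IntegrableOn (fun s : ℝ => s ^ (e - 1) * Real.exp (-((d ^ 2 + ‖x - z‖ ^ 2) * s)))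
      (Set.Ioi 0) := by
    by_contra hn
    rw [integral_undef hn] at h1
    have : 0 < (1 / (d ^ 2 + ‖x - z‖ ^ 2)) ^ e * Real.Gamma e := by positivity
    linarith
  have h3 : (d ^ 2 + ‖x - z‖ ^ 2) ^ (-e) = ∫ s in Set.Ioi 0,
      (Real.Gamma e)⁻¹ * (s ^ (e - 1) * Real.exp (-((d ^ 2 + ‖x - z‖ ^ 2) * s))) := by
    rw [integral_const_mul, h1, one_div, Real.inv_rpow hA.le, Real.rpow_neg hA.le]
    field_simp
  rw [h3, ofReal_integral_eq_lintegral_ofReal (h2.const_mul _)]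
  · refine setLIntegral_congr_fun measurableSet_Ioi fun s hs => ?_
    have hs' : 0 < s := hs
    rw [← ENNReal.ofReal_mul (by positivity)]
    congr 1
    rw [mul_assoc, ← Real.exp_add, div_eq_inv_mul, mul_assoc]
    ring_nf
  · refine (ae_restrict_iff' measurableSet_Ioi).2 (ae_of_all _ fun s hs => ?_)
    have hs' : 0 < s := hs
    simp only [Pi.zero_apply]
    positivity

/-- The regularized logarithmic kernel `-½ log (d² + |x - z|²)`. -/
noncomputable def regKernel (d : ℝ) (x z : Space n) : ℝ :=
  -(1 / 2) * Real.log (d ^ 2 + ‖x - z‖ ^ 2)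

theorem logWeight_nonneg (x : Space n) : 0 ≤ logWeight x :=
  Real.log_nonneg (by linarith [norm_nonneg x])

theorem continuous_logWeight : Continuous (logWeight : Space n → ℝ) := by
  unfold logWeight
  exact Continuous.log (by fun_prop) fun x => by positivity

theorem measurable_logWeight : Measurable (logWeight : Space n → ℝ) :=
  continuous_logWeight.measurable

theorem continuous_regKernel {d : ℝ} (hd : 0 < d) :
    Continuous fun p : Space n × Space n => regKernel d p.1 p.2 := by
  unfold regKernel
  exact continuous_const.mul (Continuous.log (by fun_prop) fun x => by positivity)

theorem regKernel_le {d : ℝ} (hd : 0 < d) (x z : Space n) : regKernel d x z ≤ -Real.log d := by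
  have h := Real.log_le_log (by positivity : 0 < d ^ 2)
    (by nlinarith [sq_nonneg ‖x - z‖] : d ^ 2 ≤ d ^ 2 + ‖x - z‖ ^ 2)
  rw [Real.log_pow] at h
  unfold regKernel
  push_cast at h
  linarith

theorem neg_le_regKernel {d : ℝ} (hd : 0 < d) (hd1 : d ≤ 1) (x z : Space n) :
    -(logWeight x + logWeight z) ≤ regKernel d x z := by
  have h1 : d ^ 2 + ‖x - z‖ ^ 2 ≤ ((1 + ‖x‖) * (1 + ‖z‖)) ^ 2 := by
    have h2 : ‖x - z‖ ≤ ‖x‖ + ‖z‖ := norm_sub_le x z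
    have h3 : ‖x - z‖ ^ 2 ≤ (‖x‖ + ‖z‖) ^ 2 := by gcongr
    have h4 : d ^ 2 ≤ 1 := by nlinarith
    have h5 : (1 + (‖x‖ + ‖z‖)) ^ 2 ≤ ((1 + ‖x‖) * (1 + ‖z‖)) ^ 2 := by
      gcongr
      nlinarith [mul_nonneg (norm_nonneg x) (norm_nonneg z)]
    nlinarith [norm_nonneg x, norm_nonneg z]
  have h := Real.log_le_log (by positivity) h1
  rw [Real.log_pow, Real.log_mul (by positivity) (by positivity)] at h
  unfold regKernel logWeight
  push_cast at h
  linarith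

theorem abs_regKernel_le {d : ℝ} (hd : 0 < d) (hd1 : d ≤ 1) (x z : Space n) :
    |regKernel d x z| ≤ -Real.log d + (logWeight x + logWeight z) := by
  have h1 := regKernel_le hd x z
  have h2 := neg_le_regKernel hd hd1 x z
  have h3 := Real.log_nonpos hd.le hd1
  have h4 := logWeight_nonneg x
  have h5 := logWeight_nonneg z
  exact abs_le.2 ⟨by linarith, by linarith⟩

section

variable {μ ν : Measure (Space n)} [IsProbabilityMeasure μ] [IsProbabilityMeasure ν]

theorem integrable_regKernel {d : ℝ} (hd : 0 < d) (hd1 : d ≤ 1) (hμ : Integrable logWeight μ)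
    (hν : Integrable logWeight ν) :
    Integrable (fun p : Space n × Space n => regKernel d p.1 p.2) (μ.prod ν) := by
  refine Integrable.mono' ((integrable_const (-Real.log d)).add
    ((hμ.comp_fst ν).add (hν.comp_snd μ)))
    (continuous_regKernel hd).measurable.aestronglyMeasurable (ae_of_all _ fun p => ?_)
  exact abs_regKernel_le hd hd1 p.1 p.2

/-- Real-valued form of `posType_rpow`: the limit e → 0 needs a constant subtracted from the kernel,
which is impossible in [0, ∞]. -/
theorem two_mul_integral_rpow_le {d e : ℝ} (hd : 0 < d) (he : 0 < e) :
    Integrable (fun p : Space n × Space n => (d ^ 2 + ‖p.1 - p.2‖ ^ 2) ^ (-e)) (μ.prod ν) ∧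
    2 * ∫ p : Space n × Space n, (d ^ 2 + ‖p.1 - p.2‖ ^ 2) ^ (-e) ∂(μ.prod ν) ≤
      (∫ p : Space n × Space n, (d ^ 2 + ‖p.1 - p.2‖ ^ 2) ^ (-e) ∂(μ.prod μ)) +
      ∫ p : Space n × Space n, (d ^ 2 + ‖p.1 - p.2‖ ^ 2) ^ (-e) ∂(ν.prod ν) := by
  have hc : Continuous fun p : Space n × Space n => (d ^ 2 + ‖p.1 - p.2‖ ^ 2) ^ (-e) :=
    Continuous.rpow_const (by fun_prop) fun p => Or.inl (by positivity)
  have hi : ∀ (μ ν : Measure (Space n)) [IsProbabilityMeasure μ] [IsProbabilityMeasure ν],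
      Integrable (fun p : Space n × Space n => (d ^ 2 + ‖p.1 - p.2‖ ^ 2) ^ (-e)) (μ.prod ν) := by
    intro μ ν _ _
    refine Integrable.mono' (integrable_const ((d ^ 2) ^ (-e)))
      hc.measurable.aestronglyMeasurable (ae_of_all _ fun p => ?_)
    rw [Real.norm_of_nonneg (by positivity)]
    exact Real.rpow_le_rpow_of_nonpos (by positivity) (by nlinarith [sq_nonneg ‖p.1 - p.2‖])
      (by linarith)
  have key : ∀ (μ ν : Measure (Space n)) [IsProbabilityMeasure μ] [IsProbabilityMeasure ν],
      ∫⁻ x, ∫⁻ z, ENNReal.ofReal ((d ^ 2 + ‖x - z‖ ^ 2) ^ (-e)) ∂ν ∂μ =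
      ENNReal.ofReal (∫ p : Space n × Space n, (d ^ 2 + ‖p.1 - p.2‖ ^ 2) ^ (-e) ∂(μ.prod ν)) := by
    intro μ ν _ _
    rw [ofReal_integral_eq_lintegral_ofReal (hi μ ν)
      (ae_of_all _ fun p => by simp only [Pi.zero_apply]; positivity),
      lintegral_prod _ hc.measurable.ennreal_ofReal.aemeasurable]
  have h := posType_rpow (n := n) hd he μ ν
  have hn : ∀ (μ ν : Measure (Space n)), 0 ≤ ∫ p : Space n × Space n,
      (d ^ 2 + ‖p.1 - p.2‖ ^ 2) ^ (-e) ∂(μ.prod ν) := fun μ ν =>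
    integral_nonneg fun p => by simp only [Pi.zero_apply]; positivity
  rw [key, key, key, ← ENNReal.ofReal_add (hn _ _) (hn _ _),
    two_mul (ENNReal.ofReal _), ← ENNReal.ofReal_add (hn _ _) (hn _ _), ← two_mul,
    ENNReal.ofReal_le_ofReal_iff (add_nonneg (hn _ _) (hn _ _))] at h
  exact ⟨hi μ ν, h⟩

/-- Domination uniform in e ∈ (0, 1] for the limit that produces the logarithm. Since A ≥ d², the
power A^{-e} costs at most d⁻². -/
theorem abs_rpow_sub_one_div_le {d A e : ℝ} (hd : 0 < d) (hd1 : d ≤ 1) (hA : d ^ 2 ≤ A)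
    (he : 0 < e) (he1 : e ≤ 1) : |(A ^ (-e) - 1) / e| ≤ (d ^ 2)⁻¹ * |Real.log A| := by
  have hA0 : 0 < A := lt_of_lt_of_le (by positivity) hA
  have hd2 : 1 ≤ (d ^ 2)⁻¹ := (one_le_inv₀ (by positivity)).2 (by nlinarith)
  have hexp : A ^ (-e) = Real.exp (-e * Real.log A) := by
    rw [Real.rpow_def_of_pos hA0]; ring_nf
  rw [abs_div, abs_of_pos he, div_le_iff₀ he, hexp]
  rcases le_total 0 (Real.log A) with h | h
  · have h1 : Real.exp (-e * Real.log A) ≤ 1 := Real.exp_le_one_iff.2 (by nlinarith)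
    have h2 := Real.add_one_le_exp (-e * Real.log A)
    rw [abs_of_nonpos (by linarith), abs_of_nonneg h]
    nlinarith [mul_nonneg he.le h]
  · have h1 : 1 ≤ Real.exp (-e * Real.log A) := Real.one_le_exp (by nlinarith)
    rw [abs_of_nonneg (by linarith), abs_of_nonpos h]
    have h2 := Real.add_one_le_exp (-(-e * Real.log A))
    have h3 : Real.exp (-e * Real.log A) ≤ (d ^ 2)⁻¹ := by
      rw [← hexp]
      calc A ^ (-e) ≤ (d ^ 2) ^ (-e) :=
            Real.rpow_le_rpow_of_nonpos (by positivity) hA (by linarith)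
        _ ≤ (d ^ 2) ^ (-1 : ℝ) :=
            Real.rpow_le_rpow_of_exponent_ge (by positivity) (by nlinarith) (by linarith)
        _ = (d ^ 2)⁻¹ := Real.rpow_neg_one _
    have h4 : Real.exp (-(-e * Real.log A)) * Real.exp (-e * Real.log A) = 1 := by
      rw [← Real.exp_add]; simp
    have h5 : Real.exp (-e * Real.log A) - 1 ≤
        (-e * Real.log A) * Real.exp (-e * Real.log A) := by nlinarith
    have h6 : 0 ≤ -e * Real.log A := by nlinarith
    nlinarith

theorem tendsto_rpow_sub_one_div {A : ℝ} (hA : 0 < A) :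
    Tendsto (fun e : ℝ => (A ^ (-e) - 1) / e) (𝓝[>] 0) (𝓝 (-Real.log A)) := by
  have h : HasDerivAt (fun e : ℝ => A ^ (-e)) (-Real.log A) 0 := by
    have h1 := (hasDerivAt_neg (0 : ℝ)).const_rpow hA
    simpa using h1
  have h2 := h.tendsto_slope_zero_right
  refine h2.congr fun e => ?_
  simp [div_eq_inv_mul]

/-- The quotient (A^{-e} - 1)/e tends to -log A as e → 0. The constant 1 contributes equally to both
sides because μ and ν are probability measures, so the inequality for powers passes to the
logarithm, which is not itself of one sign. -/
theorem two_mul_integral_regKernel_le {d : ℝ} (hd : 0 < d) (hd1 : d ≤ 1)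
    (hμ : Integrable logWeight μ) (hν : Integrable logWeight ν) :
    2 * ∫ p : Space n × Space n, regKernel d p.1 p.2 ∂(μ.prod ν) ≤
      (∫ p : Space n × Space n, regKernel d p.1 p.2 ∂(μ.prod μ)) +
      ∫ p : Space n × Space n, regKernel d p.1 p.2 ∂(ν.prod ν) := by
  have lim : ∀ (μ ν : Measure (Space n)) [IsProbabilityMeasure μ] [IsProbabilityMeasure ν],
      Integrable logWeight μ → Integrable logWeight ν →
      Tendsto (fun e : ℝ => ∫ p : Space n × Space n,
        ((d ^ 2 + ‖p.1 - p.2‖ ^ 2) ^ (-e) - 1) / e ∂(μ.prod ν)) (𝓝[>] 0)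
        (𝓝 (2 * ∫ p : Space n × Space n, regKernel d p.1 p.2 ∂(μ.prod ν))) := by
    intro μ ν _ _ hμ hν
    rw [← integral_const_mul]
    refine tendsto_integral_filter_of_dominated_convergence
      (fun p => (d ^ 2)⁻¹ * (2 * |regKernel d p.1 p.2|)) ?_ ?_ ?_ ?_
    · filter_upwards [self_mem_nhdsWithin] with e he
      refine Continuous.aestronglyMeasurable ?_
      exact ((Continuous.rpow_const (by fun_prop) fun p =>
        Or.inl (by positivity)).sub continuous_const).div_const _
    · filter_upwards [Ioc_mem_nhdsGT (show (0 : ℝ) < 1 by norm_num)] with e he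
      refine ae_of_all _ fun p => ?_
      have := abs_rpow_sub_one_div_le hd hd1
        (by nlinarith [sq_nonneg ‖p.1 - p.2‖] : d ^ 2 ≤ d ^ 2 + ‖p.1 - p.2‖ ^ 2) he.1 he.2
      refine this.trans (le_of_eq ?_)
      unfold regKernel
      rw [abs_mul, show |(-(1 / 2) : ℝ)| = 1 / 2 by norm_num]
      ring
    · exact ((integrable_regKernel hd hd1 hμ hν).abs.const_mul 2).const_mul _
    · refine ae_of_all _ fun p => ?_
      have := tendsto_rpow_sub_one_div (by positivity : 0 < d ^ 2 + ‖p.1 - p.2‖ ^ 2)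
      convert this using 2
      unfold regKernel
      ring
  have h := le_of_tendsto_of_tendsto ((lim μ ν hμ hν).const_mul 2)
    ((lim μ μ hμ hμ).add (lim ν ν hν hν)) ?_
  · linarith
  · filter_upwards [self_mem_nhdsWithin] with e he
    have he' : 0 < e := he
    have key : ∀ (μ ν : Measure (Space n)) [IsProbabilityMeasure μ] [IsProbabilityMeasure ν],
        ∫ p : Space n × Space n, ((d ^ 2 + ‖p.1 - p.2‖ ^ 2) ^ (-e) - 1) / e ∂(μ.prod ν) =
        ((∫ p : Space n × Space n, (d ^ 2 + ‖p.1 - p.2‖ ^ 2) ^ (-e) ∂(μ.prod ν)) - 1) / e := by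
      intro μ ν _ _
      rw [integral_div, integral_sub (two_mul_integral_rpow_le hd he').1 (integrable_const _)]
      simp
    rw [key, key, key, ← mul_div_assoc, ← add_div]
    gcongr
    linarith [(two_mul_integral_rpow_le (μ := μ) (ν := ν) hd he').2]

end

end LogGas

/-! ### Integrable weights and the logarithmic singularity -/

namespace LogGas

variable {n : ℕ}

theorem exp_mul_logWeight (A : ℝ) (x : Space n) :
    Real.exp (A * logWeight x) = (1 + ‖x‖) ^ A := by
  rw [Real.rpow_def_of_pos (by positivity), logWeight, mul_comm]

theorem continuous_potential {α : ℝ} (hα : 0 < α) :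
    Continuous (potential α : Space n → ℝ) :=
  continuous_norm.rpow_const fun _ => Or.inr hα.le

/-- The weight `(1 + |x|)^A e^{-|x|^α}`. -/
noncomputable def edgeWeight (α A : ℝ) (x : Space n) : ℝ :=
  Real.exp (A * logWeight x - potential α x)

theorem edgeWeight_pos (α A : ℝ) (x : Space n) : 0 < edgeWeight α A x := Real.exp_pos _

theorem continuous_edgeWeight {α : ℝ} (hα : 0 < α) (A : ℝ) :
    Continuous (edgeWeight α A : Space n → ℝ) :=
  Real.continuous_exp.comp
    ((continuous_const.mul continuous_logWeight).sub (continuous_potential hα))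

theorem edgeWeight_mono (α : ℝ) {A B : ℝ} (h : A ≤ B) (x : Space n) :
    edgeWeight α A x ≤ edgeWeight α B x := by
  unfold edgeWeight
  gcongr
  exact logWeight_nonneg x

theorem edgeWeight_add (α A B : ℝ) (x : Space n) :
    edgeWeight α (A + B) x = Real.exp (B * logWeight x) * edgeWeight α A x := by
  rw [edgeWeight, edgeWeight, ← Real.exp_add]
  ring_nf

/-- The polynomial factor is dominated by 1 + (|x|^α)^k for an integer k ≥ A/α, and the power by k!
e^{|x|^α}. -/
theorem edgeWeight_bounded {α : ℝ} (hα : 0 < α) (A : ℝ) :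
    ∃ C, 0 < C ∧ ∀ x : Space n, edgeWeight α A x ≤ C := by
  wlog hA : 0 ≤ A generalizing A
  · obtain ⟨C, hC, h⟩ := this 0 le_rfl
    exact ⟨C, hC, fun x => (edgeWeight_mono α (by linarith) x).trans (h x)⟩
  obtain ⟨k, hk⟩ := exists_nat_ge (A / α)
  refine ⟨2 ^ A * (1 + k.factorial), by positivity, fun x => ?_⟩
  set r := ‖x‖ with hr
  have hr0 : 0 ≤ r := norm_nonneg x
  have hu : 0 ≤ r ^ α := Real.rpow_nonneg hr0 α
  have h1 : (1 + r) ^ A ≤ 2 ^ A * (1 + (r ^ α) ^ k) := by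
    have h2 : (1 + r) ^ A ≤ (2 * max 1 r) ^ A := by
      gcongr
      linarith [le_max_left 1 r, le_max_right 1 r]
    rw [Real.mul_rpow (by norm_num) (by positivity)] at h2
    refine h2.trans ?_
    gcongr
    rcases le_total r 1 with h | h
    · rw [max_eq_left h, Real.one_rpow]
      linarith [pow_nonneg hu k]
    · rw [max_eq_right h, ← Real.rpow_natCast, ← Real.rpow_mul hr0]
      have : r ^ A ≤ r ^ (α * k) := Real.rpow_le_rpow_of_exponent_le h (by
        rw [div_le_iff₀ hα] at hk; linarith)
      linarith
  have h3 := Real.pow_div_factorial_le_exp (r ^ α) hu k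
  rw [div_le_iff₀ (by positivity)] at h3
  have h4 : 1 ≤ Real.exp (r ^ α) := Real.one_le_exp hu
  rw [edgeWeight, sub_eq_add_neg, Real.exp_add, exp_mul_logWeight, Real.exp_neg, potential,
    ← div_eq_mul_inv, div_le_iff₀ (Real.exp_pos _), ← hr, mul_assoc]
  refine h1.trans ?_
  gcongr
  nlinarith

theorem edgeWeight_integrable {α : ℝ} (hα : 0 < α) (A : ℝ) :
    Integrable (edgeWeight α A : Space n → ℝ) := by
  -- Raising the exponent by n + 1 before using boundedness leaves the integrable factor
  -- (1+|x|)^{-(n+1)}.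
  obtain ⟨C, hC, h⟩ := edgeWeight_bounded (n := n) hα (A + (n + 1))
  have hi : Integrable fun x : Space n => (1 + ‖x‖) ^ (-((n : ℝ) + 1)) :=
    integrable_one_add_norm (by simp)
  refine Integrable.mono' (hi.const_mul C) (continuous_edgeWeight hα A).aestronglyMeasurable
    (ae_of_all _ fun x => ?_)
  rw [Real.norm_of_nonneg (edgeWeight_pos α A x).le, Real.rpow_neg (by positivity),
    ← div_eq_mul_inv, le_div_iff₀ (by positivity), mul_comm, ← exp_mul_logWeight, ← edgeWeight_add]
  exact h x

theorem tendsto_logWeight : Tendsto (logWeight : Space n → ℝ) (cocompact _) atTop :=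
  Real.tendsto_log_atTop.comp
    (tendsto_atTop_add_const_left _ 1 (tendsto_norm_cocompact_atTop (E := Space n)))

/-- The singular part `log (1 + |x - y|⁻¹)` of the logarithmic kernel. -/
noncomputable def singWeight (x y : Space n) : ℝ := Real.log (1 + ‖x - y‖⁻¹)

theorem singWeight_nonneg (x y : Space n) : 0 ≤ singWeight x y :=
  Real.log_nonneg (by simp)

theorem measurable_singWeight : Measurable fun p : Space n × Space n => singWeight p.1 p.2 := by
  unfold singWeight
  fun_prop

/-- The exponent 1/2 turns the singularity into |v|^{-1/2}, which is locally integrable in every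
dimension n ≥ 1. -/
theorem exp_half_singWeight_le (x y : Space n) :
    Real.exp (1 / 2 * singWeight x y) ≤
      2 + (Metric.ball (0 : Space n) 1).indicator (fun v => (√‖v‖)⁻¹) (x - y) := by
  have h0 : 0 ≤ ‖x - y‖⁻¹ := by positivity
  have h1 : Real.exp (1 / 2 * singWeight x y) = √(1 + ‖x - y‖⁻¹) := by
    rw [singWeight, Real.sqrt_eq_rpow, Real.rpow_def_of_pos (by positivity)]
    ring_nf
  rw [h1]
  have h2 : √(1 + ‖x - y‖⁻¹) ≤ 1 + √(‖x - y‖⁻¹) := by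
    rw [Real.sqrt_le_left (by positivity)]
    nlinarith [Real.sq_sqrt h0, Real.sqrt_nonneg (‖x - y‖⁻¹)]
  refine h2.trans ?_
  by_cases h : x - y ∈ Metric.ball (0 : Space n) 1
  · rw [Set.indicator_of_mem h, Real.sqrt_inv]
    linarith
  · rw [Set.indicator_of_notMem h]
    have h3 : 1 ≤ ‖x - y‖ := by simpa using h
    have : √(‖x - y‖⁻¹) ≤ 1 := Real.sqrt_le_one.2 (inv_le_one_of_one_le₀ h3)
    linarith

/-- Bound of the logarithm by the weight and the singular part. -/
theorem abs_log_norm_sub_sub_logWeight_le {x y : Space n} (h : x ≠ y) :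
    |Real.log ‖x - y‖ - logWeight x| ≤ logWeight y + singWeight x y := by
  have h0 : 0 < ‖x - y‖ := norm_pos_iff.2 (sub_ne_zero.2 h)
  have hy := norm_nonneg y
  have hx := norm_nonneg x
  have hs := singWeight_nonneg x y
  rw [abs_le]
  constructor
  · have h1 : 1 + ‖x‖ ≤ (1 + ‖y‖) * (1 + ‖x - y‖) := by
      have : ‖x‖ ≤ ‖x - y‖ + ‖y‖ := by simpa using norm_add_le (x - y) y
      nlinarith [mul_nonneg hy h0.le]
    have h2 := Real.log_le_log (by positivity) h1
    rw [Real.log_mul (by positivity) (by positivity)] at h2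
    have h3 : singWeight x y = Real.log (1 + ‖x - y‖) - Real.log ‖x - y‖ := by
      rw [singWeight, ← Real.log_div (by positivity) h0.ne']
      congr 1
      field_simp
      ring
    unfold logWeight
    linarith
  · have h1 : ‖x - y‖ ≤ (1 + ‖x‖) * (1 + ‖y‖) := by
      nlinarith [norm_sub_le x y, mul_nonneg hx hy]
    have h2 := Real.log_le_log h0 h1
    rw [Real.log_mul (by positivity) (by positivity)] at h2
    unfold logWeight at *
    linarith

section

variable [NeZero n]

instance : Nontrivial (Space n) :=
  Module.nontrivial_of_finrank_pos (R := ℝ) (by simpa using Nat.pos_of_ne_zero (NeZero.ne n))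

theorem integrableOn_inv_sqrt_norm :
    IntegrableOn (fun v : Space n => (√‖v‖)⁻¹) (Metric.ball 0 1) := by
  -- Polar coordinates; on (0, 1) the Jacobian r^{n-1} is at most 1, and r^{-1/2} is integrable.
  rw [integrableOn_fun_norm_addHaar volume (f := fun r => (√r)⁻¹)]
  have h : IntegrableOn (fun r : ℝ => r ^ (-(1 / 2) : ℝ)) (Set.Ioo 0 1) :=
    (intervalIntegral.integrableOn_Ioo_rpow_iff one_pos).2 (by norm_num)
  refine Integrable.mono' h (by fun_prop) ((ae_restrict_iff' measurableSet_Ioo).2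
    (ae_of_all _ fun r hr => ?_))
  have h0 : 0 < r := hr.1
  rw [Real.rpow_neg h0.le, ← Real.sqrt_eq_rpow, smul_eq_mul, norm_mul,
    Real.norm_of_nonneg (by positivity : 0 ≤ (√r)⁻¹), norm_pow, Real.norm_of_nonneg h0.le]
  exact mul_le_of_le_one_left (by positivity) (pow_le_one₀ h0.le hr.2.le)

/-- Uniform exponential integrability of the logarithmic singularity. -/
theorem exists_integral_edgeWeight_mul_exp_singWeight_le {α : ℝ} (hα : 0 < α) (A : ℝ) :
    ∃ B, ∀ x : Space n,
      Integrable (fun y => edgeWeight α A y * Real.exp (1 / 2 * singWeight x y)) ∧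
      ∫ y, edgeWeight α A y * Real.exp (1 / 2 * singWeight x y) ≤ B := by
  obtain ⟨C, hC, h⟩ := edgeWeight_bounded (n := n) hα A
  set g : Space n → ℝ := (Metric.ball (0 : Space n) 1).indicator fun v => (√‖v‖)⁻¹ with hg
  have hgi : Integrable g :=
    (integrable_indicator_iff measurableSet_ball).2 integrableOn_inv_sqrt_norm
  have hg0 : ∀ v, 0 ≤ g v := fun v => Set.indicator_nonneg (fun v _ => by positivity) v
  -- The weight is bounded by `C` next to the singularity, so translation invariance makes the bound
  -- independent of x.
  refine ⟨∫ y : Space n, (2 * edgeWeight α A y + C * g y), fun x => ?_⟩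
  have hi : Integrable fun y => 2 * edgeWeight α A y + C * g (x - y) :=
    ((edgeWeight_integrable hα A).const_mul 2).add ((hgi.comp_sub_left x).const_mul C)
  have hb : ∀ y, edgeWeight α A y * Real.exp (1 / 2 * singWeight x y) ≤
      2 * edgeWeight α A y + C * g (x - y) := by
    intro y
    have h1 := exp_half_singWeight_le x y
    have h2 := edgeWeight_pos α A y
    calc edgeWeight α A y * Real.exp (1 / 2 * singWeight x y)
        ≤ edgeWeight α A y * (2 + g (x - y)) := by gcongr
      _ ≤ _ := by nlinarith [mul_le_mul_of_nonneg_right (h y) (hg0 (x - y))]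
  have hI : Integrable fun y => edgeWeight α A y * Real.exp (1 / 2 * singWeight x y) := by
    refine Integrable.mono' hi ?_ (ae_of_all _ fun y => ?_)
    · refine ((continuous_edgeWeight hα A).measurable.mul ?_).aestronglyMeasurable
      exact ((measurable_singWeight.comp (measurable_prodMk_left (x := x))).const_mul _).exp
    · rw [Real.norm_of_nonneg (mul_nonneg (edgeWeight_pos α A y).le (Real.exp_pos _).le)]
      exact hb y
  refine ⟨hI, (integral_mono hI hi hb).trans (le_of_eq ?_)⟩
  rw [integral_add ((edgeWeight_integrable hα A).const_mul 2) ((hgi.comp_sub_left x).const_mul C),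
    integral_add ((edgeWeight_integrable hα A).const_mul 2) (hgi.const_mul C)]
  congr 1
  rw [integral_const_mul, integral_const_mul, integral_sub_left_eq_self g volume x]

end

end LogGas

/-! ### Weighted energy and measures with a tame density -/

namespace LogGas

variable {n : ℕ}

/-- The weighted kernel as a function with values in `[0, ∞]`. -/
noncomputable def wKernel (x z : Space n) : ℝ≥0∞ := (weightedKernel x z).toENNReal

theorem wKernel_self (x : Space n) : wKernel x x = ⊤ := by
  rw [wKernel, weightedKernel, logKernel_self, EReal.top_add_coe, EReal.top_add_coe,
    EReal.toENNReal_top]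

theorem wKernel_of_ne {x z : Space n} (h : x ≠ z) :
    wKernel x z = ENNReal.ofReal (-Real.log ‖x - z‖ + logWeight x + logWeight z) := by
  rw [wKernel, weightedKernel, logKernel_of_ne h, ← EReal.coe_add, ← EReal.coe_add,
    EReal.toENNReal_of_ne_top (EReal.coe_ne_top _), EReal.toReal_coe]

theorem wKernel_comm (x z : Space n) : wKernel x z = wKernel z x := by
  rcases eq_or_ne x z with rfl | h
  · rfl
  · rw [wKernel_of_ne h, wKernel_of_ne h.symm, norm_sub_rev]
    ring_nf

/-- The regularized weighted kernel. -/
noncomputable def regWKernel (k : ℕ) (x z : Space n) : ℝ≥0∞ :=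
  ENNReal.ofReal (regKernel (1 / ((k : ℝ) + 1)) x z + logWeight x + logWeight z)

theorem measurable_regWKernel (k : ℕ) :
    Measurable fun p : Space n × Space n => regWKernel k p.1 p.2 := by
  unfold regWKernel
  have h1 := (continuous_regKernel (n := n) (d := 1 / ((k : ℝ) + 1)) (by positivity)).measurable
  have h2 := measurable_logWeight (n := n)
  fun_prop

theorem regWKernel_mono (x z : Space n) : Monotone fun k => regWKernel k x z := by
  intro j k hjk
  simp only [regWKernel, regKernel]
  refine ENNReal.ofReal_le_ofReal ?_
  have h : (1 / ((k : ℝ) + 1)) ^ 2 ≤ (1 / ((j : ℝ) + 1)) ^ 2 := by gcongr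
  have := Real.log_le_log (by positivity)
    (by linarith : (1 / ((k : ℝ) + 1)) ^ 2 + ‖x - z‖ ^ 2 ≤ (1 / ((j : ℝ) + 1)) ^ 2 + ‖x - z‖ ^ 2)
  linarith

theorem tendsto_regKernel {x z : Space n} (h : x ≠ z) {d : ℕ → ℝ}
    (hd : Tendsto d atTop (𝓝 0)) :
    Tendsto (fun k => regKernel (d k) x z) atTop (𝓝 (-Real.log ‖x - z‖)) := by
  have h0 : 0 < ‖x - z‖ := norm_pos_iff.2 (sub_ne_zero.2 h)
  have h1 : Tendsto (fun k : ℕ => d k ^ 2 + ‖x - z‖ ^ 2) atTop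
      (𝓝 (0 ^ 2 + ‖x - z‖ ^ 2)) := (hd.pow 2).add_const _
  have h2 := (h1.log (by positivity)).const_mul (-(1 / 2))
  have h3 : -(1 / 2) * Real.log (0 ^ 2 + ‖x - z‖ ^ 2) = -Real.log ‖x - z‖ := by
    rw [zero_pow two_ne_zero, zero_add, Real.log_pow]
    push_cast
    ring
  rw [h3] at h2
  exact h2

theorem tendsto_regWKernel (x z : Space n) :
    Tendsto (fun k => regWKernel k x z) atTop (𝓝 (wKernel x z)) := by
  rcases eq_or_ne x z with rfl | h
  · rw [wKernel_self]
    refine ENNReal.tendsto_ofReal_nhds_top.2 ?_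
    have h1 : ∀ k : ℕ, regKernel (1 / ((k : ℝ) + 1)) x x = Real.log ((k : ℝ) + 1) := by
      intro k
      rw [regKernel, sub_self, norm_zero, zero_pow two_ne_zero, add_zero, Real.log_pow,
      one_div ((k : ℝ) + 1),
        Real.log_inv]
      push_cast
      ring
    simp_rw [h1, add_assoc]
    exact tendsto_atTop_add_const_right _ _
      (Real.tendsto_log_atTop.comp
        (tendsto_atTop_add_const_right _ _ tendsto_natCast_atTop_atTop))
  · rw [wKernel_of_ne h]
    refine ENNReal.tendsto_ofReal ?_
    exact ((tendsto_regKernel h tendsto_one_div_add_atTop_nhds_zero_nat).add_const _).add_const _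

theorem measurable_wKernel : Measurable fun p : Space n × Space n => wKernel p.1 p.2 :=
  measurable_of_tendsto_metrizable measurable_regWKernel
    (tendsto_pi_nhds.2 fun p => tendsto_regWKernel p.1 p.2)

/-- The mutual weighted energy of two measures. -/
noncomputable def crossEnergy (μ ν : Measure (Space n)) : ℝ≥0∞ := ∫⁻ x, ∫⁻ z, wKernel x z ∂ν ∂μ

theorem crossEnergy_eq_lintegral_prod (μ ν : Measure (Space n)) [SFinite μ] [SFinite ν] :
    crossEnergy μ ν = ∫⁻ p : Space n × Space n, wKernel p.1 p.2 ∂(μ.prod ν) :=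
  (lintegral_prod _ measurable_wKernel.aemeasurable).symm

theorem crossEnergy_comm (μ ν : Measure (Space n)) [SFinite μ] [SFinite ν] :
    crossEnergy μ ν = crossEnergy ν μ := by
  rw [crossEnergy, lintegral_lintegral_swap measurable_wKernel.aemeasurable]
  simp_rw [wKernel_comm]
  rfl

theorem crossEnergy_add_left (μ₁ μ₂ ν : Measure (Space n)) :
    crossEnergy (μ₁ + μ₂) ν = crossEnergy μ₁ ν + crossEnergy μ₂ ν := lintegral_add_measure _ _ _

theorem crossEnergy_smul_left (c : ℝ≥0∞) (μ ν : Measure (Space n)) :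
    crossEnergy (c • μ) ν = c * crossEnergy μ ν := lintegral_smul_measure _ _

theorem crossEnergy_add_right (μ ν₁ ν₂ : Measure (Space n)) [SFinite μ] [SFinite ν₁] [SFinite ν₂] :
    crossEnergy μ (ν₁ + ν₂) = crossEnergy μ ν₁ + crossEnergy μ ν₂ := by
  rw [crossEnergy_comm, crossEnergy_add_left, crossEnergy_comm ν₁, crossEnergy_comm ν₂]

theorem crossEnergy_smul_right (c : ℝ≥0∞) (μ ν : Measure (Space n)) [SFinite μ] [SFinite ν] :
    crossEnergy μ (c • ν) = c * crossEnergy μ ν := by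
  rw [crossEnergy_comm, crossEnergy_smul_left, crossEnergy_comm]

theorem crossEnergy_mono {μ₁ μ₂ ν₁ ν₂ : Measure (Space n)} (hμ : μ₁ ≤ μ₂) (hν : ν₁ ≤ ν₂) :
    crossEnergy μ₁ ν₁ ≤ crossEnergy μ₂ ν₂ :=
  lintegral_mono' hμ fun _ => lintegral_mono' hν le_rfl

/-- Monotone convergence in the regularization. Infinite limits are allowed, so no finite energy has
to be assumed. -/
theorem tendsto_lintegral_regWKernel (μ ν : Measure (Space n)) [SFinite μ] [SFinite ν] :
    Tendsto (fun k => ∫⁻ p : Space n × Space n, regWKernel k p.1 p.2 ∂(μ.prod ν)) atTop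
      (𝓝 (crossEnergy μ ν)) := by
  rw [crossEnergy_eq_lintegral_prod]
  exact lintegral_tendsto_of_tendsto_of_monotone
    (fun k => (measurable_regWKernel k).aemeasurable)
    (ae_of_all _ fun p => regWKernel_mono p.1 p.2)
    (ae_of_all _ fun p => tendsto_regWKernel p.1 p.2)

/-- The weighted energy is convex on probability measures with a finite logarithmic moment. -/
theorem two_mul_crossEnergy_le {μ ν : Measure (Space n)} [IsProbabilityMeasure μ]
    [IsProbabilityMeasure ν] (hμ : Integrable logWeight μ) (hν : Integrable logWeight ν) :
    2 * crossEnergy μ ν ≤ crossEnergy μ μ + crossEnergy ν ν := by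
  refine le_of_tendsto_of_tendsto'
    (ENNReal.Tendsto.const_mul (tendsto_lintegral_regWKernel μ ν) (Or.inr (by simp)))
    ((tendsto_lintegral_regWKernel μ μ).add (tendsto_lintegral_regWKernel ν ν)) fun k => ?_
  set d : ℝ := 1 / ((k : ℝ) + 1) with hd
  have hd0 : 0 < d := by positivity
  have hd1 : d ≤ 1 := by
    rw [hd, div_le_one (by positivity)]
    linarith [(Nat.cast_nonneg k : (0 : ℝ) ≤ k)]
  have hpos : ∀ p : Space n × Space n, 0 ≤ regKernel d p.1 p.2 + logWeight p.1 + logWeight p.2 :=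
    fun p => by linarith [neg_le_regKernel hd0 hd1 p.1 p.2]
  have key : ∀ (μ ν : Measure (Space n)) [IsProbabilityMeasure μ] [IsProbabilityMeasure ν],
      Integrable logWeight μ → Integrable logWeight ν →
      0 ≤ (∫ p : Space n × Space n, regKernel d p.1 p.2 ∂(μ.prod ν)) + (∫ x, logWeight x ∂μ) +
          ∫ x, logWeight x ∂ν ∧
      ∫⁻ p : Space n × Space n, regWKernel k p.1 p.2 ∂(μ.prod ν) =
        ENNReal.ofReal ((∫ p : Space n × Space n, regKernel d p.1 p.2 ∂(μ.prod ν)) +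
          (∫ x, logWeight x ∂μ) + ∫ x, logWeight x ∂ν) := by
    intro μ ν _ _ hμ hν
    have h1 := integrable_regKernel hd0 hd1 hμ hν
    have h2 : Integrable (fun p : Space n × Space n => logWeight p.1) (μ.prod ν) := hμ.comp_fst ν
    have h3 : Integrable (fun p : Space n × Space n => logWeight p.2) (μ.prod ν) := hν.comp_snd μ
    have h12 : Integrable (fun p : Space n × Space n => regKernel d p.1 p.2 + logWeight p.1)
      (μ.prod ν) := h1.add h2
    have h123 : Integrable (fun p : Space n × Space n =>
      regKernel d p.1 p.2 + logWeight p.1 + logWeight p.2) (μ.prod ν) := h12.add h3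
    have h4 : ∫ p : Space n × Space n, (regKernel d p.1 p.2 + logWeight p.1 + logWeight p.2)
        ∂(μ.prod ν) = (∫ p : Space n × Space n, regKernel d p.1 p.2 ∂(μ.prod ν)) +
          (∫ x, logWeight x ∂μ) + ∫ x, logWeight x ∂ν := by
      rw [integral_add h12 h3, integral_add h1 h2, integral_fun_fst (f := logWeight),
        integral_fun_snd (f := logWeight)]
      simp
    refine ⟨h4 ▸ integral_nonneg hpos, ?_⟩
    rw [← h4, ofReal_integral_eq_lintegral_ofReal h123 (ae_of_all _ hpos)]
    rfl
  -- The moments of ϑ enter both sides with the same coefficients, since both measures have mass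
  -- one. They cancel and leave the inequality for `regKernel`.
  have hc := two_mul_integral_regKernel_le hd0 hd1 hμ hν
  rw [(key μ ν hμ hν).2, (key μ μ hμ hμ).2, (key ν ν hν hν).2,
    ← ENNReal.ofReal_add (key μ μ hμ hμ).1 (key ν ν hν hν).1, two_mul,
    ← ENNReal.ofReal_add (key μ ν hμ hν).1 (key μ ν hμ hν).1]
  exact ENNReal.ofReal_le_ofReal (by linarith)

theorem wKernel_le {x y : Space n} (h : x ≠ y) :
    wKernel x y ≤ ENNReal.ofReal (2 * logWeight y + singWeight x y) := by
  rw [wKernel_of_ne h]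
  refine ENNReal.ofReal_le_ofReal ?_
  linarith [(abs_le.1 (abs_log_norm_sub_sub_logWeight_le h)).1]

/-! ### Measures with a tame density -/

/-- `μ` has a density with respect to Lebesgue measure which is at most `C (1 + |x|)^A e^{-V}`. -/
def Tame (α : ℝ) (μ : Measure (Space n)) : Prop :=
  ∃ (p : Space n → ℝ) (C A : ℝ), Measurable p ∧ (∀ x, 0 ≤ p x) ∧ (∀ x, p x ≤ C * edgeWeight α A x) ∧
    μ = volume.withDensity fun x => ENNReal.ofReal (p x)

theorem Tame.absolutelyContinuous {α : ℝ} {μ : Measure (Space n)} (h : Tame α μ) :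
    μ ≪ volume := by
  obtain ⟨p, C, A, -, -, -, rfl⟩ := h
  exact withDensity_absolutelyContinuous _ _

theorem volume_ae_ne [NeZero n] (x : Space n) : ∀ᵐ y, x ≠ y := by
  have : ∀ᵐ y : Space n, y ≠ x := by simp [ae_iff]
  exact this.mono fun y hy => hy.symm

theorem Tame.ae_ne {α : ℝ} [NeZero n] {μ : Measure (Space n)} (h : Tame α μ) (x : Space n) :
    ∀ᵐ y ∂μ, x ≠ y := h.absolutelyContinuous.ae_le (volume_ae_ne x)

/-- Uniform exponential moments of tame measures. -/
theorem Tame.exists_integral_exp_le {α : ℝ} [NeZero n] (hα : 0 < α) {μ : Measure (Space n)}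
    (h : Tame α μ) (s : ℝ) :
    ∃ B, ∀ x : Space n,
      Integrable (fun y => Real.exp (s * logWeight y + 1 / 2 * singWeight x y)) μ ∧
      ∫ y, Real.exp (s * logWeight y + 1 / 2 * singWeight x y) ∂μ ≤ B := by
  obtain ⟨p, C, A, hp, hp0, hpC, rfl⟩ := h
  -- The factor e^{sϑ} is absorbed by moving the exponent of the weight from A to A + s.
  obtain ⟨B, hB⟩ := exists_integral_edgeWeight_mul_exp_singWeight_le (n := n) hα (A + s)
  have hC : 0 ≤ C := by
    have := (hp0 0).trans (hpC 0)
    exact nonneg_of_mul_nonneg_left this (edgeWeight_pos α A 0)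
  refine ⟨C * B, fun x => ?_⟩
  have hb : ∀ y, p y * Real.exp (s * logWeight y + 1 / 2 * singWeight x y) ≤
      C * (edgeWeight α (A + s) y * Real.exp (1 / 2 * singWeight x y)) := by
    intro y
    rw [edgeWeight_add, Real.exp_add]
    have := mul_le_mul_of_nonneg_right (hpC y)
      (mul_pos (Real.exp_pos (s * logWeight y)) (Real.exp_pos (1 / 2 * singWeight x y))).le
    linarith
  have hsm : Measurable fun y => Real.exp (s * logWeight y + 1 / 2 * singWeight x y) :=
    ((measurable_logWeight.const_mul _).add
      ((measurable_singWeight.comp (measurable_prodMk_left (x := x))).const_mul _)).exp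
  have hI : Integrable fun y => p y * Real.exp (s * logWeight y + 1 / 2 * singWeight x y) := by
    refine Integrable.mono' ((hB x).1.const_mul C) (hp.mul hsm).aestronglyMeasurable
      (ae_of_all _ fun y => ?_)
    rw [Real.norm_of_nonneg (mul_nonneg (hp0 y) (Real.exp_pos _).le)]
    exact hb y
  constructor
  · rw [integrable_withDensity_iff_integrable_smul' hp.ennreal_ofReal
      (ae_of_all _ fun _ => ENNReal.ofReal_lt_top)]
    refine hI.congr (ae_of_all _ fun y => ?_)
    simp only [smul_eq_mul]
    rw [ENNReal.toReal_ofReal (hp0 y)]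
  · rw [integral_withDensity_eq_integral_toReal_smul hp.ennreal_ofReal
      (ae_of_all _ fun _ => ENNReal.ofReal_lt_top)]
    have : ∀ y, (ENNReal.ofReal (p y)).toReal •
        Real.exp (s * logWeight y + 1 / 2 * singWeight x y) =
        p y * Real.exp (s * logWeight y + 1 / 2 * singWeight x y) := fun y => by
      rw [ENNReal.toReal_ofReal (hp0 y), smul_eq_mul]
    simp_rw [this]
    refine (integral_mono hI ((hB x).1.const_mul C) hb).trans ?_
    rw [integral_const_mul]
    exact mul_le_mul_of_nonneg_left (hB x).2 hC

theorem Tame.exists_integral_le {α : ℝ} [NeZero n] (hα : 0 < α) {μ : Measure (Space n)}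
    (h : Tame α μ) (s : ℝ) :
    ∃ B, ∀ x : Space n, Integrable (fun y => s * logWeight y + singWeight x y) μ ∧
      ∫ y, (s * logWeight y + singWeight x y) ∂μ ≤ B := by
  -- Halving s matches the coefficient 1/2 of the singular part, so that v ≤ 2e^{v/2} covers both
  -- terms at once.
  obtain ⟨B, hB⟩ := h.exists_integral_exp_le hα (|s| / 2)
  refine ⟨2 * B, fun x => ?_⟩
  have hb : ∀ y, |s * logWeight y + singWeight x y| ≤
      2 * Real.exp (|s| / 2 * logWeight y + 1 / 2 * singWeight x y) := by
    intro y
    have h1 := Real.add_one_le_exp (|s| / 2 * logWeight y + 1 / 2 * singWeight x y)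
    have h2 := singWeight_nonneg x y
    have h3 := logWeight_nonneg y
    have h4 := abs_add_le (s * logWeight y) (singWeight x y)
    rw [abs_mul, abs_of_nonneg h2, abs_of_nonneg h3] at h4
    linarith
  have hI : Integrable (fun y => s * logWeight y + singWeight x y) μ := by
    refine Integrable.mono' ((hB x).1.const_mul 2) ?_ (ae_of_all _ hb)
    exact ((measurable_logWeight.const_mul _).add
      (measurable_singWeight.comp (measurable_prodMk_left (x := x)))).aestronglyMeasurable
  refine ⟨hI, (integral_mono hI ((hB x).1.const_mul 2)
    fun y => (le_abs_self _).trans (hb y)).trans ?_⟩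
  rw [integral_const_mul]
  linarith [(hB x).2]

theorem Tame.integrable_logWeight {α : ℝ} [NeZero n] (hα : 0 < α) {μ : Measure (Space n)}
    (h : Tame α μ) : Integrable logWeight μ := by
  obtain ⟨B, hB⟩ := h.exists_integral_le hα 1
  refine Integrable.mono' (hB 0).1 measurable_logWeight.aestronglyMeasurable
    (ae_of_all _ fun y => ?_)
  rw [Real.norm_of_nonneg (logWeight_nonneg y)]
  linarith [singWeight_nonneg 0 y]

theorem Tame.exists_lintegral_wKernel_le {α : ℝ} [NeZero n] (hα : 0 < α) {μ : Measure (Space n)}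
    (h : Tame α μ) : ∃ B : ℝ, ∀ x : Space n, ∫⁻ y, wKernel x y ∂μ ≤ ENNReal.ofReal B := by
  obtain ⟨B, hB⟩ := h.exists_integral_le hα 2
  refine ⟨B, fun x => ?_⟩
  refine (lintegral_mono_ae ((h.ae_ne x).mono fun y hy => wKernel_le hy)).trans ?_
  rw [← ofReal_integral_eq_lintegral_ofReal (hB x).1 (ae_of_all _ fun y => by
    simp only [Pi.zero_apply]
    linarith [singWeight_nonneg x y, logWeight_nonneg y])]
  exact ENNReal.ofReal_le_ofReal (hB x).2

theorem Tame.crossEnergy_lt_top {α : ℝ} [NeZero n] (hα : 0 < α) {μ : Measure (Space n)}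
    [IsFiniteMeasure μ] (h : Tame α μ) : crossEnergy μ μ < ⊤ := by
  obtain ⟨B, hB⟩ := h.exists_lintegral_wKernel_le hα
  calc crossEnergy μ μ ≤ ∫⁻ _, ENNReal.ofReal B ∂μ := lintegral_mono hB
    _ < ⊤ := by
      rw [lintegral_const]
      exact ENNReal.mul_lt_top ENNReal.ofReal_lt_top (measure_lt_top μ _)

theorem toReal_logKernel_of_ne {x z : Space n} (h : x ≠ z) :
    (logKernel x z).toReal = -Real.log ‖x - z‖ := by
  rw [logKernel_of_ne h, EReal.toReal_coe]

theorem toReal_logKernel (x z : Space n) : (logKernel x z).toReal = -Real.log ‖x - z‖ := by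
  rcases eq_or_ne x z with rfl | h
  -- Both default values vanish on the diagonal: `EReal.toReal ⊤ = 0` and `Real.log 0 = 0`.
  · simp [logKernel_self]
  · exact toReal_logKernel_of_ne h

end LogGas

/-! ### Entropy and Hellinger distance of densities -/

namespace LogGas

open InformationTheory

/-! ### Pointwise inequalities for the entropy -/

/-- Relative entropy dominates the squared Hellinger distance already pointwise: apply log t ≤ t - 1
at t = √b/√a. -/
theorem sq_sqrt_sub_sqrt_le {a b : ℝ} (ha : 0 ≤ a) (hb : 0 < b) :
    (√a - √b) ^ 2 ≤ a * Real.log (a / b) - a + b := by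
  rcases ha.eq_or_lt with rfl | ha
  · simp [Real.sq_sqrt hb.le]
  have hsa := Real.sqrt_pos.2 ha
  have hsb := Real.sqrt_pos.2 hb
  have h1 : Real.log (a / b) = -(2 * Real.log (√b / √a)) := by
    rw [Real.log_div ha.ne' hb.ne', Real.log_div hsb.ne' hsa.ne', Real.log_sqrt ha.le,
      Real.log_sqrt hb.le]
    ring
  have h2 := Real.log_le_sub_one_of_pos (div_pos hsb hsa)
  have h3 : a * (√b / √a) = √a * √b := by
    have := Real.mul_self_sqrt ha.le
    field_simp
    nlinarith
  rw [h1]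
  nlinarith [Real.sq_sqrt ha.le, Real.sq_sqrt hb.le, mul_le_mul_of_nonneg_left h2 ha.le]

/-- The convexity gap at the midpoint m is half the sum of the pointwise relative entropies of a and
b with respect to m. Each is at least a squared difference of square roots, and the triangle
inequality combines the two. -/
theorem klFun_midpoint {a b : ℝ} (ha : 0 ≤ a) (hb : 0 ≤ b) :
    klFun ((a + b) / 2) + (√a - √b) ^ 2 / 4 ≤ (klFun a + klFun b) / 2 := by
  rcases (add_nonneg ha hb).eq_or_lt with h | h
  · have h1 : a = 0 := by linarith
    have h2 : b = 0 := by linarith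
    simp [h1, h2]
  set m := (a + b) / 2 with hm
  have hm0 : 0 < m := by positivity
  have key : ∀ {c : ℝ}, 0 ≤ c → c * Real.log (c / m) = c * Real.log c - c * Real.log m := by
    intro c hc
    rcases hc.eq_or_lt with rfl | hc
    · simp
    · rw [Real.log_div hc.ne' hm0.ne']; ring
  have h1 := sq_sqrt_sub_sqrt_le ha hm0
  have h2 := sq_sqrt_sub_sqrt_le hb hm0
  rw [key ha] at h1
  rw [key hb] at h2
  have h3 : (√a - √b) ^ 2 ≤ 2 * (√a - √m) ^ 2 + 2 * (√b - √m) ^ 2 := by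
    nlinarith [sq_nonneg ((√a - √m) + (√b - √m))]
  have h4 : m * Real.log m = (a * Real.log m + b * Real.log m) / 2 := by rw [hm]; ring
  simp only [klFun_apply]
  have h5 : a + b = 2 * m := by rw [hm]; ring
  nlinarith

/-- Young's inequality for the dual pair a log a - a and e^t. It turns exponential integrability
under the reference measure into integrability under any density of finite entropy. -/
theorem mul_le_klFun_add_exp {a : ℝ} (ha : 0 ≤ a) (t : ℝ) : a * t ≤ klFun a + Real.exp t := by
  rw [klFun_apply]
  rcases ha.eq_or_lt with rfl | ha
  · have := Real.exp_pos t
    simp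
    linarith
  · have h := Real.add_one_le_exp (t - Real.log a)
    rw [Real.exp_sub, Real.exp_log ha, le_div_iff₀ ha] at h
    linarith

/-! ### Probability densities -/

variable {E : Type*} [MeasurableSpace E]

/-- `f` is a probability density with respect to `ν`. -/
structure IsDens (ν : Measure E) (f : E → ℝ) : Prop where
  measurable : Measurable f
  nonneg : ∀ x, 0 ≤ f x
  lintegral_eq : ∫⁻ x, ENNReal.ofReal (f x) ∂ν = 1

/-- The measure with density `f` with respect to `ν`. -/
noncomputable def dens (ν : Measure E) (f : E → ℝ) : Measure E :=
  ν.withDensity fun x => ENNReal.ofReal (f x)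

/-- The relative entropy of a density. -/
noncomputable def entropy (ν : Measure E) (f : E → ℝ) : ℝ≥0∞ :=
  ∫⁻ x, ENNReal.ofReal (klFun (f x)) ∂ν

variable {ν : Measure E} [IsProbabilityMeasure ν] {f g : E → ℝ}

theorem IsDens.isProbabilityMeasure {ν : Measure E} (hf : IsDens ν f) :
    IsProbabilityMeasure (dens ν f) :=
  ⟨by rw [dens, withDensity_apply _ MeasurableSet.univ, setLIntegral_univ, hf.lintegral_eq]⟩

theorem IsDens.integrable {ν : Measure E} (hf : IsDens ν f) : Integrable f ν :=
  ⟨hf.measurable.aestronglyMeasurable, by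
    rw [hasFiniteIntegral_iff_ofReal (ae_of_all _ hf.nonneg), hf.lintegral_eq]; simp⟩

theorem IsDens.integral_eq {ν : Measure E} (hf : IsDens ν f) : ∫ x, f x ∂ν = 1 := by
  rw [integral_eq_lintegral_of_nonneg_ae (ae_of_all _ hf.nonneg)
    hf.measurable.aestronglyMeasurable, hf.lintegral_eq, ENNReal.toReal_one]

theorem isDens_of_integral {ν : Measure E} (hm : Measurable f) (h0 : ∀ x, 0 ≤ f x)
    (hi : Integrable f ν) (h1 : ∫ x, f x ∂ν = 1) : IsDens ν f :=
  ⟨hm, h0, by rw [← ofReal_integral_eq_lintegral_ofReal hi (ae_of_all _ h0), h1,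
    ENNReal.ofReal_one]⟩

theorem isDens_one : IsDens ν fun _ => (1 : ℝ) :=
  ⟨measurable_const, fun _ => zero_le_one, by simp⟩

theorem IsDens.convex {ν : Measure E} (hf : IsDens ν f) (hg : IsDens ν g) {t : ℝ} (h0 : 0 ≤ t)
    (h1 : t ≤ 1) : IsDens ν fun x => (1 - t) * f x + t * g x := by
  refine isDens_of_integral ((hf.measurable.const_mul _).add (hg.measurable.const_mul _))
    (fun x => add_nonneg (mul_nonneg (by linarith) (hf.nonneg x)) (mul_nonneg h0 (hg.nonneg x)))
    ((hf.integrable.const_mul _).add (hg.integrable.const_mul _)) ?_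
  rw [integral_add (hf.integrable.const_mul _) (hg.integrable.const_mul _), integral_const_mul,
    integral_const_mul, hf.integral_eq, hg.integral_eq]
  ring

theorem dens_convex {ν : Measure E} (hf : IsDens ν f) (hg : IsDens ν g) {t : ℝ} (h0 : 0 ≤ t)
    (h1 : t ≤ 1) : dens ν (fun x => (1 - t) * f x + t * g x) =
      ENNReal.ofReal (1 - t) • dens ν f + ENNReal.ofReal t • dens ν g := by
  have hfm := hf.measurable.ennreal_ofReal
  have hgm := hg.measurable.ennreal_ofReal
  rw [dens, dens, dens, ← withDensity_smul _ hfm, ← withDensity_smul _ hgm,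
    ← withDensity_add_left (hfm.const_smul _)]
  congr 1
  ext x
  simp only [Pi.add_apply, Pi.smul_apply, smul_eq_mul]
  rw [ENNReal.ofReal_add (mul_nonneg (by linarith) (hf.nonneg x)) (mul_nonneg h0 (hg.nonneg x)),
    ENNReal.ofReal_mul (by linarith), ENNReal.ofReal_mul h0]

theorem IsDens.klDiv_eq (hf : IsDens ν f) : klDiv (dens ν f) ν = entropy ν f := by
  have := hf.isProbabilityMeasure
  have hac : dens ν f ≪ ν := withDensity_absolutelyContinuous _ _
  rw [klDiv_eq_lintegral_klFun_of_ac hac]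
  refine lintegral_congr_ae ?_
  filter_upwards [Measure.rnDeriv_withDensity ν hf.measurable.ennreal_ofReal] with x hx
  rw [dens, hx, ENNReal.toReal_ofReal (hf.nonneg x)]

theorem exists_isDens (μ : Measure E) [IsProbabilityMeasure μ] (h : klDiv μ ν ≠ ⊤) :
    ∃ f, IsDens ν f ∧ μ = dens ν f := by
  have hac := (klDiv_ne_top_iff.1 h).1
  have hd : dens ν (fun x => (μ.rnDeriv ν x).toReal) = μ := by
    rw [dens, ← Measure.withDensity_rnDeriv_eq μ ν hac]
    refine withDensity_congr_ae ?_
    filter_upwards [Measure.rnDeriv_lt_top μ ν] with x hx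
    rw [Measure.withDensity_rnDeriv_eq μ ν hac, ENNReal.ofReal_toReal hx.ne]
  refine ⟨fun x => (μ.rnDeriv ν x).toReal, ⟨(Measure.measurable_rnDeriv μ ν).ennreal_toReal,
    fun x => ENNReal.toReal_nonneg, ?_⟩, hd.symm⟩
  have h1 : dens ν (fun x => (μ.rnDeriv ν x).toReal) Set.univ = 1 := by rw [hd]; simp
  rwa [dens, withDensity_apply _ MeasurableSet.univ, setLIntegral_univ] at h1

theorem lintegral_dens {ν : Measure E} (hf : IsDens ν f) {u : E → ℝ≥0∞} (hu : Measurable u) :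
    ∫⁻ x, u x ∂(dens ν f) = ∫⁻ x, ENNReal.ofReal (f x) * u x ∂ν :=
  lintegral_withDensity_eq_lintegral_mul _ hf.measurable.ennreal_ofReal hu

theorem integrable_dens_iff {ν : Measure E} (hf : IsDens ν f) {u : E → ℝ} :
    Integrable u (dens ν f) ↔ Integrable (fun x => f x * u x) ν := by
  rw [dens, integrable_withDensity_iff_integrable_smul' hf.measurable.ennreal_ofReal
    (ae_of_all _ fun _ => ENNReal.ofReal_lt_top)]
  simp_rw [ENNReal.toReal_ofReal (hf.nonneg _), smul_eq_mul]

theorem integrable_klFun {ν : Measure E} (hf : IsDens ν f) (h : entropy ν f ≠ ⊤) :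
    Integrable (fun x => klFun (f x)) ν :=
  ⟨(measurable_klFun.comp hf.measurable).aestronglyMeasurable, by
    rw [hasFiniteIntegral_iff_ofReal (ae_of_all _ fun x => klFun_nonneg (hf.nonneg x))]
    exact lt_top_iff_ne_top.2 h⟩

theorem entropy_eq_ofReal {ν : Measure E} (hf : IsDens ν f) (h : entropy ν f ≠ ⊤) :
    entropy ν f = ENNReal.ofReal (∫ x, klFun (f x) ∂ν) :=
  (ofReal_integral_eq_lintegral_ofReal (integrable_klFun hf h)
    (ae_of_all _ fun x => klFun_nonneg (hf.nonneg x))).symm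

theorem integrable_of_integrable_exp {ν : Measure E} {u : E → ℝ} (hum : Measurable u)
    (hu0 : ∀ x, 0 ≤ u x) (hu : Integrable (fun x => Real.exp (u x)) ν) (hf : IsDens ν f)
    (h : entropy ν f ≠ ⊤) : Integrable u (dens ν f) := by
  rw [integrable_dens_iff hf]
  refine Integrable.mono' ((integrable_klFun hf h).add hu)
    (hf.measurable.mul hum).aestronglyMeasurable (ae_of_all _ fun x => ?_)
  rw [Real.norm_of_nonneg (mul_nonneg (hf.nonneg x) (hu0 x))]
  exact mul_le_klFun_add_exp (hf.nonneg x) (u x)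

/-- The squared Hellinger distance of two densities. -/
noncomputable def hellingerSq (ν : Measure E) (f g : E → ℝ) : ℝ≥0∞ :=
  ∫⁻ x, ENNReal.ofReal ((√(f x) - √(g x)) ^ 2) ∂ν

theorem entropy_midpoint {ν : Measure E} (hf : IsDens ν f) (hg : IsDens ν g) :
    2 * entropy ν (fun x => (1 - 1 / 2) * f x + 1 / 2 * g x) + 2⁻¹ * hellingerSq ν f g ≤
      entropy ν f + entropy ν g := by
  have hfm := hf.measurable
  have hgm := hg.measurable
  have hk := measurable_klFun
  rw [entropy, entropy, entropy, hellingerSq, ← lintegral_const_mul _ (by fun_prop),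
    ← lintegral_const_mul _ (by fun_prop), ← lintegral_add_left (by fun_prop),
    ← lintegral_add_left (by fun_prop)]
  refine lintegral_mono fun x => ?_
  have h := klFun_midpoint (hf.nonneg x) (hg.nonneg x)
  rw [show (1 - 1 / 2) * f x + 1 / 2 * g x = (f x + g x) / 2 by ring,
    show (2 : ℝ≥0∞) = ENNReal.ofReal 2 by norm_num, ← ENNReal.ofReal_inv_of_pos (by norm_num),
    ← ENNReal.ofReal_mul (by norm_num), ← ENNReal.ofReal_mul (by positivity),
    ← ENNReal.ofReal_add (mul_nonneg (by norm_num)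
      (klFun_nonneg (by linarith [hf.nonneg x, hg.nonneg x]))) (by positivity),
    ← ENNReal.ofReal_add (klFun_nonneg (hf.nonneg x)) (klFun_nonneg (hg.nonneg x))]
  exact ENNReal.ofReal_le_ofReal (by linarith)

/-- The Hellinger distance is the L² distance of square roots, which gives access to L²
completeness. -/
theorem hellingerSq_eq_eLpNorm (ν : Measure E) (f g : E → ℝ) :
    hellingerSq ν f g = eLpNorm ((fun x => √(f x)) - fun x => √(g x)) 2 ν ^ 2 := by
  rw [eLpNorm_eq_lintegral_rpow_enorm_toReal (by norm_num) (by norm_num), hellingerSq]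
  simp only [ENNReal.toReal_ofNat, ENNReal.rpow_ofNat, one_div, Pi.sub_apply]
  rw [← ENNReal.rpow_natCast, ← ENNReal.rpow_mul]
  norm_num
  refine lintegral_congr fun x => ?_
  rw [← ofReal_norm, ← ENNReal.ofReal_pow (norm_nonneg _), Real.norm_eq_abs, sq_abs]

theorem hellingerSq_eq_zero {ν : Measure E} (hf : IsDens ν f) (hg : IsDens ν g)
    (h : hellingerSq ν f g = 0) : f =ᵐ[ν] g := by
  have hfm := hf.measurable
  have hgm := hg.measurable
  rw [hellingerSq, lintegral_eq_zero_iff (by fun_prop)] at h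
  filter_upwards [h] with x hx
  simp only [Pi.zero_apply, ENNReal.ofReal_eq_zero] at hx
  have h1 : √(f x) - √(g x) = 0 := pow_eq_zero_iff two_ne_zero |>.1 (le_antisymm hx (sq_nonneg _))
  rw [← Real.sq_sqrt (hf.nonneg x), ← Real.sq_sqrt (hg.nonneg x), sub_eq_zero.1 h1]

/-- Densities which are Cauchy in Hellinger distance converge almost everywhere to a density. -/
theorem exists_tendsto_of_hellingerSq {ν : Measure E} {f : ℕ → E → ℝ} (hf : ∀ k, IsDens ν (f k))
    (h : ∀ N j k, N ≤ j → N ≤ k → hellingerSq ν (f j) (f k) < (2⁻¹ ^ N) ^ 2) :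
    ∃ g, IsDens ν g ∧ ∀ᵐ x ∂ν, Tendsto (fun k => f k x) atTop (𝓝 (g x)) := by
  set s : ℕ → E → ℝ := fun k x => √(f k x) with hs
  have hsm : ∀ k, Measurable (s k) := fun k => (hf k).measurable.sqrt
  have hcau : ∀ N j k : ℕ, N ≤ j → N ≤ k → eLpNorm (s j - s k) 2 ν < 2⁻¹ ^ N := by
    intro N j k hj hk
    have := h N j k hj hk
    rw [hellingerSq_eq_eLpNorm] at this
    exact lt_of_pow_lt_pow_left' 2 this
  have hB : ∑' i : ℕ, (2⁻¹ : ℝ≥0∞) ^ i ≠ ⊤ := by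
    rw [ENNReal.tsum_geometric]
    simp
  -- The rate 2^{-N} is summable, hence the whole sequence converges almost everywhere, with no
  -- passage to a subsequence.
  have hlim := Lp.ae_tendsto_of_cauchy_eLpNorm (fun k => (hsm k).aestronglyMeasurable)
    (by norm_num : (1 : ℝ≥0∞) ≤ 2) hB hcau
  obtain ⟨G, hG, hGlim⟩ := measurable_limit_of_tendsto_metrizable_ae
    (fun k => (hsm k).aemeasurable) hlim
  have hconv := Lp.cauchy_tendsto_of_tendsto (p := 2) (fun k => (hsm k).aestronglyMeasurable) G hB
    hcau hGlim
  have hnorm : ∀ (u : E → ℝ), IsDens ν u → eLpNorm (fun x => √(u x)) 2 ν = 1 := by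
    intro u hu
    rw [eLpNorm_eq_lintegral_rpow_enorm_toReal (by norm_num) (by norm_num)]
    have : ∀ x, ‖√(u x)‖ₑ ^ (2 : ℝ≥0∞).toReal = ENNReal.ofReal (u x) := by
      intro x
      rw [← ofReal_norm, ENNReal.toReal_ofNat, ENNReal.rpow_ofNat,
        ← ENNReal.ofReal_pow (norm_nonneg _), Real.norm_eq_abs, sq_abs, Real.sq_sqrt (hu.nonneg x)]
    simp_rw [this]
    rw [hu.lintegral_eq, ENNReal.one_rpow]
  -- The square roots have unit norm and converge in L², so no mass is lost and G² integrates to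
  -- one.
  have hG2 : eLpNorm G 2 ν = 1 := by
    apply le_antisymm
    · have hle : ∀ k, eLpNorm G 2 ν ≤ 1 + eLpNorm (s k - G) 2 ν := by
        intro k
        have h1 : G = s k - (s k - G) := by abel
        calc eLpNorm G 2 ν = eLpNorm (s k - (s k - G)) 2 ν := by rw [← h1]
          _ ≤ eLpNorm (s k) 2 ν + eLpNorm (s k - G) 2 ν :=
              eLpNorm_sub_le (hsm k).aestronglyMeasurable
                ((hsm k).sub hG).aestronglyMeasurable (by norm_num)
          _ = _ := by rw [hnorm _ (hf k)]
      have := ge_of_tendsto' (hconv.const_add 1) hle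
      simpa using this
    · have hle : ∀ k, 1 ≤ eLpNorm G 2 ν + eLpNorm (s k - G) 2 ν := by
        intro k
        have h1 : s k = G + (s k - G) := by abel
        calc 1 = eLpNorm (s k) 2 ν := (hnorm _ (hf k)).symm
          _ = eLpNorm (G + (s k - G)) 2 ν := by rw [← h1]
          _ ≤ _ := eLpNorm_add_le hG.aestronglyMeasurable
              ((hsm k).sub hG).aestronglyMeasurable (by norm_num)
      have := ge_of_tendsto' (hconv.const_add (eLpNorm G 2 ν)) hle
      simpa using this
  refine ⟨fun x => G x ^ 2, ⟨hG.pow_const 2, fun x => sq_nonneg _, ?_⟩, ?_⟩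
  · rw [eLpNorm_eq_lintegral_rpow_enorm_toReal (by norm_num) (by norm_num)] at hG2
    have : ∀ x, ‖G x‖ₑ ^ (2 : ℝ≥0∞).toReal = ENNReal.ofReal (G x ^ 2) := by
      intro x
      rw [← ofReal_norm, ENNReal.toReal_ofNat, ENNReal.rpow_ofNat,
        ← ENNReal.ofReal_pow (norm_nonneg _), Real.norm_eq_abs, sq_abs]
    simp_rw [this] at hG2
    have h2 := congrArg (fun t : ℝ≥0∞ => t ^ (2 : ℝ)) hG2
    simp only [← ENNReal.rpow_mul, ENNReal.one_rpow] at h2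
    rwa [ENNReal.toReal_ofNat, one_div_mul_cancel two_ne_zero, ENNReal.rpow_one] at h2
  · filter_upwards [hGlim] with x hx
    have := hx.pow 2
    refine this.congr fun k => ?_
    exact Real.sq_sqrt ((hf k).nonneg x)

end LogGas

/-! ### Existence of a minimizer of the free energy -/

namespace LogGas

open InformationTheory

variable {n : ℕ} {α : ℝ} {ν : Measure (Space n)} {f g : Space n → ℝ}

/-! ### The free energy functional on densities -/

/-- The free energy of a density. -/
noncomputable def densEnergy (ν : Measure (Space n)) (q : ℝ) (f : Space n → ℝ) : ℝ≥0∞ :=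
  ENNReal.ofReal q * crossEnergy (dens ν f) (dens ν f) + entropy ν f

theorem entropy_ne_top_of_densEnergy {q : ℝ} (h : densEnergy ν q f ≠ ⊤) : entropy ν f ≠ ⊤ :=
  fun h1 => h (by rw [densEnergy, h1, add_top])

variable [NeZero n]

theorem integrable_exp_logWeight (hα : 0 < α) (hν : Tame α ν) :
    Integrable (fun x => Real.exp (logWeight x)) ν := by
  obtain ⟨B, hB⟩ := hν.exists_integral_exp_le hα 1
  refine Integrable.mono' (hB 0).1 measurable_logWeight.exp.aestronglyMeasurable
    (ae_of_all _ fun y => ?_)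
  rw [Real.norm_of_nonneg (Real.exp_pos _).le]
  exact Real.exp_le_exp.2 (by linarith [singWeight_nonneg 0 y])

/-- Finite entropy forces a finite logarithmic moment because e^ϑ is integrable under a tame ν. This
is the hypothesis of `two_mul_crossEnergy_le`. -/
theorem integrable_logWeight_dens (hα : 0 < α) (hν : Tame α ν) (hf : IsDens ν f)
    (h : entropy ν f ≠ ⊤) : Integrable logWeight (dens ν f) :=
  integrable_of_integrable_exp measurable_logWeight logWeight_nonneg
    (integrable_exp_logWeight hα hν) hf h

variable [IsProbabilityMeasure ν]

/-- Bilinearity makes the energy at the midpoint (a + 2c + b)/4, where a and b are the energies of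
the two densities and c is their mutual energy; then 2c ≤ a + b. -/
theorem two_mul_crossEnergy_midpoint_le (hα : 0 < α) (hν : Tame α ν) (hf : IsDens ν f)
    (hg : IsDens ν g) (hfe : entropy ν f ≠ ⊤) (hge : entropy ν g ≠ ⊤) :
    2 * crossEnergy (dens ν fun x => (1 - 1 / 2) * f x + 1 / 2 * g x)
      (dens ν fun x => (1 - 1 / 2) * f x + 1 / 2 * g x) ≤
      crossEnergy (dens ν f) (dens ν f) + crossEnergy (dens ν g) (dens ν g) := by
  have := hf.isProbabilityMeasure
  have := hg.isProbabilityMeasure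
  have h := two_mul_crossEnergy_le (integrable_logWeight_dens hα hν hf hfe)
    (integrable_logWeight_dens hα hν hg hge)
  rw [dens_convex hf hg (by norm_num) (by norm_num), show (1 : ℝ) - 1 / 2 = 1 / 2 by norm_num,
    ← smul_add, crossEnergy_smul_left, crossEnergy_smul_right, crossEnergy_add_left,
    crossEnergy_add_right, crossEnergy_add_right, crossEnergy_comm (dens ν g) (dens ν f)]
  set a := crossEnergy (dens ν f) (dens ν f)
  set b := crossEnergy (dens ν g) (dens ν g)
  set c := crossEnergy (dens ν f) (dens ν g)
  have h2 : ENNReal.ofReal (1 / 2) = 2⁻¹ := by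
    rw [one_div, ENNReal.ofReal_inv_of_pos (by norm_num)]; norm_num
  have h3 : a + c + (c + b) ≤ 2 * (a + b) := by
    calc a + c + (c + b) = (a + b) + 2 * c := by ring
      _ ≤ (a + b) + (a + b) := by gcongr
      _ = 2 * (a + b) := by ring
  rw [h2]
  calc 2 * (2⁻¹ * (2⁻¹ * (a + c + (c + b)))) = 2⁻¹ * (a + c + (c + b)) := by
        rw [← mul_assoc, ENNReal.mul_inv_cancel two_ne_zero (by simp), one_mul]
    _ ≤ 2⁻¹ * (2 * (a + b)) := by gcongr
    _ = a + b := by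
        rw [← mul_assoc, ENNReal.inv_mul_cancel two_ne_zero (by simp), one_mul]

/-- Strong convexity of the free energy. -/
theorem densEnergy_midpoint (hα : 0 < α) (hν : Tame α ν) (q : ℝ) (hf : IsDens ν f)
    (hg : IsDens ν g) (hfe : entropy ν f ≠ ⊤) (hge : entropy ν g ≠ ⊤) :
    2 * densEnergy ν q (fun x => (1 - 1 / 2) * f x + 1 / 2 * g x) + 2⁻¹ * hellingerSq ν f g ≤
      densEnergy ν q f + densEnergy ν q g := by
  have h1 := two_mul_crossEnergy_midpoint_le hα hν hf hg hfe hge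
  have h2 := entropy_midpoint hf hg
  unfold densEnergy
  set a := crossEnergy (dens ν f) (dens ν f)
  set b := crossEnergy (dens ν g) (dens ν g)
  set c := crossEnergy (dens ν fun x => (1 - 1 / 2) * f x + 1 / 2 * g x)
      (dens ν fun x => (1 - 1 / 2) * f x + 1 / 2 * g x)
  set e := entropy ν (fun x => (1 - 1 / 2) * f x + 1 / 2 * g x)
  calc 2 * (ENNReal.ofReal q * c + e) + 2⁻¹ * hellingerSq ν f g
      = ENNReal.ofReal q * (2 * c) + (2 * e + 2⁻¹ * hellingerSq ν f g) := by ring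
    _ ≤ ENNReal.ofReal q * (a + b) + (entropy ν f + entropy ν g) := by gcongr
    _ = _ := by ring

/-- The midpoint is a competitor, so the strong convexity term cannot exceed the sum of the two
excesses. Zero excess gives uniqueness, small excess makes minimizing sequences Cauchy. -/
theorem hellingerSq_le_of_isMin (hα : 0 < α) (hν : Tame α ν) {q : ℝ} (hf : IsDens ν f)
    (hg : IsDens ν g) {m : ℝ≥0∞} (hm : m ≠ ⊤) (hmin : ∀ u, IsDens ν u → m ≤ densEnergy ν q u)
    {e₁ e₂ : ℝ≥0∞} (h₁ : densEnergy ν q f ≤ m + e₁) (h₂ : densEnergy ν q g ≤ m + e₂)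
    (he₁ : e₁ ≠ ⊤) (he₂ : e₂ ≠ ⊤) : hellingerSq ν f g ≤ 2 * (e₁ + e₂) := by
  have hf' : entropy ν f ≠ ⊤ := entropy_ne_top_of_densEnergy (q := q)
    (ne_top_of_le_ne_top (by finiteness) h₁)
  have hg' : entropy ν g ≠ ⊤ := entropy_ne_top_of_densEnergy (q := q)
    (ne_top_of_le_ne_top (by finiteness) h₂)
  have h := densEnergy_midpoint hα hν q hf hg hf' hg'
  have h0 := hmin _ (hf.convex hg (t := 1 / 2) (by norm_num) (by norm_num))
  have h3 : 2 * m + 2⁻¹ * hellingerSq ν f g ≤ 2 * m + (e₁ + e₂) := by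
    calc 2 * m + 2⁻¹ * hellingerSq ν f g ≤ _ := by gcongr
      _ ≤ _ := h
      _ ≤ (m + e₁) + (m + e₂) := by gcongr
      _ = _ := by ring
  have h4 := (ENNReal.add_le_add_iff_left (by finiteness)).1 h3
  calc hellingerSq ν f g = 2 * (2⁻¹ * hellingerSq ν f g) := by
        rw [← mul_assoc, ENNReal.mul_inv_cancel two_ne_zero (by simp), one_mul]
    _ ≤ _ := by gcongr

theorem crossEnergy_dens {ν : Measure (Space n)} [SFinite ν] (hf : IsDens ν f) (hg : IsDens ν g) :
    crossEnergy (dens ν f) (dens ν g) = ∫⁻ p : Space n × Space n,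
      ENNReal.ofReal (f p.1) * (ENNReal.ofReal (g p.2) * wKernel p.1 p.2) ∂(ν.prod ν) := by
  have hw := measurable_wKernel (n := n)
  have hgm := hg.measurable
  have hfm := hf.measurable
  have hwx : ∀ x : Space n, Measurable fun z => wKernel x z := fun x =>
    Measurable.of_uncurry_left (f := wKernel) hw
  have hF : Measurable fun p : Space n × Space n => ENNReal.ofReal (g p.2) * wKernel p.1 p.2 :=
    (hgm.comp measurable_snd).ennreal_ofReal.mul hw
  have hG : Measurable fun p : Space n × Space n =>
      ENNReal.ofReal (f p.1) * (ENNReal.ofReal (g p.2) * wKernel p.1 p.2) :=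
    (hfm.comp measurable_fst).ennreal_ofReal.mul hF
  have h1 : ∀ x, ∫⁻ z, wKernel x z ∂(dens ν g) =
      ∫⁻ z, ENNReal.ofReal (g z) * wKernel x z ∂ν := fun x => lintegral_dens hg (hwx x)
  have hV : Measurable fun x => ∫⁻ z, ENNReal.ofReal (g z) * wKernel x z ∂ν :=
    hF.lintegral_prod_right'
  calc crossEnergy (dens ν f) (dens ν g)
      = ∫⁻ x, ∫⁻ z, ENNReal.ofReal (g z) * wKernel x z ∂ν ∂(dens ν f) := lintegral_congr h1
    _ = ∫⁻ x, ENNReal.ofReal (f x) * ∫⁻ z, ENNReal.ofReal (g z) * wKernel x z ∂ν ∂ν :=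
        lintegral_dens hf hV
    _ = ∫⁻ x, ∫⁻ z, ENNReal.ofReal (f x) * (ENNReal.ofReal (g z) * wKernel x z) ∂ν ∂ν :=
        lintegral_congr fun x => (lintegral_const_mul _ (hgm.ennreal_ofReal.mul (hwx x))).symm
    _ = _ := (lintegral_prod _ hG.aemeasurable).symm

/-- One nonnegative integrand over the product space, continuous in the values of f wherever the
kernel is finite: the form to which Fatou's lemma applies. -/
theorem densEnergy_eq_lintegral (q : ℝ) (hf : IsDens ν f) :
    densEnergy ν q f = ∫⁻ p : Space n × Space n, (ENNReal.ofReal q *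
      (ENNReal.ofReal (f p.1) * (ENNReal.ofReal (f p.2) * wKernel p.1 p.2)) +
        ENNReal.ofReal (klFun (f p.1))) ∂(ν.prod ν) := by
  have hw := measurable_wKernel (n := n)
  have hfm := hf.measurable
  have hk := measurable_klFun
  rw [lintegral_add_left (by fun_prop), lintegral_const_mul _ (by fun_prop),
    ← crossEnergy_dens hf hf,
    densEnergy]
  congr 1
  rw [lintegral_prod _ (by fun_prop)]
  simp [entropy]

theorem Tame.ae_prod_ne (hν : Tame α ν) : ∀ᵐ p : Space n × Space n ∂(ν.prod ν), p.1 ≠ p.2 := by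
  have hms : MeasurableSet {p : Space n × Space n | ¬ (p.1 ≠ p.2)} := by
    simp only [ne_eq, not_not]
    exact measurableSet_eq_fun measurable_fst measurable_snd
  rw [ae_iff, Measure.measure_prod_null hms]
  exact ae_of_all _ fun x => hν.ae_ne x

/-- The free energy has a minimizer among densities. -/
theorem exists_isMin_densEnergy (hα : 0 < α) (hν : Tame α ν) (q : ℝ) :
    ∃ f, IsDens ν f ∧ densEnergy ν q f ≠ ⊤ ∧
      ∀ g, IsDens ν g → densEnergy ν q f ≤ densEnergy ν q g := by
  set m : ℝ≥0∞ := ⨅ f : {f : Space n → ℝ // IsDens ν f}, densEnergy ν q f with hm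
  have hmin : ∀ u, IsDens ν u → m ≤ densEnergy ν q u := fun u hu =>
    iInf_le (fun f : {f : Space n → ℝ // IsDens ν f} => densEnergy ν q f) ⟨u, hu⟩
  -- The reference measure has zero entropy relative to itself and finite energy by tameness, so the
  -- infimum is finite.
  have hone : densEnergy ν q (fun _ => 1) ≠ ⊤ := by
    have h1 : dens ν (fun _ => (1 : ℝ)) = ν := by
      simp only [dens, ENNReal.ofReal_one]
      exact withDensity_one
    rw [densEnergy, h1, entropy]
    have := hν.crossEnergy_lt_top hα
    simp only [klFun_one, ENNReal.ofReal_zero, lintegral_zero, add_zero]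
    finiteness
  have hmt : m ≠ ⊤ := ne_top_of_le_ne_top hone (hmin _ isDens_one)
  -- With this excess the Hellinger bound 2(e + e) is half of (2^{-N})², strictly below the rate
  -- that `exists_tendsto_of_hellingerSq` asks for.
  set e : ℕ → ℝ≥0∞ := fun N => (2⁻¹ ^ N) ^ 2 / 8 with he
  have he0 : ∀ N, e N ≠ 0 := fun N => by simp [he]
  have het : ∀ N, e N ≠ ⊤ := fun N => by
    simp only [he]
    refine ENNReal.div_ne_top (by finiteness) (by norm_num)
  have hex : ∀ N, ∃ f, IsDens ν f ∧ densEnergy ν q f ≤ m + e N := by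
    intro N
    have : m < m + e N := ENNReal.lt_add_right hmt (he0 N)
    rw [hm] at this
    obtain ⟨⟨f, hf⟩, hlt⟩ := iInf_lt_iff.1 this
    exact ⟨f, hf, hlt.le⟩
  choose F hF hFe using hex
  have hant : ∀ {N j : ℕ}, N ≤ j → e j ≤ e N := by
    intro N j h
    simp only [he]
    gcongr ?_ ^ 2 / 8
    exact pow_le_pow_right_of_le_one' (by simp) h
  obtain ⟨g, hg, hlim⟩ := exists_tendsto_of_hellingerSq hF (fun N j k hj hk => by
    have h1 := hellingerSq_le_of_isMin hα hν (hF j) (hF k) hmt hmin (hFe j) (hFe k) (het j) (het k)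
    refine (h1.trans (?_ : _ ≤ 2 * (e N + e N))).trans_lt ?_
    · gcongr <;> exact hant (by assumption)
    · have h2 : 2 * (e N + e N) = (2⁻¹ ^ N) ^ 2 * (4 / 8) := by
        simp only [he, div_eq_mul_inv]
        ring
      rw [h2]
      have h48 : (4 / 8 : ℝ≥0∞) < 1 := by
        rw [ENNReal.div_lt_iff (by simp) (by simp)]; norm_num
      calc ((2⁻¹ : ℝ≥0∞) ^ N) ^ 2 * (4 / 8) < (2⁻¹ ^ N) ^ 2 * 1 :=
            ENNReal.mul_lt_mul_right (by simp) (by finiteness) h48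
        _ = _ := mul_one _)
  have hle : densEnergy ν q g ≤ m := by
    have hw := measurable_wKernel (n := n)
    have hk := measurable_klFun
    set T : (Space n → ℝ) → Space n × Space n → ℝ≥0∞ := fun f p => ENNReal.ofReal q *
      (ENNReal.ofReal (f p.1) * (ENNReal.ofReal (f p.2) * wKernel p.1 p.2)) +
        ENNReal.ofReal (klFun (f p.1)) with hT
    have hTm : ∀ k, Measurable (T (F k)) := fun k => by
      have := (hF k).measurable
      fun_prop
    have hlim1 : ∀ᵐ p : Space n × Space n ∂(ν.prod ν),
        Tendsto (fun k => F k p.1) atTop (𝓝 (g p.1)) :=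
      Measure.quasiMeasurePreserving_fst.ae hlim
    have hlim2 : ∀ᵐ p : Space n × Space n ∂(ν.prod ν),
        Tendsto (fun k => F k p.2) atTop (𝓝 (g p.2)) :=
      Measure.quasiMeasurePreserving_snd.ae hlim
    -- Off the diagonal, which is null for ν × ν, the kernel is finite; this is what makes
    -- multiplication in [0, ∞] continuous here.
    have hTlim : ∀ᵐ p : Space n × Space n ∂(ν.prod ν),
        Tendsto (fun k => T (F k) p) atTop (𝓝 (T g p)) := by
      filter_upwards [hlim1, hlim2, hν.ae_prod_ne] with p h1 h2 h3
      have hwt : wKernel p.1 p.2 ≠ ⊤ := by rw [wKernel_of_ne h3]; simp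
      have h1' := ENNReal.tendsto_ofReal h1
      have h2' := ENNReal.tendsto_ofReal h2
      have h4 := ENNReal.Tendsto.mul_const h2' (Or.inr hwt)
      refine Tendsto.add (ENNReal.Tendsto.const_mul (ENNReal.Tendsto.mul h1' (Or.inr ?_) h4
        (Or.inr ENNReal.ofReal_ne_top)) (Or.inr ENNReal.ofReal_ne_top)) ?_
      · finiteness
      · exact ENNReal.tendsto_ofReal ((continuous_klFun.tendsto _).comp h1)
    rw [densEnergy_eq_lintegral q hg]
    calc ∫⁻ p, T g p ∂(ν.prod ν) = ∫⁻ p, liminf (fun k => T (F k) p) atTop ∂(ν.prod ν) :=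
          lintegral_congr_ae (hTlim.mono fun p hp => hp.liminf_eq.symm)
      _ ≤ liminf (fun k => ∫⁻ p, T (F k) p ∂(ν.prod ν)) atTop := lintegral_liminf_le hTm
      _ ≤ liminf (fun k => m + e k) atTop := by
          refine liminf_le_liminf (Eventually.of_forall fun k => ?_)
          rw [← densEnergy_eq_lintegral q (hF k)]
          exact hFe k
      _ = m := by
          refine Tendsto.liminf_eq ?_
          have : Tendsto e atTop (𝓝 0) := by
            have h1 : Tendsto (fun N : ℕ => (2⁻¹ : ℝ≥0∞) ^ N) atTop (𝓝 0) :=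
              ENNReal.tendsto_pow_atTop_nhds_zero_of_lt_one (by simp)
            have h2 := ENNReal.Tendsto.div_const (ENNReal.Tendsto.pow (n := 2) h1)
              (Or.inr (by norm_num : (8 : ℝ≥0∞) ≠ 0))
            simpa using h2
          simpa using this.const_add m
  exact ⟨g, hg, ne_top_of_le_ne_top hmt hle, fun u hu => hle.trans (hmin u hu)⟩

end LogGas

/-! ### The Euler–Lagrange equation -/

namespace LogGas

open InformationTheory

variable {n : ℕ} {α : ℝ} {ν : Measure (Space n)} {f g : Space n → ℝ}

/-- The weighted potential of a measure. -/
noncomputable def wPotential (μ : Measure (Space n)) (x : Space n) : ℝ≥0∞ := ∫⁻ z, wKernel x z ∂μ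

theorem measurable_wPotential (μ : Measure (Space n)) [SFinite μ] :
    Measurable (wPotential μ) := measurable_wKernel.lintegral_prod_right'

theorem crossEnergy_eq_lintegral_wPotential (μ ν : Measure (Space n)) :
    crossEnergy μ ν = ∫⁻ x, wPotential ν x ∂μ := rfl

/-- The Gibbs density `Z⁻¹ exp(-2 q u)` with respect to `ν`. -/
noncomputable def gibbsDens (ν : Measure (Space n)) (q : ℝ) (u : Space n → ℝ) (x : Space n) : ℝ :=
  (∫ y, Real.exp (-(2 * q) * u y) ∂ν)⁻¹ * Real.exp (-(2 * q) * u x)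

section Gibbs

variable [IsProbabilityMeasure ν] {q : ℝ} {u : Space n → ℝ}

theorem integrable_gibbs (hq : 0 ≤ q) (hu : Measurable u) (hu0 : ∀ x, 0 ≤ u x) :
    Integrable (fun y => Real.exp (-(2 * q) * u y)) ν := by
  refine Integrable.mono' (integrable_const (1 : ℝ)) (by fun_prop) (ae_of_all _ fun y => ?_)
  rw [Real.norm_of_nonneg (Real.exp_pos _).le]
  exact Real.exp_le_one_iff.2 (by nlinarith [mul_nonneg hq (hu0 y)])

theorem integral_gibbs_pos (hq : 0 ≤ q) (hu : Measurable u) (hu0 : ∀ x, 0 ≤ u x) :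
    0 < ∫ y, Real.exp (-(2 * q) * u y) ∂ν :=
  integral_exp_pos (integrable_gibbs hq hu hu0)

theorem integral_gibbs_le_one (hq : 0 ≤ q) (hu : Measurable u) (hu0 : ∀ x, 0 ≤ u x) :
    ∫ y, Real.exp (-(2 * q) * u y) ∂ν ≤ 1 := by
  refine (integral_mono (integrable_gibbs hq hu hu0) (integrable_const (1 : ℝ))
    fun y => ?_).trans (by simp)
  exact Real.exp_le_one_iff.2 (by nlinarith [mul_nonneg hq (hu0 y)])

theorem gibbsDens_pos (hq : 0 ≤ q) (hu : Measurable u) (hu0 : ∀ x, 0 ≤ u x) (x : Space n) :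
    0 < gibbsDens ν q u x :=
  mul_pos (inv_pos.2 (integral_gibbs_pos hq hu hu0)) (Real.exp_pos _)

theorem gibbsDens_le (hq : 0 ≤ q) (hu : Measurable u) (hu0 : ∀ x, 0 ≤ u x) (x : Space n) :
    gibbsDens ν q u x ≤ (∫ y, Real.exp (-(2 * q) * u y) ∂ν)⁻¹ :=
  mul_le_of_le_one_right (inv_pos.2 (integral_gibbs_pos hq hu hu0)).le
    (Real.exp_le_one_iff.2 (by nlinarith [mul_nonneg hq (hu0 x)]))

theorem isDens_gibbsDens (hq : 0 ≤ q) (hu : Measurable u) (hu0 : ∀ x, 0 ≤ u x) :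
    IsDens ν (gibbsDens ν q u) := by
  refine isDens_of_integral ?_ (fun x => (gibbsDens_pos hq hu hu0 x).le)
    ((integrable_gibbs hq hu hu0).const_mul _) ?_
  · unfold gibbsDens; fun_prop
  · unfold gibbsDens
    rw [integral_const_mul]
    exact inv_mul_cancel₀ (integral_gibbs_pos hq hu hu0).ne'

theorem entropy_gibbsDens_ne_top (hq : 0 ≤ q) (hu : Measurable u) (hu0 : ∀ x, 0 ≤ u x) :
    entropy ν (gibbsDens ν q u) ≠ ⊤ := by
  set Z := ∫ y, Real.exp (-(2 * q) * u y) ∂ν with hZ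
  have hZ1 : 1 ≤ Z⁻¹ :=
    (one_le_inv₀ (integral_gibbs_pos hq hu hu0)).2 (integral_gibbs_le_one hq hu hu0)
  have hb : ∀ x, klFun (gibbsDens ν q u x) ≤ Z⁻¹ * Real.log Z⁻¹ + 1 := by
    intro x
    have h0 := gibbsDens_pos (ν := ν) hq hu hu0 x
    have h1 : gibbsDens ν q u x ≤ Z⁻¹ := gibbsDens_le hq hu hu0 x
    have h2 := Real.log_le_log h0 h1
    have h3 := Real.log_nonneg hZ1
    rw [klFun_apply]
    nlinarith [mul_le_mul_of_nonneg_left h2 h0.le, mul_le_mul_of_nonneg_right h1 h3]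
  refine ne_top_of_le_ne_top ?_ (lintegral_mono fun x => ENNReal.ofReal_le_ofReal (hb x))
  simp

/-- The Gibbs density is bounded because u ≥ 0, so the energies of this competitor are controlled by
those of ν. -/
theorem dens_gibbsDens_le (hq : 0 ≤ q) (hu : Measurable u) (hu0 : ∀ x, 0 ≤ u x) :
    dens ν (gibbsDens ν q u) ≤
      ENNReal.ofReal (∫ y, Real.exp (-(2 * q) * u y) ∂ν)⁻¹ • ν := by
  have h := withDensity_mono (μ := ν) (ae_of_all _ fun x =>
    ENNReal.ofReal_le_ofReal (gibbsDens_le (ν := ν) hq hu hu0 x))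
  rwa [withDensity_const] at h

end Gibbs

theorem entropy_convex_le [IsProbabilityMeasure ν] (hf : IsDens ν f) (hg : IsDens ν g)
    (hfe : entropy ν f ≠ ⊤) (hge : entropy ν g ≠ ⊤) {t : ℝ} (h0 : 0 ≤ t) (h1 : t ≤ 1) :
    entropy ν (fun x => (1 - t) * f x + t * g x) ≤
      ENNReal.ofReal ((1 - t) * ∫ x, klFun (f x) ∂ν + t * ∫ x, klFun (g x) ∂ν) := by
  have hi1 := (integrable_klFun hf hfe).const_mul (1 - t)
  have hi2 := (integrable_klFun hg hge).const_mul t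
  have hi12 : Integrable (fun x => (1 - t) * klFun (f x) + t * klFun (g x)) ν := hi1.add hi2
  rw [← integral_const_mul, ← integral_const_mul, ← integral_add hi1 hi2,
    ofReal_integral_eq_lintegral_ofReal hi12 (ae_of_all _ fun x =>
      add_nonneg (mul_nonneg (by linarith) (klFun_nonneg (hf.nonneg x)))
        (mul_nonneg h0 (klFun_nonneg (hg.nonneg x))))]
  refine lintegral_mono fun x => ENNReal.ofReal_le_ofReal ?_
  exact convexOn_klFun.2 (hf.nonneg x) (hg.nonneg x) (by linarith) h0 (by ring)

/-- The first-order condition at a minimizer: it minimizes the linearized free energy. -/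
theorem linearized_le_of_isMin [IsProbabilityMeasure ν] {q : ℝ} (hq : 0 < q) (hf : IsDens ν f)
    (hg : IsDens ν g) (hfe : entropy ν f ≠ ⊤) (hge : entropy ν g ≠ ⊤)
    (hff : crossEnergy (dens ν f) (dens ν f) ≠ ⊤) (hgf : crossEnergy (dens ν g) (dens ν f) ≠ ⊤)
    (hgg : crossEnergy (dens ν g) (dens ν g) ≠ ⊤)
    (hmin : ∀ u, IsDens ν u → densEnergy ν q f ≤ densEnergy ν q u) :
    2 * q * (crossEnergy (dens ν f) (dens ν f)).toReal + ∫ x, klFun (f x) ∂ν ≤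
      2 * q * (crossEnergy (dens ν g) (dens ν f)).toReal + ∫ x, klFun (g x) ∂ν := by
  have := hf.isProbabilityMeasure
  have := hg.isProbabilityMeasure
  set a := (crossEnergy (dens ν f) (dens ν f)).toReal with ha
  set c := (crossEnergy (dens ν g) (dens ν f)).toReal with hc
  set b := (crossEnergy (dens ν g) (dens ν g)).toReal with hb
  set F := ∫ x, klFun (f x) ∂ν with hF
  set G := ∫ x, klFun (g x) ∂ν with hG
  have ha0 : 0 ≤ a := ENNReal.toReal_nonneg
  have hb0 : 0 ≤ b := ENNReal.toReal_nonneg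
  have hc0 : 0 ≤ c := ENNReal.toReal_nonneg
  have hF0 : 0 ≤ F := integral_nonneg fun x => klFun_nonneg (hf.nonneg x)
  have hG0 : 0 ≤ G := integral_nonneg fun x => klFun_nonneg (hg.nonneg x)
  have key : ∀ t : ℝ, 0 ≤ t → t ≤ 1 → q * a + F ≤
      q * ((1 - t) * ((1 - t) * a + t * c) + t * ((1 - t) * c + t * b)) +
        ((1 - t) * F + t * G) := by
    intro t h0 h1
    have h1' : 0 ≤ 1 - t := by linarith
    have h := hmin _ (hf.convex hg h0 h1)
    have hE : crossEnergy (dens ν fun x => (1 - t) * f x + t * g x)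
        (dens ν fun x => (1 - t) * f x + t * g x) = ENNReal.ofReal
          ((1 - t) * ((1 - t) * a + t * c) + t * ((1 - t) * c + t * b)) := by
      rw [dens_convex hf hg h0 h1, crossEnergy_add_left, crossEnergy_smul_left,
        crossEnergy_smul_left, crossEnergy_add_right, crossEnergy_add_right,
        crossEnergy_smul_right, crossEnergy_smul_right, crossEnergy_smul_right,
        crossEnergy_smul_right, crossEnergy_comm (dens ν f) (dens ν g),
        ← ENNReal.ofReal_toReal hff, ← ENNReal.ofReal_toReal hgf, ← ENNReal.ofReal_toReal hgg,
        ← ha, ← hb, ← hc, ENNReal.ofReal_add, ENNReal.ofReal_mul h1', ENNReal.ofReal_mul h0,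
        ENNReal.ofReal_add, ENNReal.ofReal_add, ENNReal.ofReal_mul h1', ENNReal.ofReal_mul h0,
        ENNReal.ofReal_mul h1', ENNReal.ofReal_mul h0] <;> positivity
    have hFe : densEnergy ν q f = ENNReal.ofReal (q * a + F) := by
      rw [densEnergy, entropy_eq_ofReal hf hfe, ← ENNReal.ofReal_toReal hff, ← ha,
        ← ENNReal.ofReal_mul hq.le, ← ENNReal.ofReal_add (by positivity) hF0]
    rw [hFe, densEnergy, hE, ← ENNReal.ofReal_mul hq.le] at h
    have h2 := h.trans (add_le_add_right (entropy_convex_le hf hg hfe hge h0 h1) _)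
    rw [← hF, ← hG, ← ENNReal.ofReal_add (by positivity) (by positivity)] at h2
    exact (ENNReal.ofReal_le_ofReal_iff (by positivity)).1 h2
  by_contra hcon
  push Not at hcon
  set X := 2 * q * a + F - (2 * q * c + G) with hX
  set Y := q * a + q * b - 2 * q * c with hY
  have hX0 : 0 < X := by linarith
  -- The energy is quadratic along the segment from f to g, so besides the first-order gap tX only
  -- t²Y appears; divide by t.
  have key2 : ∀ t : ℝ, 0 < t → t ≤ 1 → X ≤ t * Y := by
    intro t h0 h1
    have h3 := key t h0.le h1
    have h2 : t * X ≤ t * (t * Y) := by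
      rw [hX, hY]
      nlinarith
    exact le_of_mul_le_mul_left h2 h0
  have h1 := key2 1 one_pos le_rfl
  have hY0 : 0 < Y := by linarith
  -- This choice of t would give X ≤ X/2. It is admissible since t = 1 already gave X ≤ Y.
  have h2 := key2 (X / (2 * Y)) (by positivity) (by rw [div_le_one (by positivity)]; linarith)
  have : X / (2 * Y) * Y = X / 2 := by field_simp
  linarith

/-- The Euler-Lagrange equation for a minimizer. -/
theorem ae_eq_gibbsDens_of_isMin [NeZero n] [IsProbabilityMeasure ν] (hα : 0 < α) (hν : Tame α ν)
    {q : ℝ} (hq : 0 < q) (hf : IsDens ν f) (hft : densEnergy ν q f ≠ ⊤)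
    (hmin : ∀ u, IsDens ν u → densEnergy ν q f ≤ densEnergy ν q u) :
    f =ᵐ[ν] gibbsDens ν q fun x => (wPotential (dens ν f) x).toReal := by
  have := hf.isProbabilityMeasure
  have hfe := entropy_ne_top_of_densEnergy hft
  have hff : crossEnergy (dens ν f) (dens ν f) ≠ ⊤ := by
    intro h
    refine hft ?_
    rw [densEnergy, h, ENNReal.mul_top (by simpa using hq), top_add]
  have hνν := (hν.crossEnergy_lt_top hα).ne
  -- Convexity of the energy bounds the mutual energy by the two self-energies. Its finiteness also
  -- makes the potential finite ν-almost everywhere.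
  have hνf : crossEnergy ν (dens ν f) ≠ ⊤ := by
    have h := two_mul_crossEnergy_le (hν.integrable_logWeight hα)
      (integrable_logWeight_dens hα hν hf hfe)
    intro h1
    rw [h1, ENNReal.mul_top two_ne_zero, top_le_iff] at h
    exact ENNReal.add_ne_top.2 ⟨hνν, hff⟩ h
  set U := wPotential (dens ν f) with hU
  set u : Space n → ℝ := fun x => (U x).toReal with hu_def
  have hUm : Measurable U := measurable_wPotential _
  have hu : Measurable u := hUm.ennreal_toReal
  have hu0 : ∀ x, 0 ≤ u x := fun x => ENNReal.toReal_nonneg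
  have hUt : ∀ᵐ x ∂ν, U x < ⊤ := ae_lt_top hUm hνf
  set r := gibbsDens ν q u with hr
  set Z := ∫ y, Real.exp (-(2 * q) * u y) ∂ν with hZ
  have hZ0 : 0 < Z := integral_gibbs_pos hq.le hu hu0
  have hrd : IsDens ν r := isDens_gibbsDens hq.le hu hu0
  have hre : entropy ν r ≠ ⊤ := entropy_gibbsDens_ne_top hq.le hu hu0
  have hrle := dens_gibbsDens_le (ν := ν) hq.le hu hu0
  have hrf : crossEnergy (dens ν r) (dens ν f) ≠ ⊤ := by
    refine ne_top_of_le_ne_top ?_ (crossEnergy_mono hrle le_rfl)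
    rw [crossEnergy_smul_left]
    finiteness
  have hrr : crossEnergy (dens ν r) (dens ν r) ≠ ⊤ := by
    refine ne_top_of_le_ne_top ?_ (crossEnergy_mono hrle hrle)
    rw [crossEnergy_smul_left, crossEnergy_smul_right]
    finiteness
  have hlin := linearized_le_of_isMin hq hf hrd hfe hre hff hrf hrr hmin
  have hcross : ∀ {g : Space n → ℝ}, IsDens ν g → crossEnergy (dens ν g) (dens ν f) ≠ ⊤ →
      Integrable (fun x => g x * u x) ν ∧
      (crossEnergy (dens ν g) (dens ν f)).toReal = ∫ x, g x * u x ∂ν := by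
    intro g hg hgt
    have h1 : crossEnergy (dens ν g) (dens ν f) = ∫⁻ x, ENNReal.ofReal (g x * u x) ∂ν := by
      rw [crossEnergy_eq_lintegral_wPotential, lintegral_dens hg hUm]
      refine lintegral_congr_ae (hUt.mono fun x hx => ?_)
      simp only
      rw [ENNReal.ofReal_mul (hg.nonneg x), ENNReal.ofReal_toReal hx.ne]
    have h0 : ∀ x, 0 ≤ g x * u x := fun x => mul_nonneg (hg.nonneg x) (hu0 x)
    have hm : AEStronglyMeasurable (fun x => g x * u x) ν :=
      (hg.measurable.mul hu).aestronglyMeasurable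
    refine ⟨⟨hm, ?_⟩, ?_⟩
    · rw [hasFiniteIntegral_iff_ofReal (ae_of_all _ h0), ← h1]
      exact lt_top_iff_ne_top.2 hgt
    · rw [integral_eq_lintegral_of_nonneg_ae (ae_of_all _ h0) hm, h1]
  obtain ⟨hif, hef⟩ := hcross hf hff
  obtain ⟨hir, her⟩ := hcross hrd hrf
  have hkf := integrable_klFun hf hfe
  have hkr := integrable_klFun hrd hre
  rw [hef, her] at hlin
  -- Since log r = -log Z - 2qu, the relative entropy of f with respect to r is the difference of
  -- their linearized free energies plus a multiple of f - r, whose integral is zero. Minimality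
  -- makes the total nonpositive, which forces the Hellinger distance to vanish.
  have hpt : ∀ x, (√(f x) - √(r x)) ^ 2 ≤
      klFun (f x) - klFun (r x) + 2 * q * (f x * u x - r x * u x) +
        Real.log Z * (f x - r x) := by
    intro x
    have hr0 : 0 < r x := gibbsDens_pos hq.le hu hu0 x
    have h1 := sq_sqrt_sub_sqrt_le (hf.nonneg x) hr0
    have hlog : Real.log (r x) = -Real.log Z - 2 * q * u x := by
      rw [hr, gibbsDens, Real.log_mul (inv_ne_zero hZ0.ne') (Real.exp_pos _).ne', Real.log_inv,
        Real.log_exp]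
      ring
    have h2 : f x * Real.log (f x / r x) = f x * Real.log (f x) - f x * Real.log (r x) := by
      rcases (hf.nonneg x).eq_or_lt with h | h
      · rw [← h]; simp
      · rw [Real.log_div h.ne' hr0.ne']; ring
    rw [h2] at h1
    simp only [klFun_apply]
    rw [hlog] at h1 ⊢
    linarith
  have hI1 : Integrable (fun x => klFun (f x) - klFun (r x)) ν := hkf.sub hkr
  have hI2 : Integrable (fun x => 2 * q * (f x * u x - r x * u x)) ν := (hif.sub hir).const_mul _
  have hI3 : Integrable (fun x => Real.log Z * (f x - r x)) ν :=
    (hf.integrable.sub hrd.integrable).const_mul _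
  have hI12 : Integrable (fun x => klFun (f x) - klFun (r x) + 2 * q * (f x * u x - r x * u x)) ν :=
    hI1.add hI2
  refine hellingerSq_eq_zero hf hrd (le_antisymm ?_ bot_le)
  calc hellingerSq ν f r ≤ ∫⁻ x, ENNReal.ofReal (klFun (f x) - klFun (r x) +
        2 * q * (f x * u x - r x * u x) + Real.log Z * (f x - r x)) ∂ν :=
        lintegral_mono fun x => ENNReal.ofReal_le_ofReal (hpt x)
    _ = ENNReal.ofReal (∫ x, (klFun (f x) - klFun (r x) +
        2 * q * (f x * u x - r x * u x) + Real.log Z * (f x - r x)) ∂ν) :=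
        (ofReal_integral_eq_lintegral_ofReal (hI12.add hI3)
          (ae_of_all _ fun x => (sq_nonneg _).trans (hpt x))).symm
    _ = 0 := by
      rw [ENNReal.ofReal_eq_zero, integral_add hI12 hI3, integral_add hI1 hI2,
        integral_sub hkf hkr, integral_const_mul, integral_sub hif hir, integral_const_mul,
        integral_sub hf.integrable hrd.integrable, hf.integral_eq, hrd.integral_eq]
      linarith

end LogGas

/-! ### The equilibrium measure and its self-consistent equation -/

namespace LogGas

open InformationTheory

variable {n : ℕ} {α γ : ℝ}

/-! ### The reference measure -/

theorem integral_edgeWeight_pos (hα : 0 < α) (A : ℝ) :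
    0 < ∫ x : Space n, edgeWeight α A x := integral_exp_pos (edgeWeight_integrable hα A)

theorem reference_eq (hα : 0 < α) : reference n α γ = volume.withDensity fun x =>
    ENNReal.ofReal ((∫ y : Space n, edgeWeight α γ y)⁻¹ * edgeWeight α γ x) := by
  have hC := integral_edgeWeight_pos (n := n) hα γ
  have h1 : unnormalizedReference n α γ =
      volume.withDensity fun x => ENNReal.ofReal (edgeWeight α γ x) := by
    unfold unnormalizedReference edgeWeight
    simp only [neg_sub]
  have h2 : unnormalizedReference n α γ Set.univ =
      ENNReal.ofReal (∫ y : Space n, edgeWeight α γ y) := by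
    rw [h1, withDensity_apply _ MeasurableSet.univ, setLIntegral_univ,
      ofReal_integral_eq_lintegral_ofReal (edgeWeight_integrable hα γ)
        (ae_of_all _ fun x => (edgeWeight_pos α γ x).le)]
  rw [reference, h2, h1, ← ENNReal.ofReal_inv_of_pos hC,
    ← withDensity_smul _ (continuous_edgeWeight hα γ).measurable.ennreal_ofReal]
  congr 1
  ext x
  rw [Pi.smul_apply, smul_eq_mul, ENNReal.ofReal_mul (inv_pos.2 hC).le]

theorem reference_isProbabilityMeasure (hα : 0 < α) :
    IsProbabilityMeasure (reference n α γ) := by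
  have hC := integral_edgeWeight_pos (n := n) hα γ
  constructor
  rw [reference_eq hα, withDensity_apply _ MeasurableSet.univ, setLIntegral_univ,
    ← ofReal_integral_eq_lintegral_ofReal ((edgeWeight_integrable hα γ).const_mul _)
      (ae_of_all _ fun x => (mul_pos (inv_pos.2 hC) (edgeWeight_pos α γ x)).le),
    integral_const_mul, inv_mul_cancel₀ hC.ne', ENNReal.ofReal_one]

theorem reference_tame (hα : 0 < α) : Tame α (reference n α γ) :=
  ⟨_, _, γ, (continuous_edgeWeight hα γ).measurable.const_mul _, fun x =>
    (mul_pos (inv_pos.2 (integral_edgeWeight_pos hα γ)) (edgeWeight_pos α γ x)).le,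
    fun _ => le_rfl, reference_eq hα⟩

/-! ### Potentials of tame measures -/

theorem Tame.integrable_log [NeZero n] (hα : 0 < α) {μ : Measure (Space n)} [IsFiniteMeasure μ]
    (h : Tame α μ) (x : Space n) : Integrable (fun z => Real.log ‖x - z‖) μ := by
  obtain ⟨B, hB⟩ := h.exists_integral_le hα 1
  refine Integrable.mono' ((integrable_const (logWeight x)).add (hB x).1)
    (Real.measurable_log.comp (by fun_prop : Measurable fun z => ‖x - z‖)).aestronglyMeasurable
    ((h.ae_ne x).mono fun z hz => ?_)
  have h1 := abs_log_norm_sub_sub_logWeight_le hz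
  have h2 := abs_le.1 h1
  have h3 := logWeight_nonneg x
  rw [Real.norm_eq_abs, abs_le]
  simp only [Pi.add_apply]
  constructor <;> linarith

theorem logPotential_eq (μ : Measure (Space n)) (x : Space n) :
    logPotential μ x = ∫ z, -Real.log ‖x - z‖ ∂μ := by
  simp_rw [logPotential, toReal_logKernel]

theorem Tame.toReal_wPotential [NeZero n] (hα : 0 < α) {μ : Measure (Space n)}
    [IsProbabilityMeasure μ] (h : Tame α μ) (x : Space n) :
    (wPotential μ x).toReal = logPotential μ x + logWeight x + ∫ z, logWeight z ∂μ := by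
  have h1 : Integrable (fun z => -Real.log ‖x - z‖) μ := (h.integrable_log hα x).neg
  have h2 := h.integrable_logWeight hα
  have h12 : Integrable (fun z => -Real.log ‖x - z‖ + logWeight x) μ :=
    h1.add (integrable_const _)
  have h3 : ∫ z, (-Real.log ‖x - z‖ + logWeight x + logWeight z) ∂μ =
      logPotential μ x + logWeight x + ∫ z, logWeight z ∂μ := by
    rw [integral_add h12 h2, integral_add h1 (integrable_const _), logPotential_eq]
    simp
  have h0 : ∀ᵐ z ∂μ, 0 ≤ -Real.log ‖x - z‖ + logWeight x + logWeight z := by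
    filter_upwards [h.ae_ne x] with z hz
    have := weightedKernel_nonneg x z
    rw [weightedKernel, logKernel_of_ne hz, ← EReal.coe_add, ← EReal.coe_add,
      EReal.coe_nonneg] at this
    exact this
  rw [← h3, integral_eq_lintegral_of_nonneg_ae h0 (h12.add h2).aestronglyMeasurable, wPotential]
  congr 1
  refine lintegral_congr_ae ?_
  filter_upwards [h.ae_ne x] with z hz
  rw [wKernel_of_ne hz]

/-! ### The equilibrium measure -/

theorem freeEnergy_eq_densEnergy (hα : 0 < α) {f : Space n → ℝ}
    (hf : IsDens (reference n α γ) f) (μ : ProbabilityMeasure (Space n))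
    (hμ : (μ : Measure (Space n)) = dens (reference n α γ) f) :
    freeEnergy α γ μ = densEnergy (reference n α γ) (γ / 2) f := by
  have := reference_isProbabilityMeasure (n := n) (γ := γ) hα
  rw [freeEnergy, hμ, hf.klDiv_eq]
  rfl

theorem dens_reference (hα : 0 < α) {f G : Space n → ℝ} (hG : Measurable G) (hG0 : ∀ x, 0 ≤ G x)
    (h : f =ᵐ[reference n α γ] G) : dens (reference n α γ) f = volume.withDensity fun x =>
      ENNReal.ofReal (G x * ((∫ y : Space n, edgeWeight α γ y)⁻¹ * edgeWeight α γ x)) := by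
  have hm1 : Measurable fun x : Space n =>
      (∫ y : Space n, edgeWeight α γ y)⁻¹ * edgeWeight α γ x :=
    (continuous_edgeWeight hα γ).measurable.const_mul _
  have h1 : dens (reference n α γ) f =
      (reference n α γ).withDensity fun x => ENNReal.ofReal (G x) :=
    withDensity_congr_ae (h.mono fun x hx => by simp only [hx])
  rw [h1, reference_eq hα, ← withDensity_mul _ hm1.ennreal_ofReal hG.ennreal_ofReal]
  congr 1
  ext x
  rw [Pi.mul_apply, mul_comm, ← ENNReal.ofReal_mul (hG0 x)]

theorem tame_of_dens_reference (hα : 0 < α) {f G : Space n → ℝ} (hG : Measurable G)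
    (hG0 : ∀ x, 0 ≤ G x) {B : ℝ} (hGB : ∀ x, G x ≤ B) (h : f =ᵐ[reference n α γ] G) :
    Tame α (dens (reference n α γ) f) := by
  have hC := integral_edgeWeight_pos (n := n) hα γ
  refine ⟨_, B * (∫ y : Space n, edgeWeight α γ y)⁻¹, γ,
    hG.mul ((continuous_edgeWeight hα γ).measurable.const_mul _), fun x => ?_, fun x => ?_,
    dens_reference hα hG hG0 h⟩
  · exact mul_nonneg (hG0 x) (mul_nonneg (inv_pos.2 hC).le (edgeWeight_pos α γ x).le)
  · rw [mul_assoc]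
    exact mul_le_mul_of_nonneg_right (hGB x)
      (mul_nonneg (inv_pos.2 hC).le (edgeWeight_pos α γ x).le)

/-- There is a unique equilibrium measure; it is tame and solves the self-consistent equation. -/
theorem exists_equilibrium [NeZero n] (hα : 0 < α) (hγ : 0 ≤ γ) :
    ∃ (μ : ProbabilityMeasure (Space n)) (L : ℝ),
      (IsEquilibrium α γ μ ∧ ∀ ν : ProbabilityMeasure (Space n), IsEquilibrium α γ ν → ν = μ) ∧
      0 < L ∧ SelfConsistent α γ L (μ : Measure (Space n)) ∧
      Tame α (μ : Measure (Space n)) := by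
  set ν := reference n α γ with hν
  have hprob : IsProbabilityMeasure ν := reference_isProbabilityMeasure hα
  have htame : Tame α ν := reference_tame hα
  obtain ⟨f, hf, hft, hmin⟩ := exists_isMin_densEnergy hα htame (γ / 2)
  have hfprob := hf.isProbabilityMeasure
  set μ : ProbabilityMeasure (Space n) := ⟨dens ν f, hfprob⟩ with hμ
  have hFμ : freeEnergy α γ μ = densEnergy ν (γ / 2) f := freeEnergy_eq_densEnergy hα hf μ rfl
  have heq : IsEquilibrium α γ μ := by
    intro ρ
    -- A measure of infinite relative entropy has infinite free energy, so only densities compete.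
    by_cases hk : klDiv (ρ : Measure (Space n)) ν = ⊤
    · have : freeEnergy α γ ρ = ⊤ := by rw [freeEnergy, ← hν, hk, add_top]
      rw [this]; exact le_top
    · obtain ⟨g, hg, hρ⟩ := exists_isDens (ρ : Measure (Space n)) hk
      rw [hFμ, freeEnergy_eq_densEnergy hα hg ρ hρ]
      exact hmin g hg
  have huniq : ∀ ρ : ProbabilityMeasure (Space n), IsEquilibrium α γ ρ → ρ = μ := by
    intro ρ hρe
    have h1 := hρe μ
    have hk : klDiv (ρ : Measure (Space n)) ν ≠ ⊤ := by
      intro hk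
      have : freeEnergy α γ ρ = ⊤ := by rw [freeEnergy, ← hν, hk, add_top]
      rw [this, hFμ, top_le_iff] at h1
      exact hft h1
    obtain ⟨g, hg, hρ⟩ := exists_isDens (ρ : Measure (Space n)) hk
    rw [hFμ, freeEnergy_eq_densEnergy hα hg ρ hρ] at h1
    have h2 := hellingerSq_le_of_isMin hα htame hf hg hft hmin (e₁ := 0) (e₂ := 0)
      (by simp) (by simpa using h1) (by simp) (by simp)
    have h3 := hellingerSq_eq_zero hf hg (by simpa using h2)
    apply Subtype.ext
    change (ρ : Measure (Space n)) = dens ν f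
    rw [hρ]
    exact withDensity_congr_ae (h3.mono fun x hx => by simp only [hx])
  have hEL : ∃ Z : ℝ, 0 < Z ∧ f =ᵐ[ν] fun x =>
      Z⁻¹ * Real.exp (-γ * (wPotential (dens ν f) x).toReal) := by
    rcases hγ.eq_or_lt with h | h
    -- For γ = 0 the free energy is the entropy, minimized by the constant density. The
    -- Euler–Lagrange argument needs a positive coupling.
    · refine ⟨1, one_pos, ?_⟩
      have h1 := hellingerSq_le_of_isMin hα htame hf isDens_one hft hmin (e₁ := 0) (e₂ := 0)
        (by simp) (by
          rw [densEnergy, ← h]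
          simp [entropy, InformationTheory.klFun_one]) (by simp) (by simp)
      have h3 := hellingerSq_eq_zero hf isDens_one (by simpa using h1)
      filter_upwards [h3] with x hx
      rw [hx, ← h]
      simp
    · have h1 := ae_eq_gibbsDens_of_isMin hα htame (half_pos h) hf hft hmin
      refine ⟨∫ y, Real.exp (-(2 * (γ / 2)) * (wPotential (dens ν f) y).toReal) ∂ν,
        integral_gibbs_pos (half_pos h).le (measurable_wPotential _).ennreal_toReal
          fun x => ENNReal.toReal_nonneg, ?_⟩
      filter_upwards [h1] with x hx
      rw [hx, gibbsDens, mul_div_cancel₀ γ two_ne_zero]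
  obtain ⟨Z, hZ, hfZ⟩ := hEL
  set C := ∫ y : Space n, edgeWeight α γ y with hC
  have hC0 : 0 < C := integral_edgeWeight_pos hα γ
  have hUm : Measurable fun x => (wPotential (dens ν f) x).toReal :=
    (measurable_wPotential _).ennreal_toReal
  set G : Space n → ℝ := fun x => Z⁻¹ * Real.exp (-γ * (wPotential (dens ν f) x).toReal) with hG
  have hGm : Measurable G := (hUm.const_mul _).exp.const_mul _
  have hG0 : ∀ x, 0 ≤ G x := fun x => by positivity
  have hGle : ∀ x, G x ≤ Z⁻¹ := fun x =>
    mul_le_of_le_one_right (by positivity) (Real.exp_le_one_iff.2 (by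
      nlinarith [mul_nonneg hγ (ENNReal.toReal_nonneg (a := wPotential (dens ν f) x))]))
  have hμd : dens ν f = volume.withDensity fun x => ENNReal.ofReal
      (G x * (C⁻¹ * edgeWeight α γ x)) := dens_reference hα hGm hG0 hfZ
  have hT : Tame α (dens ν f) := tame_of_dens_reference hα hGm hG0 hGle hfZ
  set I := ∫ z, logWeight z ∂(dens ν f) with hI
  -- In L the factor `Z` normalizes the density relative to the reference measure, `C` normalizes
  -- the reference measure, and e^{γI} absorbs the constant ∫ϑ dμ contained in the weighted
  -- potential. The factor e^{γϑ} of the reference cancels against the ϑ(x) of that potential.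
  refine ⟨μ, Z * C * Real.exp (γ * I), ⟨heq, huniq⟩, by positivity, ⟨fun x => ?_, ?_⟩, hT⟩
  · simp_rw [toReal_logKernel]
    exact (hT.integrable_log hα x).neg
  · change dens ν f = _
    refine hμd.trans ?_
    congr 1
    ext x
    congr 1
    rw [hG]
    simp only
    rw [hT.toReal_wPotential hα, ← hI, edgeWeight, mul_inv, mul_inv, ← Real.exp_neg]
    change _ = Z⁻¹ * C⁻¹ * Real.exp (-(γ * I)) *
      Real.exp (-γ * logPotential (dens ν f) x - potential α x)
    have : ∀ a b c d : ℝ, a * b * (c * d) = a * c * (b * d) := fun a b c d => by ring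
    rw [this, ← Real.exp_add, mul_assoc (Z⁻¹ * C⁻¹), ← Real.exp_add]
    ring_nf

end LogGas

/-! ### The equilibrium potential and a uniform Chernoff bound -/

namespace LogGas

variable {n : ℕ} [NeZero n] {α γ L : ℝ} {μ : Measure (Space n)}

/-- A tame probability measure which solves the self-consistent equation. -/
structure Solution (α γ L : ℝ) (μ : Measure (Space n)) : Prop where
  alpha_pos : 0 < α
  gamma_nonneg : 0 ≤ γ
  const_pos : 0 < L
  isProbabilityMeasure : IsProbabilityMeasure μ
  selfConsistent : SelfConsistent α γ L μ
  tame : Tame α μ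

/-- The corrected potential `U + ϑ`, which vanishes at infinity. -/
noncomputable def corrPotential (μ : Measure (Space n)) (x : Space n) : ℝ :=
  logPotential μ x + logWeight x

/-- The density of a solution of the self-consistent equation. -/
noncomputable def solDensity (α γ L : ℝ) (μ : Measure (Space n)) (x : Space n) : ℝ :=
  L⁻¹ * Real.exp (-γ * logPotential μ x - potential α x)

theorem log_one_add_le_two_mul_sqrt {t : ℝ} (ht : 0 ≤ t) : Real.log (1 + t) ≤ 2 * √t := by
  have h1 : 1 + t ≤ Real.exp √t ^ 2 := by
    have h2 := Real.add_one_le_exp √t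
    have h3 : (√t + 1) ^ 2 ≤ Real.exp √t ^ 2 := by gcongr
    nlinarith [Real.sq_sqrt ht, Real.sqrt_nonneg t]
  have h4 := Real.log_le_log (by positivity) h1
  rwa [Real.log_pow, Real.log_exp, Nat.cast_ofNat] at h4

theorem exp_half_singWeight (x y : Space n) :
    Real.exp (1 / 2 * singWeight x y) = √(1 + ‖x - y‖⁻¹) := by
  rw [singWeight, Real.sqrt_eq_rpow, Real.rpow_def_of_pos (by positivity)]
  ring_nf

theorem exp_logWeight (x : Space n) : Real.exp (logWeight x) = 1 + ‖x‖ :=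
  Real.exp_log (by positivity)

theorem exp_half_logWeight (x : Space n) : Real.exp (1 / 2 * logWeight x) = √(1 + ‖x‖) := by
  rw [exp_mul_logWeight, Real.sqrt_eq_rpow]

/-- Decay of order (1+|x|)^{-1/2} is bought with one power of 1+|z| and half a power of the
singularity. Both are integrable against a tame measure, uniformly in x, so U + ϑ vanishes at
infinity. -/
theorem abs_log_sub_logWeight_le_decay {x z : Space n} (h : x ≠ z) :
    |Real.log ‖x - z‖ - logWeight x| ≤
      2 * Real.exp (-(1 / 2 * logWeight x)) *
        Real.exp (1 * logWeight z + 1 / 2 * singWeight x z) := by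
  have h0 : 0 < ‖x - z‖ := norm_pos_iff.2 (sub_ne_zero.2 h)
  have hx := norm_nonneg x
  have hz := norm_nonneg z
  have hsx : 0 < √(1 + ‖x‖) := Real.sqrt_pos.2 (by positivity)
  have hs1 : 1 ≤ √(1 + ‖x - z‖⁻¹) := Real.one_le_sqrt.2 (by
    have : 0 < ‖x - z‖⁻¹ := by positivity
    linarith)
  have hR : 2 * Real.exp (-(1 / 2 * logWeight x)) *
      Real.exp (1 * logWeight z + 1 / 2 * singWeight x z) =
      2 * ((1 + ‖z‖) * √(1 + ‖x - z‖⁻¹) / √(1 + ‖x‖)) := by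
    rw [Real.exp_neg, exp_half_logWeight, Real.exp_add, exp_half_singWeight, one_mul, exp_logWeight]
    field_simp
  rw [hR, abs_le]
  constructor
  · have h1 : (1 + ‖x‖) / ‖x - z‖ ≤ 1 + (1 + ‖z‖) / ‖x - z‖ := by
      rw [div_le_iff₀ h0]
      have : ‖x‖ ≤ ‖x - z‖ + ‖z‖ := by simpa using norm_add_le (x - z) z
      field_simp
      linarith
    have h2 := Real.log_le_log (by positivity) h1
    rw [Real.log_div (by positivity) h0.ne'] at h2
    have h3 := log_one_add_le_two_mul_sqrt (t := (1 + ‖z‖) / ‖x - z‖) (by positivity)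
    have h4 : √((1 + ‖z‖) / ‖x - z‖) ≤ (1 + ‖z‖) * √(1 + ‖x - z‖⁻¹) / √(1 + ‖x‖) := by
      rw [le_div_iff₀ hsx, ← Real.sqrt_mul (by positivity), ← Real.sqrt_sq (by positivity :
        0 ≤ 1 + ‖z‖), ← Real.sqrt_mul (by positivity), Real.sqrt_sq (by positivity)]
      refine Real.sqrt_le_sqrt ?_
      have h5 : 1 + ‖x‖ ≤ (1 + ‖z‖) * (1 + ‖x - z‖) := by
        have : ‖x‖ ≤ ‖x - z‖ + ‖z‖ := by simpa using norm_add_le (x - z) z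
        nlinarith [mul_nonneg hz h0.le]
      calc (1 + ‖z‖) / ‖x - z‖ * (1 + ‖x‖)
          ≤ (1 + ‖z‖) / ‖x - z‖ * ((1 + ‖z‖) * (1 + ‖x - z‖)) := by gcongr
        _ = (1 + ‖z‖) ^ 2 * (1 + ‖x - z‖⁻¹) := by field_simp; ring
    unfold logWeight
    linarith
  · have h1 : ‖x - z‖ / (1 + ‖x‖) ≤ 1 + ‖z‖ / (1 + ‖x‖) := by
      rw [div_le_iff₀ (by positivity)]
      field_simp
      linarith [norm_sub_le x z]
    have h2 := Real.log_le_log (by positivity) h1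
    rw [Real.log_div h0.ne' (by positivity)] at h2
    have h3 := Real.log_le_sub_one_of_pos (by positivity : 0 < 1 + ‖z‖ / (1 + ‖x‖))
    have h4 : ‖z‖ / (1 + ‖x‖) ≤ (1 + ‖z‖) * √(1 + ‖x - z‖⁻¹) / √(1 + ‖x‖) := by
      have h6 : √(1 + ‖x‖) ≤ 1 + ‖x‖ := by
        rw [Real.sqrt_le_left (by positivity)]; nlinarith
      gcongr
      nlinarith
    have h5 : 0 ≤ (1 + ‖z‖) * √(1 + ‖x - z‖⁻¹) / √(1 + ‖x‖) := by positivity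
    unfold logWeight
    linarith

namespace Solution

theorem corrPotential_eq (S : Solution α γ L μ) (x : Space n) :
    corrPotential μ x = ∫ z, (logWeight x - Real.log ‖x - z‖) ∂μ := by
  have := S.isProbabilityMeasure
  rw [integral_sub (integrable_const _) (S.tame.integrable_log S.alpha_pos x), corrPotential,
    logPotential_eq, integral_neg]
  simp
  ring

theorem exists_abs_corrPotential_le (S : Solution α γ L μ) :
    ∃ B, 0 ≤ B ∧ ∀ x, |corrPotential μ x| ≤ B * Real.exp (-(1 / 2 * logWeight x)) := by
  have := S.isProbabilityMeasure
  obtain ⟨B, hB⟩ := S.tame.exists_integral_exp_le S.alpha_pos 1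
  have hB0 : 0 ≤ B := (integral_nonneg fun y => (Real.exp_pos _).le).trans (hB 0).2
  refine ⟨2 * B, by positivity, fun x => ?_⟩
  rw [S.corrPotential_eq, ← Real.norm_eq_abs]
  refine (norm_integral_le_of_norm_le ((hB x).1.const_mul (2 * Real.exp (-(1 / 2 * logWeight x))))
    ((S.tame.ae_ne x).mono fun z hz => ?_)).trans ?_
  · rw [Real.norm_eq_abs, abs_sub_comm]
    exact abs_log_sub_logWeight_le_decay hz
  · rw [integral_const_mul]
    have := mul_le_mul_of_nonneg_left (hB x).2 (Real.exp_pos (-(1 / 2 * logWeight x))).le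
    linarith

theorem tendsto_corrPotential (S : Solution α γ L μ) :
    Tendsto (corrPotential μ) (cocompact _) (𝓝 0) := by
  obtain ⟨B, -, hB⟩ := S.exists_abs_corrPotential_le
  refine squeeze_zero_norm hB ?_
  have h := Real.tendsto_exp_neg_atTop_nhds_zero.comp
    (tendsto_logWeight (n := n) |>.const_mul_atTop (by norm_num : (0 : ℝ) < 1 / 2))
  simpa using h.const_mul B

theorem exists_abs_corrPotential_le_const (S : Solution α γ L μ) :
    ∃ B, 0 ≤ B ∧ ∀ x, |corrPotential μ x| ≤ B := by
  obtain ⟨B, hB0, hB⟩ := S.exists_abs_corrPotential_le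
  exact ⟨B, hB0, fun x => (hB x).trans (mul_le_of_le_one_right hB0
    (Real.exp_le_one_iff.2 (by linarith [logWeight_nonneg x])))⟩

theorem measurable_logPotential (S : Solution α γ L μ) : Measurable (logPotential μ) := by
  have := S.isProbabilityMeasure
  have h : logPotential μ = fun x => (wPotential μ x).toReal - logWeight x -
      ∫ z, logWeight z ∂μ := by
    ext x
    rw [S.tame.toReal_wPotential S.alpha_pos]
    ring
  rw [h]
  exact ((measurable_wPotential μ).ennreal_toReal.sub measurable_logWeight).sub_const _

theorem measurable_corrPotential (S : Solution α γ L μ) : Measurable (corrPotential μ) :=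
  S.measurable_logPotential.add measurable_logWeight

theorem measurable_solDensity (S : Solution α γ L μ) : Measurable (solDensity α γ L μ) :=
  (((S.measurable_logPotential.const_mul _).sub
    (continuous_potential S.alpha_pos).measurable).exp).const_mul _

theorem solDensity_pos (S : Solution α γ L μ) (x : Space n) : 0 < solDensity α γ L μ x :=
  mul_pos (inv_pos.2 S.const_pos) (Real.exp_pos _)

theorem eq_withDensity (S : Solution α γ L μ) :
    μ = volume.withDensity fun x => ENNReal.ofReal (solDensity α γ L μ x) := S.selfConsistent.2

theorem solDensity_eq (x : Space n) : solDensity α γ L μ x =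
    L⁻¹ * (Real.exp (-γ * corrPotential μ x) * edgeWeight α γ x) := by
  rw [solDensity, edgeWeight, ← Real.exp_add, corrPotential]
  ring_nf

/-- The normalization of the equilibrium measure. -/
theorem integral_exp_corrPotential (S : Solution α γ L μ) :
    Integrable (fun x => Real.exp (-γ * corrPotential μ x) * edgeWeight α γ x) ∧
    ∫ x, Real.exp (-γ * corrPotential μ x) * edgeWeight α γ x = L := by
  have hp := S.isProbabilityMeasure
  have hd : IsDens volume (solDensity α γ L μ) := by
    refine ⟨S.measurable_solDensity, fun x => (S.solDensity_pos x).le, ?_⟩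
    have h := congrArg (fun ν : Measure (Space n) => ν Set.univ) S.eq_withDensity
    simp only [measure_univ] at h
    rw [h, withDensity_apply _ MeasurableSet.univ, setLIntegral_univ]
  have h : (fun x => Real.exp (-γ * corrPotential μ x) * edgeWeight α γ x) =
      fun x => L * solDensity α γ L μ x := by
    ext x
    rw [solDensity_eq, mul_inv_cancel_left₀ S.const_pos.ne']
  rw [h, integral_const_mul, hd.integral_eq, mul_one]
  exact ⟨hd.integrable.const_mul _, rfl⟩

/-- The regularized potential. -/
theorem exists_logPotential_sub_le (S : Solution α γ L μ) : ∃ B, 0 ≤ B ∧ ∀ d, 0 < d → d ≤ 1 →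
    ∀ x, Integrable (regKernel d x) μ ∧ ∫ z, regKernel d x z ∂μ ≤ logPotential μ x ∧
      logPotential μ x ≤ (∫ z, regKernel d x z ∂μ) + B * √d := by
  have := S.isProbabilityMeasure
  obtain ⟨B, hB⟩ := S.tame.exists_integral_exp_le S.alpha_pos 0
  have hB0 : 0 ≤ B := (integral_nonneg fun y => (Real.exp_pos _).le).trans (hB 0).2
  refine ⟨2 * B, by positivity, fun d hd hd1 x => ?_⟩
  have hI : Integrable (regKernel d x) μ := by
    refine Integrable.mono' ((integrable_const (-Real.log d)).add
      ((integrable_const (logWeight x)).add (S.tame.integrable_logWeight S.alpha_pos))) ?_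
      (ae_of_all _ fun z => abs_regKernel_le hd hd1 x z)
    exact ((continuous_regKernel hd).comp
      (continuous_const.prodMk continuous_id)).measurable.aestronglyMeasurable
  have hl : Integrable (fun z => -Real.log ‖x - z‖) μ :=
    (S.tame.integrable_log S.alpha_pos x).neg
  refine ⟨hI, ?_, ?_⟩
  · rw [logPotential_eq]
    refine integral_mono_ae hI hl ((S.tame.ae_ne x).mono fun z hz => ?_)
    have h0 : 0 < ‖x - z‖ := norm_pos_iff.2 (sub_ne_zero.2 hz)
    have h1 := Real.log_le_log (by positivity : 0 < ‖x - z‖ ^ 2)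
      (by nlinarith : ‖x - z‖ ^ 2 ≤ d ^ 2 + ‖x - z‖ ^ 2)
    rw [Real.log_pow] at h1
    push_cast at h1
    simp only [regKernel]
    linarith
  -- Regularizing at scale d costs at most log(1 + d/|x-z|) ≤ 2√(d/|x-z|), which has a finite
  -- integral of order √d.
  · have hpt : ∀ᵐ z ∂μ, -Real.log ‖x - z‖ ≤ regKernel d x z +
        2 * √d * Real.exp (0 * logWeight z + 1 / 2 * singWeight x z) := by
      filter_upwards [S.tame.ae_ne x] with z hz
      have h0 : 0 < ‖x - z‖ := norm_pos_iff.2 (sub_ne_zero.2 hz)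
      rw [zero_mul, zero_add, exp_half_singWeight]
      have h1 : d ^ 2 + ‖x - z‖ ^ 2 ≤ (‖x - z‖ * (1 + d / ‖x - z‖)) ^ 2 := by
        have : ‖x - z‖ * (1 + d / ‖x - z‖) = ‖x - z‖ + d := by field_simp
        rw [this]
        nlinarith [mul_pos h0 hd]
      have h2 := Real.log_le_log (by positivity) h1
      rw [Real.log_pow, Real.log_mul h0.ne' (by positivity)] at h2
      push_cast at h2
      have h3 := log_one_add_le_two_mul_sqrt (t := d / ‖x - z‖) (by positivity)
      have h4 : √(d / ‖x - z‖) ≤ √d * √(1 + ‖x - z‖⁻¹) := by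
        rw [← Real.sqrt_mul hd.le]
        refine Real.sqrt_le_sqrt ?_
        rw [div_eq_mul_inv]
        gcongr
        linarith
      simp only [regKernel]
      linarith
    have hE := (hB x).1.const_mul (2 * √d)
    rw [logPotential_eq]
    have hIE : Integrable (fun z => regKernel d x z +
        2 * √d * Real.exp (0 * logWeight z + 1 / 2 * singWeight x z)) μ := hI.add hE
    refine (integral_mono_ae hl hIE hpt).trans ?_
    rw [integral_add hI hE, integral_const_mul]
    have := mul_le_mul_of_nonneg_left (hB x).2 (Real.sqrt_nonneg d)
    linarith

end Solution

theorem exp_le_one_add_add_sq (s : ℝ) : Real.exp s ≤ 1 + s + s ^ 2 * Real.exp |s| := by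
  rcases le_total 0 s with hs | hs
  · rw [abs_of_nonneg hs]
    have h1 := Real.add_one_le_exp (-s)
    have h2 : Real.exp (-s) * Real.exp s = 1 := by rw [← Real.exp_add]; simp
    have h3 := Real.exp_pos s
    nlinarith [mul_le_mul_of_nonneg_right h1 h3.le]
  · have h1 := Real.add_one_le_exp (-s)
    have h2 : Real.exp (-s) * Real.exp s = 1 := by rw [← Real.exp_add]; simp
    have h3 : 1 ≤ Real.exp |s| := Real.one_le_exp (abs_nonneg s)
    have h4 : Real.exp s ≤ 1 + s + s ^ 2 := by
      have h5 := Real.exp_pos s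
      have h6 : (-s + 1) * Real.exp s ≤ 1 := by nlinarith
      have h7 : 1 ≤ (-s + 1) * (1 + s + s ^ 2) := by nlinarith [pow_nonneg (neg_nonneg.2 hs) 3]
      exact le_of_mul_le_mul_left (h6.trans h7) (by linarith)
    nlinarith [sq_nonneg s]

/-- Second-order remainder for the Chernoff bound. With |s| ≤ tY and t ≤ 1/8, the square and the
exponential each cost a multiple of e^{Y/8}, and Y/4 stays below the exponent θ + g/2 that is
integrable uniformly in x, up to a constant. -/
theorem sq_mul_exp_abs_le {t B X θ g σ : ℝ} (ht0 : 0 < t) (ht8 : t ≤ 1 / 8) (hB : 0 ≤ B)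
    (hθ : 0 ≤ θ) (hg : 0 ≤ g) (hσ : |σ| = 1) (hX : |X| ≤ θ + g + B) :
    (t * (σ * X) + 2 * t ^ 2 * (1 + θ)) ^ 2 * Real.exp |t * (σ * X) + 2 * t ^ 2 * (1 + θ)| ≤
      t ^ 2 * (128 * Real.exp ((B + 2) / 4) * Real.exp (1 * θ + 1 / 2 * g)) := by
  generalize hs : t * (σ * X) + 2 * t ^ 2 * (1 + θ) = s
  obtain ⟨Y, hY⟩ : ∃ Y, Y = 3 * θ + g + B + 2 := ⟨_, rfl⟩
  have hY0 : 0 ≤ Y := by linarith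
  have hsY : |s| ≤ t * Y := by
    have h3 : |s| ≤ |t * (σ * X)| + |2 * t ^ 2 * (1 + θ)| := hs ▸ abs_add_le _ _
    rw [abs_mul, abs_mul, hσ, one_mul, abs_of_pos ht0,
      abs_of_nonneg (by positivity : 0 ≤ 2 * t ^ 2 * (1 + θ))] at h3
    have h4 : t * |X| ≤ t * (θ + g + B) := by gcongr
    have h5 : 2 * t ^ 2 * (1 + θ) ≤ t * (2 * (1 + θ)) := by
      have : t ^ 2 ≤ t * 1 := by nlinarith
      nlinarith
    rw [hY]
    linarith
  have h6 : s ^ 2 ≤ t ^ 2 * Y ^ 2 := by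
    rw [← mul_pow, ← sq_abs s]
    gcongr
  have h7 : Real.exp |s| ≤ Real.exp (Y / 8) := Real.exp_le_exp.2 (by nlinarith)
  have h8 : Y ^ 2 ≤ 128 * Real.exp (Y / 8) := by
    have := Real.pow_div_factorial_le_exp (Y / 8) (by positivity) 2
    norm_num [Nat.factorial] at this
    nlinarith
  calc s ^ 2 * Real.exp |s| ≤ t ^ 2 * (128 * Real.exp (Y / 8)) * Real.exp (Y / 8) := by
        gcongr
        exact h6.trans (by gcongr)
    _ = t ^ 2 * (128 * Real.exp (Y / 4)) := by
        rw [mul_assoc, mul_assoc, ← Real.exp_add]; ring_nf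
    _ ≤ t ^ 2 * (128 * (Real.exp ((B + 2) / 4) * Real.exp (1 * θ + 1 / 2 * g))) := by
        rw [← Real.exp_add]
        gcongr
        rw [hY]
        linarith
    _ = _ := by ring

namespace Solution

/-- Uniform Chernoff bound for the logarithmic kernel. -/
theorem exists_chernoff (S : Solution α γ L μ) {η : ℝ} (hη : 0 < η) :
    ∃ ε t q : ℝ, 0 < ε ∧ 0 < t ∧ q < 1 ∧ 0 ≤ q ∧ ∀ σ : ℝ, |σ| = 1 → ∀ x : Space n,
      Integrable (fun y => Real.exp (t * (σ * (Real.log ‖x - y‖ + logPotential μ x) - η) +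
        2 * ε * (1 + logWeight y))) μ ∧
      ∫ y, Real.exp (t * (σ * (Real.log ‖x - y‖ + logPotential μ x) - η) +
        2 * ε * (1 + logWeight y)) ∂μ ≤ q := by
  have := S.isProbabilityMeasure
  obtain ⟨B, hB0, hB⟩ := S.exists_abs_corrPotential_le_const
  obtain ⟨B1, hB1⟩ := S.tame.exists_integral_exp_le S.alpha_pos 1
  have hB10 : 0 ≤ B1 := (integral_nonneg fun y => (Real.exp_pos _).le).trans (hB1 0).2
  have hθi := S.tame.integrable_logWeight S.alpha_pos
  set I := ∫ y, logWeight y ∂μ with hI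
  have hI0 : 0 ≤ I := integral_nonneg logWeight_nonneg
  set K := 2 * (1 + I) + 128 * Real.exp ((B + 2) / 4) * B1 with hK
  have hK0 : 0 < K := by positivity
  -- Chosen so that the second-order term Kt² is at most half of the linear gain tη. Taking ε = t²
  -- makes the extra weight 2ε(1 + ϑ) second order too.
  set t := min (1 / 8) (η / (2 * K)) with ht
  have ht0 : 0 < t := by positivity
  have ht8 : t ≤ 1 / 8 := min_le_left _ _
  have htK : K * t ≤ η / 2 := by
    have : t ≤ η / (2 * K) := min_le_right _ _
    rw [le_div_iff₀ (by positivity)] at this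
    linarith
  refine ⟨t ^ 2, t, Real.exp (-(t * η / 2)), by positivity, ht0,
    Real.exp_lt_one_iff.2 (by have := mul_pos ht0 hη; linarith), (Real.exp_pos _).le,
    fun σ hσ x => ?_⟩
  set X : Space n → ℝ := fun y => Real.log ‖x - y‖ + logPotential μ x with hX
  have hXi : Integrable X μ := (S.tame.integrable_log S.alpha_pos x).add (integrable_const _)
  -- Centring holds by the very definition of U; it removes the first-order term in t.
  have hX0 : ∫ y, X y ∂μ = 0 := by
    rw [hX, integral_add (S.tame.integrable_log S.alpha_pos x) (integrable_const _),
      logPotential_eq, integral_neg]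
    simp
  set s : Space n → ℝ := fun y => t * (σ * X y) + 2 * t ^ 2 * (1 + logWeight y) with hs
  have hsi1 : Integrable (fun y => t * (σ * X y)) μ := (hXi.const_mul σ).const_mul t
  have hsi2 : Integrable (fun y => 2 * t ^ 2 * (1 + logWeight y)) μ :=
    ((integrable_const 1).add hθi).const_mul _
  have hsi : Integrable s μ := hsi1.add hsi2
  have hsint : ∫ y, s y ∂μ = 2 * t ^ 2 * (1 + I) := by
    rw [hs, integral_add hsi1 hsi2, integral_const_mul, integral_const_mul, hX0,
      integral_const_mul, integral_add (integrable_const 1) hθi]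
    simp [hI]
  have hbd : ∀ᵐ y ∂μ, s y ^ 2 * Real.exp |s y| ≤ t ^ 2 * (128 * Real.exp ((B + 2) / 4) *
      Real.exp (1 * logWeight y + 1 / 2 * singWeight x y)) := by
    filter_upwards [S.tame.ae_ne x] with y hy
    have h1 := abs_log_norm_sub_sub_logWeight_le hy
    refine sq_mul_exp_abs_le ht0 ht8 hB0 (logWeight_nonneg y) (singWeight_nonneg x y) hσ ?_
    have : X y = (Real.log ‖x - y‖ - logWeight x) + corrPotential μ x := by
      simp only [hX, corrPotential]; ring
    rw [this]
    exact (abs_add_le _ _).trans (add_le_add h1 (hB x))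
  have hdom := ((hB1 x).1.const_mul (128 * Real.exp ((B + 2) / 4))).const_mul (t ^ 2)
  have hfull : Integrable (fun y => 1 + s y + t ^ 2 * (128 * Real.exp ((B + 2) / 4) *
      Real.exp (1 * logWeight y + 1 / 2 * singWeight x y))) μ :=
    ((integrable_const 1).add hsi).add hdom
  have hle : ∀ᵐ y ∂μ, Real.exp (s y) ≤ 1 + s y + t ^ 2 * (128 * Real.exp ((B + 2) / 4) *
      Real.exp (1 * logWeight y + 1 / 2 * singWeight x y)) :=
    hbd.mono fun y hy => (exp_le_one_add_add_sq (s y)).trans (by linarith)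
  have hes : Integrable (fun y => Real.exp (s y)) μ := by
    refine Integrable.mono' hfull (Real.continuous_exp.comp_aestronglyMeasurable hsi.1)
      (hle.mono fun y hy => ?_)
    rwa [Real.norm_of_nonneg (Real.exp_pos _).le]
  have heq : ∀ y, Real.exp (t * (σ * (Real.log ‖x - y‖ + logPotential μ x) - η) +
      2 * t ^ 2 * (1 + logWeight y)) = Real.exp (-(t * η)) * Real.exp (s y) := by
    intro y
    rw [← Real.exp_add]
    simp only [hs, hX]
    ring_nf
  simp_rw [heq]
  refine ⟨hes.const_mul _, ?_⟩
  rw [integral_const_mul]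
  have h1 : ∫ y, Real.exp (s y) ∂μ ≤ 1 + K * t ^ 2 := by
    refine (integral_mono_ae hes hfull hle).trans ?_
    have hi1 : Integrable (fun y => 1 + s y) μ := (integrable_const 1).add hsi
    rw [integral_add hi1 hdom, integral_add (integrable_const 1) hsi, hsint, integral_const_mul,
      integral_const_mul]
    have : 128 * Real.exp ((B + 2) / 4) *
        ∫ y, Real.exp (1 * logWeight y + 1 / 2 * singWeight x y) ∂μ
        ≤ 128 * Real.exp ((B + 2) / 4) * B1 := by
      gcongr
      exact (hB1 x).2
    simp only [integral_const, probReal_univ, smul_eq_mul, mul_one]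
    rw [hK]
    nlinarith [mul_le_mul_of_nonneg_left this (sq_nonneg t)]
  have h2 : 1 + K * t ^ 2 ≤ Real.exp (K * t ^ 2) := by
    linarith [Real.add_one_le_exp (K * t ^ 2)]
  calc Real.exp (-(t * η)) * ∫ y, Real.exp (s y) ∂μ
      ≤ Real.exp (-(t * η)) * Real.exp (K * t ^ 2) := by gcongr; linarith
    _ = Real.exp (-(t * η) + K * t * t) := by rw [← Real.exp_add]; ring_nf
    _ ≤ Real.exp (-(t * η / 2)) := by
        refine Real.exp_le_exp.2 ?_
        nlinarith

end Solution

end LogGas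

/-! ### The Gibbs weight as a real function -/

namespace LogGas

variable {n : ℕ}

/-- The product `∏_{i<j} |x_i - x_j|^β`, written symmetrically. -/
noncomputable def pairProd {N : ℕ} (β : ℝ) (x : Fin N → Space n) : ℝ :=
  ∏ i, ∏ j, if i = j then 1 else ‖x i - x j‖ ^ (β / 2)

/-- The unnormalized density of the Gibbs measure. -/
noncomputable def gibbsWeight {N : ℕ} (α β : ℝ) (x : Fin N → Space n) : ℝ :=
  pairProd β x * ∏ j, Real.exp (-potential α (x j))

theorem pairProd_nonneg {N : ℕ} (β : ℝ) (x : Fin N → Space n) : 0 ≤ pairProd β x :=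
  Finset.prod_nonneg fun i _ => Finset.prod_nonneg fun j _ => by
    split_ifs
    · exact zero_le_one
    · exact Real.rpow_nonneg (norm_nonneg _) _

theorem gibbsWeight_nonneg {N : ℕ} (α β : ℝ) (x : Fin N → Space n) : 0 ≤ gibbsWeight α β x :=
  mul_nonneg (pairProd_nonneg β x) (Finset.prod_nonneg fun _ _ => (Real.exp_pos _).le)

theorem measurable_pairProd {N : ℕ} (β : ℝ) :
    Measurable (pairProd β : (Fin N → Space n) → ℝ) := by
  unfold pairProd
  refine Finset.measurable_fun_prod _ fun i _ => Finset.measurable_fun_prod _ fun j _ => ?_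
  split_ifs
  · exact measurable_const
  · exact (((measurable_pi_apply i).sub (measurable_pi_apply j)).norm).pow_const _

theorem measurable_gibbsWeight {N : ℕ} {α : ℝ} (hα : 0 < α) (β : ℝ) :
    Measurable (gibbsWeight α β : (Fin N → Space n) → ℝ) :=
  (measurable_pairProd β).mul (Finset.measurable_fun_prod _ fun j _ =>
    ((continuous_potential hα).measurable.comp (measurable_pi_apply j)).neg.exp)

theorem pairProd_of_not_injective {N : ℕ} {β : ℝ} (hβ : 0 < β) {x : Fin N → Space n}
    (h : ¬ Function.Injective x) : pairProd β x = 0 := by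
  rw [Function.not_injective_iff] at h
  obtain ⟨i, j, hij, hne⟩ := h
  refine Finset.prod_eq_zero (Finset.mem_univ i) (Finset.prod_eq_zero (Finset.mem_univ j) ?_)
  rw [if_neg hne, hij, sub_self, norm_zero, Real.zero_rpow (by positivity)]

theorem pairProd_of_injective {N : ℕ} (β : ℝ) {x : Fin N → Space n}
    (h : Function.Injective x) :
    pairProd β x =
      Real.exp (β / 2 * ∑ i, ∑ j, if i = j then 0 else Real.log ‖x i - x j‖) := by
  rw [pairProd, Finset.mul_sum, Real.exp_sum]
  refine Finset.prod_congr rfl fun i _ => ?_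
  rw [Finset.mul_sum, Real.exp_sum]
  refine Finset.prod_congr rfl fun j _ => ?_
  split_ifs with hij
  · simp
  · rw [Real.rpow_def_of_pos (norm_pos_iff.2 (sub_ne_zero.2 fun h' => hij (h h'))), mul_comm]

theorem sum_ite_eq_two_mul_sum_Ioi {N : ℕ} (f : Fin N → Fin N → ℝ) (hf : ∀ i j, f i j = f j i) :
    (∑ i, ∑ j, if i = j then 0 else f i j) = 2 * ∑ i, ∑ j ∈ Finset.Ioi i, f i j := by
  have h := Finset.sum_sum_Ioi_add_eq_sum_sum_off_diag f
  have h1 : ∀ i, (∑ j, if i = j then 0 else f i j) = ∑ j ∈ {i}ᶜ, f j i := by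
    intro i
    rw [← Finset.sum_subset (Finset.subset_univ ({i}ᶜ : Finset (Fin N)))]
    · refine Finset.sum_congr rfl fun j hj => ?_
      have : i ≠ j := by simpa [eq_comm] using hj
      rw [if_neg this, hf]
    · intro j _ hj
      have : i = j := by simpa [eq_comm] using hj
      rw [if_pos this]
  simp_rw [h1, ← h, Finset.mul_sum]
  refine Finset.sum_congr rfl fun i _ => Finset.sum_congr rfl fun j _ => ?_
  rw [hf j i]
  ring

theorem EReal.sum_ne_bot {ι : Type*} (s : Finset ι) {f : ι → EReal} (h : ∀ i ∈ s, f i ≠ ⊥) :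
    ∑ i ∈ s, f i ≠ ⊥ := by
  classical
  induction s using Finset.induction_on with
  | empty => simp
  | insert a s ha ih =>
    rw [Finset.sum_insert ha]
    intro h0
    rcases EReal.add_eq_bot_iff.1 h0 with h1 | h1
    · exact h a (Finset.mem_insert_self a s) h1
    · exact ih (fun i hi => h i (Finset.mem_insert_of_mem hi)) h1

theorem EReal.sum_eq_top {ι : Type*} {s : Finset ι} {f : ι → EReal} (h : ∀ i ∈ s, f i ≠ ⊥)
    {a : ι} (ha : a ∈ s) (hfa : f a = ⊤) : ∑ i ∈ s, f i = ⊤ := by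
  classical
  rw [← Finset.add_sum_erase s f ha, hfa]
  exact EReal.top_add_of_ne_bot (EReal.sum_ne_bot _ fun i hi => h i (Finset.mem_of_mem_erase hi))

theorem EReal.coe_sum {ι : Type*} (s : Finset ι) (f : ι → ℝ) :
    ((∑ i ∈ s, f i : ℝ) : EReal) = ∑ i ∈ s, (f i : EReal) := by
  classical
  induction s using Finset.induction_on with
  | empty => simp
  | insert a s ha ih => rw [Finset.sum_insert ha, Finset.sum_insert ha, EReal.coe_add, ih]

theorem logKernel_ne_bot (x u : Space n) : logKernel x u ≠ ⊥ := by
  rcases eq_or_ne x u with rfl | h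
  · simp [logKernel_self]
  · rw [logKernel_of_ne h]
    exact EReal.coe_ne_bot _

/-- At a collision the energy is infinite and the product vanishes, both because β > 0. Elsewhere
the two sides agree through the logarithm. -/
theorem exp_neg_energy {N : ℕ} (α : ℝ) {β : ℝ} (hβ : 0 < β) (x : Fin N → Space n) :
    EReal.exp (-energy α β x) = ENNReal.ofReal (gibbsWeight α β x) := by
  by_cases h : Function.Injective x
  · have h0 : (∑ i, ∑ j ∈ Finset.Ioi i, logKernel (x i) (x j)) =
        ((∑ i, ∑ j ∈ Finset.Ioi i, -Real.log ‖x i - x j‖ : ℝ) : EReal) := by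
      rw [EReal.coe_sum]
      refine Finset.sum_congr rfl fun i _ => ?_
      rw [EReal.coe_sum]
      refine Finset.sum_congr rfl fun j hj => ?_
      exact logKernel_of_ne fun h1 => (Finset.mem_Ioi.1 hj).ne (h h1)
    have h1 : energy α β x = ((β * (∑ i, ∑ j ∈ Finset.Ioi i, -Real.log ‖x i - x j‖) +
        ∑ j, potential α (x j) : ℝ) : EReal) := by
      rw [energy, EReal.coe_add, EReal.coe_mul, h0]
    rw [h1, ← EReal.coe_neg, EReal.exp_coe, gibbsWeight, pairProd_of_injective β h,
      sum_ite_eq_two_mul_sum_Ioi (fun i j => Real.log ‖x i - x j‖)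
        (fun i j => by rw [norm_sub_rev]), ← Real.exp_sum, ← Real.exp_add]
    congr 2
    simp only [Finset.sum_neg_distrib]
    ring
  · rw [gibbsWeight, pairProd_of_not_injective hβ h, zero_mul, ENNReal.ofReal_zero]
    have h1 : energy α β x = ⊤ := by
      rw [Function.not_injective_iff] at h
      obtain ⟨i, j, hij, hne⟩ := h
      wlog hlt : i < j generalizing i j
      · exact this j i hij.symm hne.symm (lt_of_le_of_ne (not_lt.1 hlt) hne.symm)
      rw [energy, EReal.sum_eq_top (fun i _ => EReal.sum_ne_bot _ fun j _ => logKernel_ne_bot _ _)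
        (Finset.mem_univ i) (EReal.sum_eq_top (fun j _ => logKernel_ne_bot _ _)
          (Finset.mem_Ioi.2 hlt) (by rw [hij, logKernel_self])), EReal.coe_mul_top_of_pos hβ,
        EReal.top_add_coe]
    rw [h1, EReal.neg_top, EReal.exp_bot]

/-- Insertion of a particle. -/
theorem gibbsWeight_insertNth {M : ℕ} (α β : ℝ) (k : Fin (M + 1)) (a : Space n)
    (y : Fin M → Space n) :
    gibbsWeight α β (k.insertNth (α := fun _ => Space n) a y) =
      gibbsWeight α β y * (Real.exp (-potential α a) * ∏ j, ‖a - y j‖ ^ β) := by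
  -- The symmetric product meets each pair containing the new particle twice, with exponent β/2 each
  -- time.
  have hsq : ∀ t : ℝ, 0 ≤ t → t ^ (β / 2) * t ^ (β / 2) = t ^ β := fun t ht => by
    rw [← Real.mul_rpow ht ht, ← pow_two, ← Real.rpow_natCast, ← Real.rpow_mul ht]
    congr 1
    push_cast
    ring
  have h1 : pairProd β (k.insertNth (α := fun _ => Space n) a y) =
      pairProd β y * ∏ j, ‖a - y j‖ ^ β := by
    simp only [pairProd, Fin.prod_univ_succAbove _ k, Fin.insertNth_apply_same,
      Fin.insertNth_apply_succAbove, if_true, one_mul, (Fin.succAbove_ne k _).symm,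
      Fin.succAbove_ne k _, if_false, Fin.succAbove_right_inj, Finset.prod_mul_distrib]
    rw [mul_comm (∏ i, ‖y i - a‖ ^ (β / 2)), mul_left_comm, ← Finset.prod_mul_distrib]
    congr 1
    refine Finset.prod_congr rfl fun j _ => ?_
    rw [norm_sub_rev (y j) a, hsq _ (norm_nonneg _)]
  rw [gibbsWeight, h1, gibbsWeight, Fin.prod_univ_succAbove _ k]
  simp only [Fin.insertNth_apply_same, Fin.insertNth_apply_succAbove]
  ring

end LogGas

/-! ### Domination of the Gibbs law by products of the equilibrium measure -/

namespace LogGas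

section Pi

variable {X : Type*} [MeasurableSpace X] {M : ℕ}

theorem pi_withDensity_ofReal {ν : Measure X} [SigmaFinite ν] {p : X → ℝ} (hp : Integrable p ν)
    (hp0 : ∀ x, 0 ≤ p x)
    [SigmaFinite (ν.withDensity fun x => ENNReal.ofReal (p x))] :
    Measure.pi (fun _ : Fin M => ν.withDensity fun x => ENNReal.ofReal (p x)) =
      (Measure.pi fun _ : Fin M => ν).withDensity fun x => ENNReal.ofReal (∏ i, p (x i)) := by
  refine Measure.pi_eq fun s hs => ?_
  have h0 : ∀ x : Fin M → X, 0 ≤ ∏ i, p (x i) := fun x => Finset.prod_nonneg fun i _ => hp0 _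
  rw [withDensity_apply _ (MeasurableSet.univ_pi hs), Measure.restrict_pi_pi,
    ← ofReal_integral_eq_lintegral_ofReal
      (Integrable.fintype_prod fun i => hp.restrict) (ae_of_all _ h0),
    integral_fintype_prod_eq_prod (fun _ => p),
    ENNReal.ofReal_prod_of_nonneg fun i _ => integral_nonneg hp0]
  refine Finset.prod_congr rfl fun i _ => ?_
  rw [withDensity_apply _ (hs i), ofReal_integral_eq_lintegral_ofReal hp.restrict
    (ae_of_all _ hp0)]

theorem measurePreserving_eval_pair (μ : Measure X) [IsProbabilityMeasure μ] {i j : Fin M}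
    (hij : i ≠ j) :
    MeasurePreserving (fun x : Fin M → X => (x i, x j)) (Measure.pi fun _ => μ) (μ.prod μ) := by
  refine ⟨by fun_prop, ?_⟩
  rw [← Measure.infinitePi_eq_pi]
  exact Measure.infinitePi_map_eval_prod hij

theorem measurePreserving_eval_one (μ : Measure X) [IsProbabilityMeasure μ] (i : Fin M) :
    MeasurePreserving (fun x : Fin M → X => x i) (Measure.pi fun _ => μ) μ :=
  measurePreserving_eval (fun _ => μ) i

end Pi

section Empirical

variable {n M : ℕ}

/-- The quadratic inequality for the regularized kernel and an empirical measure. -/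
theorem two_mul_sum_integral_regKernel_le {μ : Measure (Space n)} [IsProbabilityMeasure μ]
    (hμ : Integrable logWeight μ) {d : ℝ} (hd : 0 < d) (hd1 : d ≤ 1) (hM : 0 < M)
    (x : Fin M → Space n) :
    2 * M * ∑ i, ∫ z, regKernel d (x i) z ∂μ ≤
      (∑ i, ∑ j, regKernel d (x i) (x j)) + M ^ 2 * ∫ y, ∫ z, regKernel d y z ∂μ ∂μ := by
  have hM' : (0 : ℝ) < M := Nat.cast_pos.2 hM
  -- The regularized kernel is finite on the diagonal, so its convexity inequality can be tested on
  -- a measure with atoms; the result is then multiplied by M².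
  set ρ : Measure (Space n) := (M : ℝ≥0∞)⁻¹ • ∑ i, Measure.dirac (x i) with hρ
  have hprob : IsProbabilityMeasure ρ := ⟨by
    rw [hρ, Measure.smul_apply, Measure.finsetSum_apply]
    simp only [measure_univ, Finset.sum_const, Finset.card_univ, Fintype.card_fin, nsmul_eq_mul,
      mul_one, smul_eq_mul]
    exact ENNReal.inv_mul_cancel (by simpa using hM.ne') (ENNReal.natCast_ne_top M)⟩
  have hint : ∀ f : Space n → ℝ, Integrable f ρ ∧ ∫ y, f y ∂ρ = (M : ℝ)⁻¹ * ∑ i, f (x i) := by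
    intro f
    have h1 : ∀ i ∈ (Finset.univ : Finset (Fin M)), Integrable f (Measure.dirac (x i)) :=
      fun i _ => integrable_dirac (by simp)
    refine ⟨(integrable_finsetSum_measure.2 h1).smul_measure (by simpa using hM.ne'), ?_⟩
    rw [hρ, integral_smul_measure, integral_finsetSum_measure h1]
    simp
  have hρθ : Integrable logWeight ρ := (hint _).1
  have h := two_mul_integral_regKernel_le hd hd1 hρθ hμ
  rw [integral_prod _ (integrable_regKernel hd hd1 hρθ hμ),
    integral_prod _ (integrable_regKernel hd hd1 hρθ hρθ),
    integral_prod _ (integrable_regKernel hd hd1 hμ hμ), (hint _).2, (hint _).2] at h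
  simp only [(hint _).2, ← Finset.mul_sum] at h
  have h2 := mul_le_mul_of_nonneg_left h (sq_nonneg (M : ℝ))
  have e1 : (M : ℝ) ^ 2 * (2 * ((M : ℝ)⁻¹ * ∑ i, ∫ z, regKernel d (x i) z ∂μ)) =
      2 * M * ∑ i, ∫ z, regKernel d (x i) z ∂μ := by
    field_simp
  have e2 : (M : ℝ) ^ 2 * ((M : ℝ)⁻¹ * ((M : ℝ)⁻¹ * ∑ i, ∑ j, regKernel d (x i) (x j)) +
      ∫ y, ∫ z, regKernel d y z ∂μ ∂μ) = (∑ i, ∑ j, regKernel d (x i) (x j)) +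
      M ^ 2 * ∫ y, ∫ z, regKernel d y z ∂μ ∂μ := by
    field_simp
  rwa [e1, e2] at h2

end Empirical

namespace Solution

variable {n : ℕ} [NeZero n] {α γ L : ℝ} {μ : Measure (Space n)}

theorem exists_abs_logPotential_le (S : Solution α γ L μ) :
    ∃ B, 0 ≤ B ∧ ∀ x, |logPotential μ x| ≤ B + logWeight x := by
  obtain ⟨B, hB0, hB⟩ := S.exists_abs_corrPotential_le_const
  refine ⟨B, hB0, fun x => ?_⟩
  have h1 := abs_le.1 (hB x)
  have h2 := logWeight_nonneg x
  unfold corrPotential at h1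
  rw [abs_le]
  constructor <;> linarith [h1.1, h1.2]

theorem integrable_logPotential (S : Solution α γ L μ) : Integrable (logPotential μ) μ := by
  have := S.isProbabilityMeasure
  obtain ⟨B, hB0, hB⟩ := S.exists_abs_logPotential_le
  exact Integrable.mono' ((integrable_const B).add (S.tame.integrable_logWeight S.alpha_pos))
    S.measurable_logPotential.aestronglyMeasurable (ae_of_all _ hB)

/-- Expanding the nonnegative regularized energy of the empirical measure minus μ bounds the pair
interaction by one-body potentials. Regularization costs a multiple of √d per pair, and log d
appears once per particle through the diagonal. -/
theorem pairProd_le (S : Solution α γ L μ) : ∃ B, 0 ≤ B ∧ ∀ d, 0 < d → d ≤ 1 →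
    ∀ M : ℕ, 0 < M → ∀ β, 0 < β → ∀ x : Fin M → Space n, pairProd β x ≤
      Real.exp (-(M * β) * (∑ i, logPotential μ (x i)) + M * β * M * (B * √d) +
        M * β * M * (∫ y, logPotential μ y ∂μ) / 2 - M * β * Real.log d / 2) := by
  have := S.isProbabilityMeasure
  obtain ⟨B, hB0, hB⟩ := S.exists_logPotential_sub_le
  refine ⟨B, hB0, fun d hd hd1 M hM β hβ x => ?_⟩
  by_cases hx : Function.Injective x
  swap
  · rw [pairProd_of_not_injective hβ hx]
    exact (Real.exp_pos _).le
  rw [pairProd_of_injective β hx]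
  refine Real.exp_le_exp.2 ?_
  have hθ := S.tame.integrable_logWeight S.alpha_pos
  have h1 := two_mul_sum_integral_regKernel_le hθ hd hd1 hM x
  have h2 : ∑ i, logPotential μ (x i) - M * (B * √d) ≤ ∑ i, ∫ z, regKernel d (x i) z ∂μ := by
    have : ∑ i, (logPotential μ (x i) - B * √d) ≤ ∑ i, ∫ z, regKernel d (x i) z ∂μ :=
      Finset.sum_le_sum fun i _ => by linarith [(hB d hd hd1 (x i)).2.2]
    simpa [Finset.sum_sub_distrib] using this
  have h3 : ∫ y, ∫ z, regKernel d y z ∂μ ∂μ ≤ ∫ y, logPotential μ y ∂μ :=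
    integral_mono (integrable_regKernel hd hd1 hθ hθ).integral_prod_left S.integrable_logPotential
      fun y => (hB d hd hd1 y).2.1
  have h4 : (∑ i, ∑ j, if i = j then 0 else Real.log ‖x i - x j‖) ≤
      -(∑ i, ∑ j, regKernel d (x i) (x j)) - M * Real.log d := by
    -- On the diagonal the regularized kernel equals -log d; off it, it lies below the true kernel.
    have : ∀ i j, (if i = j then 0 else Real.log ‖x i - x j‖) ≤
        -regKernel d (x i) (x j) - if i = j then Real.log d else 0 := by
      intro i j
      split_ifs with hij
      · subst hij
        simp only [regKernel, sub_self, norm_zero]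
        rw [zero_pow two_ne_zero, add_zero, Real.log_pow]
        push_cast
        linarith
      · have h0 : 0 < ‖x i - x j‖ := norm_pos_iff.2 (sub_ne_zero.2 fun h' => hij (hx h'))
        have h5 := Real.log_le_log (by positivity) (by nlinarith [sq_nonneg d] :
          ‖x i - x j‖ ^ 2 ≤ d ^ 2 + ‖x i - x j‖ ^ 2)
        rw [Real.log_pow] at h5
        unfold regKernel
        push_cast at h5
        linarith
    refine (Finset.sum_le_sum fun i _ => Finset.sum_le_sum fun j _ => this i j).trans ?_
    simp [Finset.sum_sub_distrib]
  have hM' : (0 : ℝ) < M := Nat.cast_pos.2 hM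
  have h5 : (∑ i, ∑ j, if i = j then 0 else Real.log ‖x i - x j‖) ≤
      -(2 * M * (∑ i, logPotential μ (x i) - M * (B * √d))) +
        M ^ 2 * (∫ y, logPotential μ y ∂μ) - M * Real.log d := by
    have h6 := mul_le_mul_of_nonneg_left h2 (by positivity : (0 : ℝ) ≤ 2 * M)
    have h7 := mul_le_mul_of_nonneg_left h3 (by positivity : (0 : ℝ) ≤ M ^ 2)
    linarith
  have h6 := mul_le_mul_of_nonneg_left h5 (by positivity : 0 ≤ β / 2)
  linarith

/-- The Gibbs weight relative to the product of the equilibrium measures. -/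
theorem gibbsWeight_eq (S : Solution α γ L μ) {M : ℕ} (β : ℝ) (x : Fin M → Space n) :
    gibbsWeight α β x = (∏ i, solDensity α γ L μ (x i)) *
      (L ^ M * (Real.exp (γ * ∑ i, logPotential μ (x i)) * pairProd β x)) := by
  have hL := S.const_pos
  have h : ∀ i, solDensity α γ L μ (x i) =
      L⁻¹ * Real.exp (-γ * logPotential μ (x i)) * Real.exp (-potential α (x i)) := fun i => by
    rw [solDensity, mul_assoc, ← Real.exp_add, sub_eq_add_neg]
  have h2 : (∏ i, Real.exp (-γ * logPotential μ (x i))) *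
      Real.exp (γ * ∑ i, logPotential μ (x i)) = 1 := by
    rw [← Real.exp_sum, ← Real.exp_add, ← Finset.mul_sum, neg_mul, neg_add_cancel, Real.exp_zero]
  have h3 : L⁻¹ ^ M * L ^ M = 1 := by rw [← mul_pow, inv_mul_cancel₀ hL.ne', one_pow]
  simp_rw [h, Finset.prod_mul_distrib, Finset.prod_const, Finset.card_univ, Fintype.card_fin]
  rw [gibbsWeight]
  calc pairProd β x * ∏ j, Real.exp (-potential α (x j))
      = (L⁻¹ ^ M * L ^ M) * ((∏ i, Real.exp (-γ * logPotential μ (x i))) *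
        Real.exp (γ * ∑ i, logPotential μ (x i))) *
        (pairProd β x * ∏ j, Real.exp (-potential α (x j))) := by rw [h2, h3]; ring
    _ = _ := by ring

theorem isDens_solDensity (S : Solution α γ L μ) : IsDens volume (solDensity α γ L μ) := by
  have hp := S.isProbabilityMeasure
  refine ⟨S.measurable_solDensity, fun x => (S.solDensity_pos x).le, ?_⟩
  have h := congrArg (fun ν : Measure (Space n) => ν Set.univ) S.eq_withDensity
  simp only [measure_univ] at h
  rw [h, withDensity_apply _ MeasurableSet.univ, setLIntegral_univ]

theorem pi_eq (S : Solution α γ L μ) (M : ℕ) : Measure.pi (fun _ : Fin M => μ) =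
    (volume : Measure (Fin M → Space n)).withDensity fun x =>
      ENNReal.ofReal (∏ i, solDensity α γ L μ (x i)) := by
  have := S.isProbabilityMeasure
  have h := S.isDens_solDensity
  have h2 : IsProbabilityMeasure
      (volume.withDensity fun x : Space n => ENNReal.ofReal (solDensity α γ L μ x)) := by
    rw [← S.eq_withDensity]
    infer_instance
  have h3 := pi_withDensity_ofReal (M := M) h.integrable
    fun x => (S.solDensity_pos x).le
  rw [← volume_pi] at h3
  rw [← h3]
  congr 1
  ext1 i
  exact S.eq_withDensity

theorem measurable_prod_solDensity (S : Solution α γ L μ) (M : ℕ) :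
    Measurable fun x : Fin M → Space n => ∏ i, solDensity α γ L μ (x i) :=
  Finset.measurable_fun_prod _ fun i _ => S.measurable_solDensity.comp (measurable_pi_apply i)

theorem integrable_pi_iff (S : Solution α γ L μ) {M : ℕ} {f : (Fin M → Space n) → ℝ} :
    Integrable f (Measure.pi fun _ => μ) ↔
      Integrable fun x => (∏ i, solDensity α γ L μ (x i)) * f x := by
  rw [S.pi_eq, integrable_withDensity_iff_integrable_smul'
    (S.measurable_prod_solDensity M).ennreal_ofReal
    (ae_of_all _ fun _ => ENNReal.ofReal_lt_top)]
  refine integrable_congr (ae_of_all _ fun x => ?_)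
  simp only [smul_eq_mul]
  rw [ENNReal.toReal_ofReal (Finset.prod_nonneg fun i _ => (S.solDensity_pos _).le)]

theorem integral_pi (S : Solution α γ L μ) {M : ℕ} (f : (Fin M → Space n) → ℝ) :
    ∫ x, f x ∂(Measure.pi fun _ => μ) = ∫ x, (∏ i, solDensity α γ L μ (x i)) * f x := by
  rw [S.pi_eq, integral_withDensity_eq_integral_toReal_smul
    (S.measurable_prod_solDensity M).ennreal_ofReal
    (ae_of_all _ fun _ => ENNReal.ofReal_lt_top)]
  refine integral_congr_ae (ae_of_all _ fun x => ?_)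
  simp only [smul_eq_mul]
  rw [ENNReal.toReal_ofReal (Finset.prod_nonneg fun i _ => (S.solDensity_pos _).le)]

theorem integrable_log_prod (S : Solution α γ L μ) :
    Integrable (fun p : Space n × Space n => Real.log ‖p.1 - p.2‖) (μ.prod μ) := by
  have := S.isProbabilityMeasure
  obtain ⟨B, hB⟩ := S.tame.exists_integral_le S.alpha_pos 1
  have hm : Measurable fun p : Space n × Space n => Real.log ‖p.1 - p.2‖ := by fun_prop
  rw [integrable_prod_iff hm.aestronglyMeasurable]
  refine ⟨ae_of_all _ fun x => S.tame.integrable_log S.alpha_pos x, ?_⟩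
  refine Integrable.mono' ((S.tame.integrable_logWeight S.alpha_pos).add (integrable_const B))
    (hm.norm.stronglyMeasurable.integral_prod_right').aestronglyMeasurable
    (ae_of_all _ fun x => ?_)
  rw [Real.norm_of_nonneg (integral_nonneg fun y => norm_nonneg _)]
  have h1 : Integrable (fun y => logWeight x + (1 * logWeight y + singWeight x y)) μ :=
    (integrable_const _).add (hB x).1
  refine (integral_mono_ae (S.tame.integrable_log S.alpha_pos x).norm h1
    ((S.tame.ae_ne x).mono fun y hy => ?_)).trans ?_
  · have h2 := abs_le.1 (abs_log_norm_sub_sub_logWeight_le hy)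
    have h3 := logWeight_nonneg x
    simp only
    rw [Real.norm_eq_abs, abs_le]
    constructor <;> linarith [h2.1, h2.2]
  · rw [integral_add (integrable_const _) (hB x).1]
    simp only [integral_const, probReal_univ, smul_eq_mul, one_mul]
    have := (hB x).2
    simp only [one_mul] at this
    simp only [Pi.add_apply]
    linarith

theorem ae_injective_pi (S : Solution α γ L μ) (M : ℕ) :
    ∀ᵐ x ∂(Measure.pi fun _ : Fin M => μ), Function.Injective x := by
  have := S.isProbabilityMeasure
  have h : ∀ i j : Fin M, i ≠ j → ∀ᵐ x ∂(Measure.pi fun _ : Fin M => μ), x i ≠ x j := by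
    intro i j hij
    have h1 : ∀ᵐ p ∂(μ.prod μ), p.1 ≠ p.2 := by
      refine (Measure.ae_prod_iff_ae_ae (p := fun p : Space n × Space n => p.1 ≠ p.2)
        (measurableSet_eq_fun measurable_fst measurable_snd).compl).2 ?_
      exact ae_of_all _ fun x => S.tame.ae_ne x
    exact (measurePreserving_eval_pair μ hij).quasiMeasurePreserving.ae h1
  have h2 : ∀ᵐ x ∂(Measure.pi fun _ : Fin M => μ), ∀ i j, i ≠ j → x i ≠ x j := by
    refine ae_all_iff.2 fun i => ae_all_iff.2 fun j => ?_
    by_cases hij : i = j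
    · exact ae_of_all _ fun x h' => absurd hij h'
    · exact (h i j hij).mono fun x hx _ => hx
  filter_upwards [h2] with x hx i j hij
  by_contra hne
  exact hx i j hne hij

/-- Lower bound of the partition function by Jensen's inequality. -/
theorem le_integral_gibbsWeight (S : Solution α γ L μ) {M : ℕ} (β : ℝ)
    (hI : Integrable (gibbsWeight α β : (Fin M → Space n) → ℝ)) :
    L ^ M * Real.exp (γ * (M * ∫ y, logPotential μ y ∂μ) -
      β / 2 * (M * (M - 1) * ∫ y, logPotential μ y ∂μ)) ≤
      ∫ x : Fin M → Space n, gibbsWeight α β x := by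
  have := S.isProbabilityMeasure
  set I := ∫ y, logPotential μ y ∂μ with hIdef
  set m := γ * (M * I) - β / 2 * (M * (M - 1) * I) with hm
  set v : (Fin M → Space n) → ℝ := fun x => γ * (∑ i, logPotential μ (x i)) +
    β / 2 * ∑ i, ∑ j, if i = j then 0 else Real.log ‖x i - x j‖ with hv
  have hl : ∀ i j : Fin M, Integrable (fun x : Fin M → Space n =>
      if i = j then 0 else Real.log ‖x i - x j‖) (Measure.pi fun _ => μ) ∧
      ∫ x : Fin M → Space n, (if i = j then 0 else Real.log ‖x i - x j‖)
        ∂(Measure.pi fun _ => μ) = if i = j then 0 else -I := by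
    intro i j
    split_ifs with hij
    · exact ⟨integrable_zero _ _ _, integral_zero _ _⟩
    · have h1 := measurePreserving_eval_pair μ hij
      have h2 : AEStronglyMeasurable (fun p : Space n × Space n => Real.log ‖p.1 - p.2‖)
          (μ.prod μ) := S.integrable_log_prod.1
      refine ⟨(h1.integrable_comp h2).2 S.integrable_log_prod, ?_⟩
      have h3 := integral_map (μ := Measure.pi fun _ : Fin M => μ) h1.measurable.aemeasurable
        (by rw [h1.map_eq]; exact h2)
      rw [h1.map_eq] at h3
      rw [← h3, integral_prod _ S.integrable_log_prod, hIdef, ← integral_neg]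
      refine integral_congr_ae (ae_of_all _ fun x => ?_)
      simp only [logPotential_eq, integral_neg, neg_neg]
  have hU : ∀ i : Fin M, Integrable (fun x : Fin M → Space n => logPotential μ (x i))
      (Measure.pi fun _ => μ) ∧
      ∫ x : Fin M → Space n, logPotential μ (x i) ∂(Measure.pi fun _ => μ) = I := by
    intro i
    have h1 := measurePreserving_eval_one μ i
    refine ⟨(h1.integrable_comp S.integrable_logPotential.1).2 S.integrable_logPotential, ?_⟩
    have h3 := integral_map (μ := Measure.pi fun _ : Fin M => μ) h1.measurable.aemeasurable
      (by rw [h1.map_eq]; exact S.integrable_logPotential.1)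
    rw [h1.map_eq] at h3
    exact h3.symm
  have hi1 : Integrable (fun x : Fin M → Space n => γ * ∑ i, logPotential μ (x i))
      (Measure.pi fun _ => μ) := (integrable_finsetSum _ fun i _ => (hU i).1).const_mul _
  have hi2 : Integrable (fun x : Fin M → Space n =>
      β / 2 * ∑ i, ∑ j, if i = j then 0 else Real.log ‖x i - x j‖)
      (Measure.pi fun _ => μ) :=
    (integrable_finsetSum _ fun i _ => integrable_finsetSum _ fun j _ => (hl i j).1).const_mul _
  have hvi : Integrable v (Measure.pi fun _ => μ) := hi1.add hi2
  have hvm : ∫ x, v x ∂(Measure.pi fun _ => μ) = m := by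
    rw [hv, integral_add hi1 hi2, integral_const_mul, integral_const_mul,
      integral_finsetSum _ fun i _ => (hU i).1, integral_finsetSum _ fun i _ =>
      integrable_finsetSum _ fun j _ => (hl i j).1]
    have h1 : ∀ i : Fin M, ∫ x : Fin M → Space n, (∑ j, if i = j then 0 else
        Real.log ‖x i - x j‖) ∂(Measure.pi fun _ => μ) = -(M - 1) * I := by
      intro i
      rw [integral_finsetSum _ fun j _ => (hl i j).1]
      have h2 : ∀ j : Fin M, (if i = j then 0 else -I) = -I + if i = j then I else 0 := by
        intro j
        split_ifs <;> simp
      simp_rw [(hl i _).2, h2, Finset.sum_add_distrib]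
      simp only [Finset.sum_const, Finset.card_univ, Fintype.card_fin, nsmul_eq_mul,
        Finset.sum_ite_eq, Finset.mem_univ, if_true]
      ring
    simp_rw [h1, (hU _).2]
    simp only [Finset.sum_const, Finset.card_univ, Fintype.card_fin, nsmul_eq_mul]
    rw [hm]
    ring
  have hg : Integrable (fun x : Fin M → Space n => L ^ M *
      (Real.exp (γ * ∑ i, logPotential μ (x i)) * pairProd β x)) (Measure.pi fun _ => μ) := by
    rw [S.integrable_pi_iff]
    exact hI.congr (ae_of_all _ fun x => S.gibbsWeight_eq β x)
  have hz : ∫ x : Fin M → Space n, gibbsWeight α β x = ∫ x : Fin M → Space n, L ^ M *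
      (Real.exp (γ * ∑ i, logPotential μ (x i)) * pairProd β x) ∂(Measure.pi fun _ => μ) := by
    rw [S.integral_pi]
    exact integral_congr_ae (ae_of_all _ fun x => S.gibbsWeight_eq β x)
  -- Jensen's inequality in tangent form, e^v ≥ e^m(1 + v - m), at the mean m of v.
  have hlow : Integrable (fun x => L ^ M * (Real.exp m * (1 - m + v x)))
      (Measure.pi fun _ : Fin M => μ) :=
    (((integrable_const (1 - m)).add hvi).const_mul _).const_mul _
  have hle : ∀ᵐ x ∂(Measure.pi fun _ : Fin M => μ), L ^ M * (Real.exp m * (1 - m + v x)) ≤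
      L ^ M * (Real.exp (γ * ∑ i, logPotential μ (x i)) * pairProd β x) := by
    filter_upwards [S.ae_injective_pi M] with x hx
    rw [pairProd_of_injective β hx, ← Real.exp_add]
    refine mul_le_mul_of_nonneg_left ?_ (pow_nonneg S.const_pos.le M)
    have h1 := Real.add_one_le_exp (v x - m)
    calc Real.exp m * (1 - m + v x) ≤ Real.exp m * Real.exp (v x - m) := by
          refine mul_le_mul_of_nonneg_left ?_ (Real.exp_pos _).le
          linarith
      _ = Real.exp (v x) := by rw [← Real.exp_add, add_sub_cancel]
  rw [hz]
  refine le_trans (le_of_eq ?_) (integral_mono_ae hlow hg hle)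
  rw [integral_const_mul, integral_const_mul, integral_add (integrable_const _) hvi, hvm]
  simp

theorem integrable_exp_mul_solDensity (S : Solution α γ L μ) (ε : ℝ) :
    Integrable fun x => Real.exp (ε * (1 + logWeight x)) * solDensity α γ L μ x := by
  obtain ⟨B, hB0, hB⟩ := S.exists_abs_corrPotential_le_const
  refine Integrable.mono' ((edgeWeight_integrable S.alpha_pos (γ + ε)).const_mul
    (Real.exp ε * (L⁻¹ * Real.exp (γ * B)))) ?_ (ae_of_all _ fun x => ?_)
  · exact (((measurable_logWeight.const_add 1).const_mul ε).exp.mul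
      S.measurable_solDensity).aestronglyMeasurable
  · rw [Real.norm_of_nonneg (mul_nonneg (Real.exp_pos _).le (S.solDensity_pos x).le),
      solDensity_eq, edgeWeight_add, mul_add, mul_one, Real.exp_add]
    have h1 : Real.exp (-γ * corrPotential μ x) ≤ Real.exp (γ * B) := by
      refine Real.exp_le_exp.2 ?_
      have := mul_le_mul_of_nonneg_left (abs_le.1 (hB x)).1 S.gamma_nonneg
      linarith
    have hL := inv_pos.2 S.const_pos
    have he := edgeWeight_pos α γ x
    calc Real.exp ε * Real.exp (ε * logWeight x) *
          (L⁻¹ * (Real.exp (-γ * corrPotential μ x) * edgeWeight α γ x))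
        ≤ Real.exp ε * Real.exp (ε * logWeight x) *
          (L⁻¹ * (Real.exp (γ * B) * edgeWeight α γ x)) := by gcongr
      _ = _ := by ring

set_option maxHeartbeats 1000000 in
/-- Up to a factor of subexponential size, the Gibbs measure is dominated by the product of the
equilibrium measures. -/
theorem exists_gibbsWeight_le (S : Solution α γ L μ) {ε : ℝ} (hε : 0 < ε) :
    ∃ (M₀ : ℕ) (δ : ℝ), 0 < δ ∧ ∀ M ≥ M₀, ∀ β, 0 < β → |M * β - γ| ≤ δ →
      Integrable (gibbsWeight α β : (Fin M → Space n) → ℝ) ∧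
      0 < ∫ x : Fin M → Space n, gibbsWeight α β x ∧
      ∀ x : Fin M → Space n, gibbsWeight α β x ≤ (∫ x : Fin M → Space n, gibbsWeight α β x) *
        ∏ i, (Real.exp (ε * (1 + logWeight (x i))) * solDensity α γ L μ (x i)) := by
  have := S.isProbabilityMeasure
  obtain ⟨B, hB0, hB⟩ := S.pairProd_le
  obtain ⟨B1, hB10, hB1⟩ := S.exists_abs_logPotential_le
  have hγ := S.gamma_nonneg
  have hL := S.const_pos
  set I := ∫ y, logPotential μ y ∂μ with hI
  -- Three errors must fit into the exponent εM: the regularization (small d), the difference Mβ - γ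
  -- (small δ), and terms bounded in M (large M). Each is given a quarter.
  set r := ε / (4 * (γ + 1) * (B + 1)) with hr
  have hr0 : 0 < r := by positivity
  set d := min 1 (r ^ 2) with hd
  have hd0 : 0 < d := by positivity
  have hd1 : d ≤ 1 := min_le_left _ _
  have hsd : √d ≤ r := by
    rw [← Real.sqrt_sq hr0.le]
    exact Real.sqrt_le_sqrt (min_le_right _ _)
  have hsd' : (γ + 1) * (B * √d) ≤ ε / 4 := by
    have h1 : (γ + 1) * (B * √d) ≤ (γ + 1) * ((B + 1) * r) := by
      gcongr
      linarith
    have h2 : (γ + 1) * ((B + 1) * r) = ε / 4 := by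
      rw [hr]
      field_simp
    linarith
  set δ := min 1 (ε / (4 * (1 + B1 + |I|))) with hδ
  have hI0 := abs_nonneg I
  have hδ0 : 0 < δ := by positivity
  have hδ1 : δ ≤ 1 := min_le_left _ _
  have hδ2 : δ * (1 + B1 + |I|) ≤ ε / 4 := by
    have : δ ≤ ε / (4 * (1 + B1 + |I|)) := min_le_right _ _
    rw [le_div_iff₀ (by positivity)] at this
    linarith
  have hδε : δ ≤ ε / 4 := by
    have : δ * 1 ≤ δ * (1 + B1 + |I|) := by gcongr; linarith
    linarith
  set K := (γ + 1) * (|Real.log d| + |I|) / 2 with hK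
  obtain ⟨M₁, hM₁⟩ := exists_nat_ge (K / (ε / 4))
  refine ⟨max 1 M₁, δ, hδ0, fun M hM β hβ hMβ => ?_⟩
  have hM0 : 0 < M := lt_of_lt_of_le one_pos ((le_max_left _ _).trans hM)
  have hMr : (0 : ℝ) < M := Nat.cast_pos.2 hM0
  have hMK : K ≤ M * (ε / 4) := by
    rw [div_le_iff₀ (by positivity)] at hM₁
    refine hM₁.trans ?_
    gcongr
    exact (le_max_right _ _).trans hM
  have hγ' := abs_le.1 hMβ
  set γ' := M * β with hγ'def
  have hγ'0 : 0 < γ' := by positivity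
  have hγ'1 : γ' ≤ γ + 1 := by linarith [hγ'.2]
  set R := γ' * M * (B * √d) + γ' * M * I / 2 - γ' * Real.log d / 2 with hR
  have hup : ∀ x : Fin M → Space n, gibbsWeight α β x ≤
      L ^ M * Real.exp (R + δ * M * B1 - M * δ) *
      ∏ i, (Real.exp (δ * (1 + logWeight (x i))) * solDensity α γ L μ (x i)) := by
    intro x
    rw [S.gibbsWeight_eq, Finset.prod_mul_distrib, ← Real.exp_sum]
    have h1 : Real.exp (γ * ∑ i, logPotential μ (x i)) * pairProd β x ≤
        Real.exp (R + δ * M * B1 - M * δ) * Real.exp (∑ i, δ * (1 + logWeight (x i))) := by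
      refine (mul_le_mul_of_nonneg_left (hB d hd0 hd1 M hM0 β hβ x) (Real.exp_pos _).le).trans ?_
      rw [← Real.exp_add, ← Real.exp_add]
      refine Real.exp_le_exp.2 ?_
      -- The potentials from the pair bound cancel those in the density of μ up to the small factor
      -- γ - Mβ.
      have h2 : (γ - γ') * (∑ i, logPotential μ (x i)) ≤ ∑ i, δ * (B1 + logWeight (x i)) := by
        rw [Finset.mul_sum]
        refine Finset.sum_le_sum fun i _ => (le_abs_self _).trans ?_
        rw [abs_mul, abs_sub_comm]
        exact mul_le_mul hMβ (hB1 (x i)) (abs_nonneg _) hδ0.le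
      simp only [mul_add, Finset.sum_add_distrib, Finset.sum_const, Finset.card_univ,
        Fintype.card_fin, nsmul_eq_mul] at h2 ⊢
      rw [hR]
      linarith
    have hp : 0 ≤ ∏ i, solDensity α γ L μ (x i) :=
      Finset.prod_nonneg fun i _ => (S.solDensity_pos _).le
    calc (∏ i, solDensity α γ L μ (x i)) *
          (L ^ M * (Real.exp (γ * ∑ i, logPotential μ (x i)) * pairProd β x))
        ≤ (∏ i, solDensity α γ L μ (x i)) * (L ^ M * (Real.exp (R + δ * M * B1 - M * δ) *
          Real.exp (∑ i, δ * (1 + logWeight (x i))))) := by gcongr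
      _ = _ := by ring
  have hint : Integrable (gibbsWeight α β : (Fin M → Space n) → ℝ) := by
    refine Integrable.mono' (Integrable.const_mul (Integrable.fintype_prod fun _ =>
      S.integrable_exp_mul_solDensity δ) (L ^ M * Real.exp (R + δ * M * B1 - M * δ)))
      (measurable_gibbsWeight S.alpha_pos β).aestronglyMeasurable (ae_of_all _ fun x => ?_)
    rw [Real.norm_of_nonneg (gibbsWeight_nonneg _ _ _)]
    exact hup x
  have hlow := S.le_integral_gibbsWeight β hint
  have hz : 0 < ∫ x : Fin M → Space n, gibbsWeight α β x := lt_of_lt_of_le (by positivity) hlow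
  refine ⟨hint, hz, fun x => (hup x).trans ?_⟩
  refine le_trans ?_ (mul_le_mul_of_nonneg_right hlow (Finset.prod_nonneg fun i _ =>
    mul_nonneg (Real.exp_pos _).le (S.solDensity_pos _).le))
  rw [Finset.prod_mul_distrib, Finset.prod_mul_distrib, ← Real.exp_sum, ← Real.exp_sum]
  have hp : 0 ≤ ∏ i, solDensity α γ L μ (x i) :=
    Finset.prod_nonneg fun i _ => (S.solDensity_pos _).le
  have e0 : ∀ a b P : ℝ, L ^ M * Real.exp a * (Real.exp b * P) =
      L ^ M * Real.exp (a + b) * P := fun a b P => by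
    rw [Real.exp_add]
    ring
  rw [e0, e0]
  refine mul_le_mul_of_nonneg_right (mul_le_mul_of_nonneg_left (Real.exp_le_exp.2 ?_)
    (pow_nonneg hL.le M)) hp
  have hT : δ * ∑ i, logWeight (x i) ≤ ε * ∑ i, logWeight (x i) := by
    gcongr
    · exact Finset.sum_nonneg fun i _ => logWeight_nonneg _
    · linarith
  have h1 : γ' * M * (B * √d) ≤ M * (ε / 4) := by
    have : γ' * (B * √d) ≤ (γ + 1) * (B * √d) := by gcongr
    nlinarith
  have h2 : M * (γ' - γ) * I + δ * M * B1 ≤ M * (ε / 4) := by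
    have h3 : (γ' - γ) * I ≤ δ * |I| := by
      refine (le_abs_self _).trans ?_
      rw [abs_mul]
      gcongr
    have h4 : (γ' - γ) * I + δ * B1 ≤ ε / 4 := by linarith
    nlinarith
  have h3 : -(γ' * Real.log d / 2) - γ' * I / 2 ≤ M * (ε / 4) := by
    refine le_trans ?_ hMK
    have h4 : -Real.log d - I ≤ |Real.log d| + |I| := by
      linarith [neg_abs_le (Real.log d), neg_abs_le I]
    have h5 : γ' * (-Real.log d - I) ≤ (γ + 1) * (|Real.log d| + |I|) := by
      refine (mul_le_mul_of_nonneg_left h4 hγ'0.le).trans ?_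
      gcongr
    rw [hK]
    linarith
  have e1 : β / 2 * (M * (M - 1) * I) = γ' * M * I / 2 - γ' * I / 2 := by
    rw [hγ'def]
    ring
  simp only [mul_add, Finset.sum_add_distrib, Finset.sum_const, Finset.card_univ,
    Fintype.card_fin, nsmul_eq_mul, ← Finset.mul_sum]
  rw [e1, hR, ← hI]
  have hMε : 0 < M * ε := by positivity
  clear_value γ' I d δ
  linear_combination hT + h1 + h2 + h3 + (1 / 4) * hMε

end Solution

end LogGas

/-! ### Concentration of the insertion ratio -/

namespace LogGas

variable {n M : ℕ}

/-- The relative weight of the insertion of a particle at `x`, normalized by `(1 + |x|)^{Mβ}`. -/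
noncomputable def insertionRatio (β : ℝ) (x : Space n) (y : Fin M → Space n) : ℝ :=
  (∏ j, ‖x - y j‖ ^ β) * Real.exp (-(M * β) * logWeight x)

theorem insertionRatio_nonneg (β : ℝ) (x : Space n) (y : Fin M → Space n) :
    0 ≤ insertionRatio β x y :=
  mul_nonneg (Finset.prod_nonneg fun _ _ => Real.rpow_nonneg (norm_nonneg _) _) (Real.exp_pos _).le

theorem measurable_insertionRatio (β : ℝ) :
    Measurable fun q : Space n × (Fin M → Space n) => insertionRatio β q.1 q.2 := by
  unfold insertionRatio
  refine Measurable.mul (Finset.measurable_fun_prod _ fun j _ => ?_) ?_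
  · have h : Measurable fun q : Space n × (Fin M → Space n) => q.1 - q.2 j := by fun_prop
    exact h.norm.pow_const _
  · exact ((measurable_logWeight.comp measurable_fst).const_mul _).exp

theorem norm_sub_le_exp_logWeight (x y : Space n) :
    ‖x - y‖ ≤ Real.exp (logWeight x + logWeight y) := by
  rw [Real.exp_add, logWeight, logWeight, Real.exp_log (by positivity),
    Real.exp_log (by positivity)]
  nlinarith [norm_sub_le x y, norm_nonneg x, norm_nonneg y,
    mul_nonneg (norm_nonneg x) (norm_nonneg y)]

/-- A crude bound for every configuration, meant for the exceptional set in the concentration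
estimate. -/
theorem insertionRatio_le {β : ℝ} (hβ : 0 < β) (x : Space n) (y : Fin M → Space n) :
    insertionRatio β x y ≤ Real.exp (β * ∑ j, logWeight (y j)) := by
  have h1 : ∏ j, ‖x - y j‖ ^ β ≤ ∏ j, Real.exp (β * (logWeight x + logWeight (y j))) := by
    refine Finset.prod_le_prod (fun j _ => Real.rpow_nonneg (norm_nonneg _) _) fun j _ => ?_
    refine (Real.rpow_le_rpow (norm_nonneg _) (norm_sub_le_exp_logWeight x (y j)) hβ.le).trans ?_
    rw [← Real.exp_mul, mul_comm]
  refine (mul_le_mul_of_nonneg_right h1 (Real.exp_pos _).le).trans (le_of_eq ?_)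
  rw [← Real.exp_sum, ← Real.exp_add]
  congr 1
  simp only [mul_add, Finset.sum_add_distrib, Finset.sum_const, Finset.card_univ,
    Fintype.card_fin, nsmul_eq_mul, ← Finset.mul_sum]
  ring

/-- Makes the limit visible: the sum has terms that are centred under μ, and Mβ → γ turns the
remaining exponent into -γ(U + ϑ)(x). -/
theorem insertionRatio_of_ne {β : ℝ} {x : Space n} {y : Fin M → Space n} (h : ∀ j, x ≠ y j)
    (μ : Measure (Space n)) :
    insertionRatio β x y = Real.exp (β * (∑ j, (Real.log ‖x - y j‖ + logPotential μ x)) -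
      M * β * corrPotential μ x) := by
  have h1 : ∏ j, ‖x - y j‖ ^ β = ∏ j, Real.exp (β * Real.log ‖x - y j‖) := by
    refine Finset.prod_congr rfl fun j _ => ?_
    rw [Real.rpow_def_of_pos (norm_pos_iff.2 (sub_ne_zero.2 (h j))), mul_comm]
  rw [insertionRatio, h1, ← Real.exp_sum, ← Real.exp_add, corrPotential]
  congr 1
  simp only [mul_add, Finset.sum_add_distrib, Finset.sum_const, Finset.card_univ,
    Fintype.card_fin, nsmul_eq_mul, ← Finset.mul_sum]
  ring

theorem abs_exp_sub_exp_le {a b K : ℝ} (ha : a ≤ K) (hb : b ≤ K) :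
    |Real.exp a - Real.exp b| ≤ Real.exp K * |a - b| := by
  wlog hab : b ≤ a generalizing a b
  · rw [abs_sub_comm, abs_sub_comm a b]
    exact this hb ha (le_of_not_ge hab)
  rw [abs_of_nonneg (sub_nonneg.2 (Real.exp_le_exp.2 hab)), abs_of_nonneg (sub_nonneg.2 hab)]
  have h1 := Real.add_one_le_exp (b - a)
  have h2 : Real.exp b = Real.exp a * Real.exp (b - a) := by
    rw [← Real.exp_add, add_sub_cancel]
  calc Real.exp a - Real.exp b = Real.exp a * (1 - Real.exp (b - a)) := by rw [h2]; ring
    _ ≤ Real.exp a * (a - b) := mul_le_mul_of_nonneg_left (by linarith) (Real.exp_pos _).le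
    _ ≤ Real.exp K * (a - b) :=
      mul_le_mul_of_nonneg_right (Real.exp_le_exp.2 ha) (sub_nonneg.2 hab)

theorem ae_forall_ne [NeZero n] (x : Space n) : ∀ᵐ y : Fin M → Space n, ∀ j, x ≠ y j := by
  refine ae_all_iff.2 fun j => ?_
  exact (Measure.quasiMeasurePreserving_eval (fun _ : Fin M => (volume : Measure (Space n))) j).ae
    (volume_ae_ne x)

/-- Pointwise control of the insertion ratio: it is close to its limit when the empirical mean of
the kernel is close to its expectation, and the exceptional set is covered by exponentials. -/
theorem abs_insertionRatio_sub_le {μ : Measure (Space n)} {β γ δ η t ε B : ℝ} {x : Space n}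
    {y : Fin M → Space n} (hM : 0 < M) (hβ : 0 < β) (hγ : 0 ≤ γ) (hβε : β ≤ ε)
    (hδ : |M * β - γ| ≤ δ) (hδ1 : δ ≤ 1) (ht : 0 < t) (hη0 : 0 ≤ η) (hη1 : η ≤ 1) (hB : 0 ≤ B)
    (hw : |corrPotential μ x| ≤ B) (h : ∀ j, x ≠ y j) :
    |insertionRatio β x y - Real.exp (-γ * corrPotential μ x)| ≤
      Real.exp ((γ + 1) * (B + 1)) * ((γ + 1) * η + δ * B) + (1 + Real.exp (γ * B)) *
        (∏ j, Real.exp (ε * (1 + logWeight (y j)))) *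
        ((∏ j, Real.exp (t * (1 * (Real.log ‖x - y j‖ + logPotential μ x) - η))) +
        ∏ j, Real.exp (t * (-1 * (Real.log ‖x - y j‖ + logPotential μ x) - η))) := by
  have hM' : (0 : ℝ) < M := Nat.cast_pos.2 hM
  have hε : 0 < ε := hβ.trans_le hβε
  have hδ' := abs_le.1 hδ
  have hw' := abs_le.1 hw
  have hδ0 : 0 ≤ δ := (abs_nonneg _).trans hδ
  set w := corrPotential μ x with hwdef
  set A := ∑ j, (Real.log ‖x - y j‖ + logPotential μ x) with hA
  have hprod : ∀ σ : ℝ, ∏ j, Real.exp (t * (σ * (Real.log ‖x - y j‖ + logPotential μ x) - η)) =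
      Real.exp (t * (σ * A - M * η)) := by
    intro σ
    rw [← Real.exp_sum, ← Finset.mul_sum, Finset.sum_sub_distrib, ← Finset.mul_sum]
    simp [hA]
  rw [hprod, hprod]
  have hT : 0 ≤ ∑ j, logWeight (y j) := Finset.sum_nonneg fun j _ => logWeight_nonneg _
  have hp1 : Real.exp (β * ∑ j, logWeight (y j)) ≤ ∏ j, Real.exp (ε * (1 + logWeight (y j))) := by
    rw [← Real.exp_sum, ← Finset.mul_sum]
    refine Real.exp_le_exp.2 ?_
    have : ∑ j, logWeight (y j) ≤ ∑ j, (1 + logWeight (y j)) :=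
      Finset.sum_le_sum fun j _ => by linarith
    exact mul_le_mul hβε this hT hε.le
  have hp2 : 1 ≤ ∏ j, Real.exp (ε * (1 + logWeight (y j))) := by
    refine le_trans ?_ hp1
    exact Real.one_le_exp (mul_nonneg hβ.le hT)
  set P := ∏ j, Real.exp (ε * (1 + logWeight (y j))) with hP
  have hexp : 0 < Real.exp (γ * B) := Real.exp_pos _
  have hγ1 : M * β ≤ γ + 1 := by linarith
  -- If the empirical mean is within η of zero, the two exponents are compared directly. Otherwise
  -- one of the two Chernoff exponentials is at least 1, and the crude bound suffices.
  by_cases hc : |A| ≤ M * η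
  · have hmain : |insertionRatio β x y - Real.exp (-γ * w)| ≤
        Real.exp ((γ + 1) * (B + 1)) * ((γ + 1) * η + δ * B) := by
      rw [insertionRatio_of_ne h μ]
      have hbA : |β * A| ≤ (γ + 1) * η := by
        rw [abs_mul, abs_of_pos hβ]
        calc β * |A| ≤ β * (M * η) := by gcongr
          _ = (M * β) * η := by ring
          _ ≤ (γ + 1) * η := by gcongr
      have hbA' := abs_le.1 hbA
      have hMw : |M * β * w| ≤ (γ + 1) * B := by
        rw [abs_mul, abs_of_pos (by positivity : 0 < M * β)]
        exact mul_le_mul hγ1 hw (abs_nonneg _) (by linarith)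
      have hMw' := abs_le.1 hMw
      have hγw : -γ * w ≤ (γ + 1) * (B + 1) := by nlinarith [hw'.1]
      have hfirst : β * A - M * β * w ≤ (γ + 1) * (B + 1) := by
        have : (γ + 1) * η ≤ (γ + 1) * 1 := by gcongr
        linarith [hbA'.2, hMw'.1]
      refine (abs_exp_sub_exp_le hfirst hγw).trans ?_
      refine mul_le_mul_of_nonneg_left ?_ (Real.exp_pos _).le
      have e : β * A - M * β * w - -γ * w = β * A + -((M * β - γ) * w) := by ring
      rw [e]
      refine (abs_add_le _ _).trans (add_le_add hbA ?_)
      rw [abs_neg, abs_mul]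
      exact mul_le_mul hδ hw (abs_nonneg _) hδ0
    refine hmain.trans (le_add_of_nonneg_right ?_)
    have := Real.exp_pos (t * (1 * A - M * η))
    have := Real.exp_pos (t * (-1 * A - M * η))
    have hP0 : 0 ≤ P := by linarith
    positivity
  · rw [not_le] at hc
    have h1 : 1 ≤ Real.exp (t * (1 * A - M * η)) + Real.exp (t * (-1 * A - M * η)) := by
      rcases abs_cases A with ⟨hA1, _⟩ | ⟨hA1, _⟩
      · have := Real.one_le_exp (x := t * (1 * A - M * η)) (mul_nonneg ht.le (by linarith))
        linarith [Real.exp_pos (t * (-1 * A - M * η))]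
      · have := Real.one_le_exp (x := t * (-1 * A - M * η)) (mul_nonneg ht.le (by linarith))
        linarith [Real.exp_pos (t * (1 * A - M * η))]
    have h2 : |insertionRatio β x y - Real.exp (-γ * w)| ≤ (1 + Real.exp (γ * B)) * P := by
      have h3 := (insertionRatio_le hβ x y).trans hp1
      have h4 := insertionRatio_nonneg β x y
      have h5 : Real.exp (-γ * w) ≤ Real.exp (γ * B) * P := by
        have : Real.exp (-γ * w) ≤ Real.exp (γ * B) :=
          Real.exp_le_exp.2 (by nlinarith [hw'.1])
        nlinarith
      rw [abs_le]
      constructor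
      · linarith
      · linarith [Real.exp_pos (-γ * w), mul_nonneg hexp.le (by linarith : (0 : ℝ) ≤ P)]
    have h6 : 0 ≤ (1 + Real.exp (γ * B)) * P := (abs_nonneg _).trans h2
    have h7 : 0 ≤ Real.exp ((γ + 1) * (B + 1)) * ((γ + 1) * η + δ * B) := by positivity
    nlinarith

namespace Solution

variable [NeZero n] {α γ L : ℝ} {μ : Measure (Space n)}

theorem integral_prod_mul_le (S : Solution α γ L μ) {F : Space n → ℝ} {q : ℝ}
    (hF0 : ∀ y, 0 ≤ F y) (hF : Integrable F μ) (hq : ∫ y, F y ∂μ ≤ q) :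
    Integrable (fun y : Fin M → Space n => (∏ j, solDensity α γ L μ (y j)) * ∏ j, F (y j)) ∧
    ∫ y : Fin M → Space n, (∏ j, solDensity α γ L μ (y j)) * ∏ j, F (y j) ≤ q ^ M := by
  have := S.isProbabilityMeasure
  constructor
  · rw [← S.integrable_pi_iff]
    exact Integrable.fintype_prod fun _ => hF
  · rw [← S.integral_pi, integral_fintype_prod_eq_pow, Fintype.card_fin]
    exact pow_le_pow_left₀ (integral_nonneg hF0) hq M

set_option maxHeartbeats 800000 in
/-- Under the Gibbs measure, the insertion ratio converges in mean, uniformly. -/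
theorem exists_integral_abs_insertionRatio_sub_le (S : Solution α γ L μ) {ε : ℝ} (hε : 0 < ε) :
    ∃ (M₀ : ℕ) (δ : ℝ), 0 < δ ∧ ∀ M ≥ M₀, ∀ β, 0 < β → |M * β - γ| ≤ δ →
      Integrable (gibbsWeight α β : (Fin M → Space n) → ℝ) ∧
      0 < ∫ y : Fin M → Space n, gibbsWeight α β y ∧
      ∀ x : Space n, Integrable (fun y : Fin M → Space n =>
        |insertionRatio β x y - Real.exp (-γ * corrPotential μ x)| * gibbsWeight α β y) ∧
      ∫ y : Fin M → Space n,
        |insertionRatio β x y - Real.exp (-γ * corrPotential μ x)| * gibbsWeight α β y ≤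
        ε * ∫ y : Fin M → Space n, gibbsWeight α β y := by
  have := S.isProbabilityMeasure
  have hγ := S.gamma_nonneg
  obtain ⟨B, hB0, hB⟩ := S.exists_abs_corrPotential_le_const
  set K := Real.exp ((γ + 1) * (B + 1)) with hK
  have hK0 : 0 < K := Real.exp_pos _
  -- On the good event η and δ each use a quarter of ε; the exponential terms take the other half
  -- once q^M is small.
  set η := min 1 (ε / (4 * (K * (γ + 1)))) with hη
  have hη0 : 0 < η := by positivity
  have hη2 : K * ((γ + 1) * η) ≤ ε / 4 := by
    have : η ≤ ε / (4 * (K * (γ + 1))) := min_le_right _ _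
    rw [le_div_iff₀ (by positivity)] at this
    linarith
  obtain ⟨ε₁, t, q, hε₁, ht, hq1, hq0, hch⟩ := S.exists_chernoff hη0
  obtain ⟨M₁, δ₁, hδ₁, hKE⟩ := S.exists_gibbsWeight_le hε₁
  set δ := min δ₁ (min 1 (ε / (4 * (K * (B + 1))))) with hδ
  have hδ0 : 0 < δ := by positivity
  have hδ1 : δ ≤ 1 := (min_le_right _ _).trans (min_le_left _ _)
  have hδ2 : K * (δ * B) ≤ ε / 4 := by
    have : δ ≤ ε / (4 * (K * (B + 1))) := (min_le_right _ _).trans (min_le_right _ _)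
    rw [le_div_iff₀ (by positivity)] at this
    have : K * (δ * B) ≤ K * (δ * (B + 1)) := by gcongr; linarith
    linarith
  set D := 1 + Real.exp (γ * B) with hD
  have hD0 : 0 < D := by positivity
  have hlim : Tendsto (fun M : ℕ => D * (2 * q ^ M)) atTop (𝓝 0) := by
    simpa using ((tendsto_pow_atTop_nhds_zero_of_lt_one hq0 hq1).const_mul 2).const_mul D
  obtain ⟨M₂, hM₂⟩ := eventually_atTop.1 (hlim.eventually (ge_mem_nhds (by positivity :
    0 < ε / 2)))
  obtain ⟨M₃, hM₃⟩ := exists_nat_ge ((γ + 1) / ε₁)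
  refine ⟨max (max 1 M₁) (max M₂ M₃), δ, hδ0, fun M hM β hβ hMβ => ?_⟩
  have hM1 : 0 < M := lt_of_lt_of_le one_pos
    ((le_max_left _ _).trans ((le_max_left _ _).trans hM))
  have hMr : (0 : ℝ) < M := Nat.cast_pos.2 hM1
  obtain ⟨hI, hz, hle⟩ := hKE M ((le_max_right _ _).trans ((le_max_left _ _).trans hM)) β hβ
    (hMβ.trans (min_le_left _ _))
  have hβε : β ≤ ε₁ := by
    have h1 : γ + 1 ≤ M * ε₁ := by
      rw [div_le_iff₀ hε₁] at hM₃
      refine hM₃.trans ?_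
      gcongr
      exact (le_max_right _ _).trans ((le_max_right _ _).trans hM)
    have h2 : M * β ≤ γ + 1 := by linarith [(abs_le.1 hMβ).2]
    exact le_of_mul_le_mul_left (h2.trans h1) hMr
  refine ⟨hI, hz, fun x => ?_⟩
  set z := ∫ y : Fin M → Space n, gibbsWeight α β y with hzdef
  set F : ℝ → Space n → ℝ := fun σ y =>
    Real.exp (t * (σ * (Real.log ‖x - y‖ + logPotential μ x) - η) + 2 * ε₁ * (1 + logWeight y))
    with hF
  have hF1 := S.integral_prod_mul_le (M := M) (F := F 1) (fun y => (Real.exp_pos _).le)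
    (hch 1 (by simp) x).1 (hch 1 (by simp) x).2
  have hF2 := S.integral_prod_mul_le (M := M) (F := F (-1)) (fun y => (Real.exp_pos _).le)
    (hch (-1) (by simp) x).1 (hch (-1) (by simp) x).2
  set G : (Fin M → Space n) → ℝ := fun y => ε / 2 * gibbsWeight α β y + z * D *
    ((∏ j, solDensity α γ L μ (y j)) * (∏ j, F 1 (y j)) +
      (∏ j, solDensity α γ L μ (y j)) * (∏ j, F (-1) (y j))) with hG
  have hGi1 : Integrable (fun y : Fin M → Space n => ε / 2 * gibbsWeight α β y) := hI.const_mul _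
  have hGi2 : Integrable (fun y : Fin M → Space n =>
      (∏ j, solDensity α γ L μ (y j)) * (∏ j, F 1 (y j)) +
      (∏ j, solDensity α γ L μ (y j)) * (∏ j, F (-1) (y j))) := hF1.1.add hF2.1
  have hGi : Integrable G := hGi1.add (hGi2.const_mul _)
  have hb : ∀ᵐ y : Fin M → Space n,
      |insertionRatio β x y - Real.exp (-γ * corrPotential μ x)| * gibbsWeight α β y ≤ G y := by
    filter_upwards [ae_forall_ne x] with y hy
    have h1 := abs_insertionRatio_sub_le hM1 hβ hγ hβε hMβ hδ1 ht hη0.le (min_le_left _ _) hB0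
      (hB x) hy
    have hg0 := gibbsWeight_nonneg α β y
    -- Two factors e^{ε₁(1+ϑ)} per particle are collected, one from the pointwise bound and one from
    -- the domination of the Gibbs weight. This is why the Chernoff bound was proved with 2ε.
    have hpf : ∀ σ : ℝ, (∏ j, Real.exp (ε₁ * (1 + logWeight (y j)))) *
        (∏ j, Real.exp (t * (σ * (Real.log ‖x - y j‖ + logPotential μ x) - η))) *
        ∏ j, (Real.exp (ε₁ * (1 + logWeight (y j))) * solDensity α γ L μ (y j)) =
        (∏ j, solDensity α γ L μ (y j)) * (∏ j, F σ (y j)) := by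
      intro σ
      rw [← Finset.prod_mul_distrib, ← Finset.prod_mul_distrib, ← Finset.prod_mul_distrib]
      refine Finset.prod_congr rfl fun j _ => ?_
      simp only [hF]
      rw [← mul_assoc, ← Real.exp_add, ← Real.exp_add, mul_comm]
      ring_nf
    refine (mul_le_mul_of_nonneg_right h1 hg0).trans ?_
    rw [add_mul]
    refine add_le_add (mul_le_mul_of_nonneg_right ?_ hg0) ?_
    · calc K * ((γ + 1) * η + δ * B) = K * ((γ + 1) * η) + K * (δ * B) := by ring
        _ ≤ ε / 2 := by linarith
    · rw [← hpf 1, ← hpf (-1)]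
      have hP : 0 ≤ ∏ j, Real.exp (ε₁ * (1 + logWeight (y j))) :=
        Finset.prod_nonneg fun _ _ => (Real.exp_pos _).le
      have hQ1 : 0 ≤ ∏ j, Real.exp (t * (1 * (Real.log ‖x - y j‖ + logPotential μ x) - η)) :=
        Finset.prod_nonneg fun _ _ => (Real.exp_pos _).le
      have hQ2 : 0 ≤ ∏ j, Real.exp (t * (-1 * (Real.log ‖x - y j‖ + logPotential μ x) - η)) :=
        Finset.prod_nonneg fun _ _ => (Real.exp_pos _).le
      refine (mul_le_mul_of_nonneg_left (hle y)
        (mul_nonneg (mul_nonneg hD0.le hP) (add_nonneg hQ1 hQ2))).trans (le_of_eq ?_)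
      ring
  have hm : AEStronglyMeasurable (fun y : Fin M → Space n =>
      |insertionRatio β x y - Real.exp (-γ * corrPotential μ x)| * gibbsWeight α β y) := by
    have h1 : Measurable fun y : Fin M → Space n => insertionRatio β x y :=
      (measurable_insertionRatio β).of_uncurry_left
    exact ((h1.sub_const _).norm.mul (measurable_gibbsWeight S.alpha_pos β)).aestronglyMeasurable
  have hint : Integrable (fun y : Fin M → Space n =>
      |insertionRatio β x y - Real.exp (-γ * corrPotential μ x)| * gibbsWeight α β y) := by
    refine Integrable.mono' hGi hm (hb.mono fun y hy => ?_)
    rwa [Real.norm_of_nonneg (mul_nonneg (abs_nonneg _) (gibbsWeight_nonneg _ _ _))]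
  refine ⟨hint, (integral_mono_ae hint hGi hb).trans ?_⟩
  rw [hG, integral_add hGi1 (hGi2.const_mul _), integral_const_mul, integral_const_mul,
    integral_add hF1.1 hF2.1, ← hzdef]
  have h2 := hM₂ M ((le_max_left _ _).trans ((le_max_right _ _).trans hM))
  have h3 : z * D * ((∫ y : Fin M → Space n, (∏ j, solDensity α γ L μ (y j)) * ∏ j, F 1 (y j)) +
      ∫ y : Fin M → Space n, (∏ j, solDensity α γ L μ (y j)) * ∏ j, F (-1) (y j)) ≤
      z * D * (q ^ M + q ^ M) := by
    refine mul_le_mul_of_nonneg_left (add_le_add hF1.2 hF2.2) (mul_nonneg hz.le hD0.le)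
  have h4 := mul_le_mul_of_nonneg_left h2 hz.le
  linarith

end Solution

end LogGas

/-! ### Splitting off a particle, and interpolation in the thinning parameter -/

namespace LogGas

variable {n M : ℕ} {α γ L β ε : ℝ} {μ : Measure (Space n)}

/-- The insertion ratio is `ε`-close in mean to its limit. -/
structure Controlled (α γ : ℝ) (μ : Measure (Space n)) (M : ℕ) (β ε : ℝ) : Prop where
  integrable : Integrable (gibbsWeight α β : (Fin M → Space n) → ℝ)
  pos : 0 < ∫ y : Fin M → Space n, gibbsWeight α β y
  integrable_succ : Integrable (gibbsWeight α β : (Fin (M + 1) → Space n) → ℝ)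
  pos_succ : 0 < ∫ y : Fin (M + 1) → Space n, gibbsWeight α β y
  integrable_sub : ∀ x : Space n, Integrable (fun y : Fin M → Space n =>
    |insertionRatio β x y - Real.exp (-γ * corrPotential μ x)| * gibbsWeight α β y)
  integral_le : ∀ x : Space n, ∫ y : Fin M → Space n,
    |insertionRatio β x y - Real.exp (-γ * corrPotential μ x)| * gibbsWeight α β y ≤
      ε * ∫ y : Fin M → Space n, gibbsWeight α β y

theorem exp_neg_potential_mul_prod (α β : ℝ) (a : Space n) (y : Fin M → Space n) :
    Real.exp (-potential α a) * ∏ j, ‖a - y j‖ ^ β =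
      edgeWeight α (M * β) a * insertionRatio β a y := by
  have h : Real.exp (-potential α a) =
      edgeWeight α (M * β) a * Real.exp (-(M * β) * logWeight a) := by
    rw [edgeWeight, ← Real.exp_add]
    ring_nf
  rw [h, insertionRatio]
  ring

theorem integrable_bdd_mul_gibbsWeight {N : ℕ} (hI : Integrable
    (gibbsWeight α β : (Fin N → Space n) → ℝ)) {φ : (Fin N → Space n) → ℝ} (hφ : Measurable φ)
    {C : ℝ} (hC : ∀ y, |φ y| ≤ C) : Integrable fun y => φ y * gibbsWeight α β y :=
  hI.bdd_mul hφ.aestronglyMeasurable (ae_of_all _ hC)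

namespace Solution

variable [NeZero n]

theorem measurable_exp_corrPotential (S : Solution α γ L μ) :
    Measurable fun x => Real.exp (-γ * corrPotential μ x) :=
  (S.measurable_corrPotential.const_mul _).exp

/-- The lower bound serves to control an integral without the factor exp(-γ(U+ϑ)) by the same
integral with it. -/
theorem exists_exp_corrPotential_le (S : Solution α γ L μ) :
    ∃ B, 1 ≤ B ∧ ∀ x, Real.exp (-γ * corrPotential μ x) ≤ B ∧
      1 ≤ B * Real.exp (-γ * corrPotential μ x) := by
  obtain ⟨B, hB0, hB⟩ := S.exists_abs_corrPotential_le_const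
  have hγ := S.gamma_nonneg
  refine ⟨Real.exp (γ * B), Real.one_le_exp (by positivity), fun x => ⟨?_, ?_⟩⟩
  · refine Real.exp_le_exp.2 ?_
    nlinarith [(abs_le.1 (hB x)).1]
  · rw [← Real.exp_add]
    refine Real.one_le_exp ?_
    nlinarith [(abs_le.1 (hB x)).2]

theorem integrable_insertionRatio_mul (S : Solution α γ L μ) (C : Controlled α γ μ M β ε)
    (x : Space n) : Integrable fun y : Fin M → Space n => insertionRatio β x y *
      gibbsWeight α β y := by
  have hm : Measurable fun y : Fin M → Space n => insertionRatio β x y :=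
    (measurable_insertionRatio β).of_uncurry_left
  refine Integrable.mono' ((C.integrable_sub x).add (C.integrable.const_mul
    (Real.exp (-γ * corrPotential μ x)))) (hm.mul
    (measurable_gibbsWeight S.alpha_pos β)).aestronglyMeasurable (ae_of_all _ fun y => ?_)
  have h0 := gibbsWeight_nonneg α β y
  rw [Real.norm_of_nonneg (mul_nonneg (insertionRatio_nonneg _ _ _) h0), Pi.add_apply, ← add_mul]
  refine mul_le_mul_of_nonneg_right ?_ h0
  linarith [le_abs_self (insertionRatio β x y - Real.exp (-γ * corrPotential μ x))]

theorem abs_integral_insertionRatio_sub_le (S : Solution α γ L μ) (C : Controlled α γ μ M β ε)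
    {φ : (Fin M → Space n) → ℝ} (hφ : Measurable φ) (hφ1 : ∀ y, |φ y| ≤ 1) (x : Space n) :
    |(∫ y : Fin M → Space n, φ y * (insertionRatio β x y * gibbsWeight α β y)) -
      Real.exp (-γ * corrPotential μ x) * ∫ y : Fin M → Space n, φ y * gibbsWeight α β y| ≤
      ε * ∫ y : Fin M → Space n, gibbsWeight α β y := by
  have h1 : Integrable fun y : Fin M → Space n =>
      φ y * (insertionRatio β x y * gibbsWeight α β y) :=
    (S.integrable_insertionRatio_mul C x).bdd_mul hφ.aestronglyMeasurable (ae_of_all _ hφ1)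
  have h2 := integrable_bdd_mul_gibbsWeight C.integrable hφ hφ1
  rw [← integral_const_mul, ← integral_sub h1 (h2.const_mul _), ← Real.norm_eq_abs]
  refine (norm_integral_le_of_norm_le (C.integrable_sub x) (ae_of_all _ fun y => ?_)).trans
    (C.integral_le x)
  have h0 := gibbsWeight_nonneg α β y
  have e : φ y * (insertionRatio β x y * gibbsWeight α β y) -
      Real.exp (-γ * corrPotential μ x) * (φ y * gibbsWeight α β y) =
      φ y * ((insertionRatio β x y - Real.exp (-γ * corrPotential μ x)) * gibbsWeight α β y) := by
    ring
  rw [e, Real.norm_eq_abs, abs_mul, abs_mul, abs_of_nonneg h0]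
  exact mul_le_of_le_one_left (mul_nonneg (abs_nonneg _) h0) (hφ1 y)

/-- Splitting off one particle. -/
theorem abs_integral_insertion_sub_le (S : Solution α γ L μ) (C : Controlled α γ μ M β ε)
    {ρ : Space n → ℝ} (hρ : Measurable ρ) (hρ0 : ∀ a, 0 ≤ ρ a) (hρ1 : ∀ a, ρ a ≤ 1)
    {φ : (Fin M → Space n) → ℝ} (hφ : Measurable φ) (hφ1 : ∀ y, |φ y| ≤ 1) (k : Fin (M + 1)) :
    |(∫ x : Fin (M + 1) → Space n, ρ (x k) * φ (fun j => x (k.succAbove j)) *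
        gibbsWeight α β x) -
      (∫ a, ρ a * edgeWeight α (M * β) a * Real.exp (-γ * corrPotential μ a)) *
        ∫ y : Fin M → Space n, φ y * gibbsWeight α β y| ≤
      ε * (∫ y : Fin M → Space n, gibbsWeight α β y) * ∫ a, ρ a * edgeWeight α (M * β) a := by
  set z := ∫ y : Fin M → Space n, gibbsWeight α β y with hz
  set c := ∫ y : Fin M → Space n, φ y * gibbsWeight α β y with hc
  set H : (Fin (M + 1) → Space n) → ℝ := fun x =>
    ρ (x k) * φ (fun j => x (k.succAbove j)) * gibbsWeight α β x with hH
  have hHi : Integrable H := by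
    refine integrable_bdd_mul_gibbsWeight (C := 1) C.integrable_succ ?_ fun x => ?_
    · refine (hρ.comp (measurable_pi_apply k)).mul (hφ.comp ?_)
      exact measurable_pi_iff.2 fun j => measurable_pi_apply _
    · rw [abs_mul, abs_of_nonneg (hρ0 _)]
      exact mul_le_one₀ (hρ1 _) (abs_nonneg _) (hφ1 _)
  have he := (volume_preserving_piFinSuccAbove (fun _ : Fin (M + 1) => Space n) k).symm
  have hHe : ∀ (a : Space n) (y : Fin M → Space n),
      H ((MeasurableEquiv.piFinSuccAbove (fun _ : Fin (M + 1) => Space n) k).symm (a, y)) =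
      ρ a * edgeWeight α (M * β) a * (φ y * (insertionRatio β a y * gibbsWeight α β y)) := by
    intro a y
    have e1 : (MeasurableEquiv.piFinSuccAbove (fun _ : Fin (M + 1) => Space n) k).symm (a, y) =
      k.insertNth (α := fun _ => Space n) a y := rfl
    rw [e1, hH]
    simp only [Fin.insertNth_apply_same, Fin.insertNth_apply_succAbove]
    rw [gibbsWeight_insertNth, exp_neg_potential_mul_prod]
    ring
  have hprod : Integrable (fun p : Space n × (Fin M → Space n) =>
      H ((MeasurableEquiv.piFinSuccAbove (fun _ : Fin (M + 1) => Space n) k).symm p))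
      (volume.prod volume) :=
    (he.integrable_comp_emb (MeasurableEquiv.measurableEmbedding _)).2 hHi
  have hInt : ∫ x, H x = ∫ a, ρ a * edgeWeight α (M * β) a *
      ∫ y : Fin M → Space n, φ y * (insertionRatio β a y * gibbsWeight α β y) := by
    rw [← he.integral_comp' H]
    refine (integral_prod _ hprod).trans ?_
    refine integral_congr_ae (ae_of_all _ fun a => ?_)
    simp only [hHe]
    rw [integral_const_mul]
  have hA : Integrable fun a => ρ a * edgeWeight α (M * β) a *
      ∫ y : Fin M → Space n, φ y * (insertionRatio β a y * gibbsWeight α β y) := by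
    refine hprod.integral_prod_left.congr (ae_of_all _ fun a => ?_)
    simp only [hHe]
    rw [integral_const_mul]
  have hei := edgeWeight_integrable (n := n) S.alpha_pos (M * β)
  have hρe : Integrable fun a => ρ a * edgeWeight α (M * β) a :=
    hei.bdd_mul hρ.aestronglyMeasurable (ae_of_all _ fun a => by
      rw [Real.norm_of_nonneg (hρ0 a)]
      exact hρ1 a)
  obtain ⟨B, hB1, hB⟩ := S.exists_exp_corrPotential_le
  have hB2 : Integrable fun a =>
      ρ a * edgeWeight α (M * β) a * Real.exp (-γ * corrPotential μ a) :=
    hρe.mul_bdd S.measurable_exp_corrPotential.aestronglyMeasurable (ae_of_all _ fun a => by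
      rw [Real.norm_of_nonneg (Real.exp_pos _).le]
      exact (hB a).1)
  rw [hInt, ← integral_mul_const, ← integral_sub hA (hB2.mul_const _), ← Real.norm_eq_abs,
    ← integral_const_mul]
  -- The error ε is uniform in a, so it is integrated against ρ and remains proportional to its
  -- mass. That proportionality survives the later sum over all particles.
  refine norm_integral_le_of_norm_le (hρe.const_mul _) (ae_of_all _ fun a => ?_)
  have h1 := S.abs_integral_insertionRatio_sub_le C hφ hφ1 a
  have h2 : 0 ≤ ρ a * edgeWeight α (M * β) a := mul_nonneg (hρ0 a) (edgeWeight_pos _ _ _).le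
  rw [mul_assoc (ρ a * edgeWeight α (M * β) a) (Real.exp _), ← mul_sub, Real.norm_eq_abs, abs_mul,
    abs_of_nonneg h2, mul_comm]
  exact mul_le_mul_of_nonneg_right h1 h2

end Solution

/-! ### Thinned products -/

/-- The product `∏_j (1 - t χ(x_j))`. -/
noncomputable def thin {N : ℕ} (χ : Space n → ℝ) (t : ℝ) (x : Fin N → Space n) : ℝ :=
  ∏ j, (1 - t * χ (x j))

variable {χ : Space n → ℝ}

theorem measurable_thin {N : ℕ} (hχ : Measurable χ) (t : ℝ) :
    Measurable (thin χ t : (Fin N → Space n) → ℝ) :=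
  Finset.measurable_fun_prod _ fun j _ =>
    ((hχ.comp (measurable_pi_apply j)).const_mul t).const_sub 1

theorem thin_zero {N : ℕ} (x : Fin N → Space n) : thin χ 0 x = 1 := by simp [thin]

theorem abs_thin_le_one {N : ℕ} (h0 : ∀ a, 0 ≤ χ a) (h1 : ∀ a, χ a ≤ 1) {t : ℝ} (ht0 : 0 ≤ t)
    (ht1 : t ≤ 1) (x : Fin N → Space n) : |thin χ t x| ≤ 1 := by
  have h : ∀ j, 0 ≤ 1 - t * χ (x j) ∧ 1 - t * χ (x j) ≤ 1 := fun j => by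
    have := mul_le_one₀ ht1 (h0 (x j)) (h1 (x j))
    have := mul_nonneg ht0 (h0 (x j))
    constructor <;> linarith
  rw [thin, Finset.abs_prod]
  refine Finset.prod_le_one (fun j _ => abs_nonneg _) fun j _ => ?_
  rw [abs_of_nonneg (h j).1]
  exact (h j).2

/-- Differentiation at the ends of [0, 1] needs a larger interval, on which factors may exceed 1 in
absolute value. The bound only provides domination at fixed N. -/
theorem abs_thin_le {N : ℕ} (h0 : ∀ a, 0 ≤ χ a) (h1 : ∀ a, χ a ≤ 1) {t : ℝ} (ht : |t| ≤ 2)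
    (x : Fin N → Space n) : |thin χ t x| ≤ 3 ^ N := by
  rw [thin, Finset.abs_prod]
  refine (Finset.prod_le_prod (fun j _ => abs_nonneg _) (fun j _ => ?_)).trans_eq
    (b := ∏ _j : Fin N, (3 : ℝ)) (by simp)
  have h2 : |t * χ (x j)| ≤ 2 := by
    rw [abs_mul, abs_of_nonneg (h0 _)]
    exact (mul_le_mul ht (h1 _) (h0 _) (by norm_num)).trans (by norm_num)
  have := abs_le.1 h2
  rw [abs_le]
  constructor <;> linarith

theorem thin_succAbove {N : ℕ} (k : Fin (N + 1)) (t : ℝ) (x : Fin (N + 1) → Space n) :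
    thin χ t x = (1 - t * χ (x k)) * thin χ t fun j => x (k.succAbove j) := by
  rw [thin, Fin.prod_univ_succAbove _ k, thin]

theorem hasDerivAt_thin {N : ℕ} (x : Fin (N + 1) → Space n) (t : ℝ) :
    HasDerivAt (fun s => thin χ s x)
      (-∑ k, χ (x k) * thin χ t fun j => x (k.succAbove j)) t := by
  have h := HasDerivAt.fun_finsetProd (u := Finset.univ) (f := fun (j : Fin (N + 1)) s =>
    1 - s * χ (x j)) (f' := fun j => -χ (x j)) (x := t) fun j _ => by
      simpa using ((hasDerivAt_id t).mul_const (χ (x j))).const_sub 1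
  refine h.congr_deriv ?_
  rw [← Finset.sum_neg_distrib]
  refine Finset.sum_congr rfl fun k _ => ?_
  have hk : Finset.univ.erase k = Finset.univ.image k.succAbove := by
    rw [Fin.image_succAbove_univ]
    ext j
    simp
  rw [hk, Finset.prod_image fun a _ b _ hab => Fin.succAbove_right_injective hab, smul_eq_mul, thin]
  ring

theorem hasDerivAt_integral_thin {N : ℕ} (hα : 0 < α) (hI : Integrable
    (gibbsWeight α β : (Fin (N + 1) → Space n) → ℝ)) (hχ : Measurable χ) (h0 : ∀ a, 0 ≤ χ a)
    (h1 : ∀ a, χ a ≤ 1) {t : ℝ} (ht : |t| < 2) :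
    HasDerivAt (fun s => ∫ x : Fin (N + 1) → Space n, thin χ s x * gibbsWeight α β x)
      (-∑ k, ∫ x : Fin (N + 1) → Space n, χ (x k) * thin χ t (fun j => x (k.succAbove j)) *
        gibbsWeight α β x) t := by
  have hm : ∀ (s : ℝ) (k : Fin (N + 1)), Measurable fun x : Fin (N + 1) → Space n =>
      χ (x k) * thin χ s (fun j => x (k.succAbove j)) := fun s k =>
    (hχ.comp (measurable_pi_apply k)).mul ((measurable_thin hχ s).comp
      (measurable_pi_iff.2 fun j => measurable_pi_apply _))
  have hb : ∀ s : ℝ, |s| ≤ 2 → ∀ (k : Fin (N + 1)) (x : Fin (N + 1) → Space n),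
      |χ (x k) * thin χ s (fun j => x (k.succAbove j))| ≤ 3 ^ N := fun s hs k x => by
    rw [abs_mul, abs_of_nonneg (h0 _)]
    refine (mul_le_mul (h1 _) (abs_thin_le h0 h1 hs _) (abs_nonneg _) zero_le_one).trans_eq
      (one_mul _)
  have hs : Metric.ball (0 : ℝ) 2 ∈ 𝓝 t := Metric.isOpen_ball.mem_nhds (by simpa using ht)
  have h := (hasDerivAt_integral_of_dominated_loc_of_deriv_le (μ := volume) (x₀ := t)
    (F := fun s (x : Fin (N + 1) → Space n) => thin χ s x * gibbsWeight α β x)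
    (F' := fun s x => (-∑ k, χ (x k) * thin χ s fun j => x (k.succAbove j)) * gibbsWeight α β x)
    (bound := fun x => (N + 1) * 3 ^ N * gibbsWeight α β x) hs
    (Eventually.of_forall fun s => ((measurable_thin hχ s).mul
      (measurable_gibbsWeight hα β)).aestronglyMeasurable)
    (integrable_bdd_mul_gibbsWeight hI (measurable_thin hχ t) (abs_thin_le h0 h1 ht.le))
    (((Finset.measurable_fun_sum _ fun k _ => hm t k).neg.mul
      (measurable_gibbsWeight hα β)).aestronglyMeasurable) ?_ (hI.const_mul _) ?_).2
  · refine h.congr_deriv ?_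
    simp only [neg_mul, Finset.sum_mul]
    rw [integral_neg, integral_finsetSum _ fun k _ =>
      integrable_bdd_mul_gibbsWeight hI (hm t k) (hb t ht.le k)]
  · refine ae_of_all _ fun x s hs => ?_
    have hs' : |s| ≤ 2 := by
      have : |s| < 2 := by simpa using hs
      exact this.le
    rw [Real.norm_eq_abs, abs_mul, abs_neg, abs_of_nonneg (gibbsWeight_nonneg _ _ _)]
    refine mul_le_mul_of_nonneg_right ?_ (gibbsWeight_nonneg _ _ _)
    refine (Finset.abs_sum_le_sum_abs _ _).trans
      ((Finset.sum_le_sum fun k _ => hb s hs' k x).trans_eq ?_)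
    simp
  · exact ae_of_all _ fun x s _ => (hasDerivAt_thin x s).mul_const _

/-- The linear differential inequality `|G' + λ G| ≤ τ`. -/
theorem abs_sub_exp_le_of_hasDerivAt {G G' : ℝ → ℝ} {l τ : ℝ} (hl : 0 ≤ l) (h0 : G 0 = 1)
    (hG : ∀ t ∈ Set.Icc (0 : ℝ) 1, HasDerivAt G (G' t) t)
    (hb : ∀ t ∈ Set.Icc (0 : ℝ) 1, |G' t + l * G t| ≤ τ) : |G 1 - Real.exp (-l)| ≤ τ := by
  -- Integrating factor: the derivative of e^{lt}G is at most e^l τ in absolute value, and e^l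
  -- disappears on multiplying back by e^{-l}.
  have hd : ∀ t ∈ Set.Icc (0 : ℝ) 1, HasDerivWithinAt (fun s => Real.exp (l * s) * G s)
      (Real.exp (l * t) * (G' t + l * G t)) (Set.Icc 0 1) t := by
    intro t ht
    have h1 : HasDerivAt (fun s => Real.exp (l * s)) (Real.exp (l * t) * l) t := by
      simpa using ((hasDerivAt_id t).const_mul l).exp
    refine ((h1.mul (hG t ht)).congr_deriv ?_).hasDerivWithinAt
    ring
  have hτ : 0 ≤ τ := (abs_nonneg _).trans (hb 0 (by simp))
  have h := norm_image_sub_le_of_norm_deriv_le_segment_01' (C := Real.exp l * τ) hd fun t ht => by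
    rw [Real.norm_eq_abs, abs_mul, abs_of_pos (Real.exp_pos _)]
    refine mul_le_mul (Real.exp_le_exp.2 ?_) (hb t ⟨ht.1, ht.2.le⟩) (abs_nonneg _)
      (Real.exp_pos _).le
    exact mul_le_of_le_one_right hl ht.2.le
  simp only [mul_one, mul_zero, Real.exp_zero, h0, Real.norm_eq_abs] at h
  have e : G 1 - Real.exp (-l) = Real.exp (-l) * (Real.exp l * G 1 - 1) := by
    rw [mul_sub, ← mul_assoc, ← Real.exp_add, neg_add_cancel, Real.exp_zero]
    ring
  rw [e, abs_mul, abs_of_pos (Real.exp_pos _)]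
  calc Real.exp (-l) * |Real.exp l * G 1 - 1| ≤ Real.exp (-l) * (Real.exp l * τ) := by gcongr
    _ = τ := by rw [← mul_assoc, ← Real.exp_add, neg_add_cancel, Real.exp_zero, one_mul]

end LogGas

/-! ### Poisson approximation of the thinned partition function -/

namespace LogGas

namespace Solution

variable {n M : ℕ} [NeZero n] {α γ L β ε : ℝ} {μ : Measure (Space n)} {χ : Space n → ℝ}

theorem integrable_mul_edgeWeight (S : Solution α γ L μ) {ρ : Space n → ℝ} (hρ : Measurable ρ)
    (hρ0 : ∀ a, 0 ≤ ρ a) (hρ1 : ∀ a, ρ a ≤ 1) (A : ℝ) :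
    Integrable (fun a => ρ a * edgeWeight α A a) ∧
    Integrable (fun a => ρ a * edgeWeight α A a * Real.exp (-γ * corrPotential μ a)) := by
  have hρe : Integrable fun a => ρ a * edgeWeight α A a :=
    (edgeWeight_integrable S.alpha_pos A).bdd_mul hρ.aestronglyMeasurable
      (ae_of_all _ fun a => by
        rw [Real.norm_of_nonneg (hρ0 a)]
        exact hρ1 a)
  obtain ⟨B, -, hB⟩ := S.exists_exp_corrPotential_le
  exact ⟨hρe, hρe.mul_bdd S.measurable_exp_corrPotential.aestronglyMeasurable
    (ae_of_all _ fun a => by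
      rw [Real.norm_of_nonneg (Real.exp_pos _).le]
      exact (hB a).1)⟩

/-- Quantitative comparison of the partition functions. -/
theorem abs_partition_sub_le (S : Solution α γ L μ) (C : Controlled α γ μ M β ε) :
    |(∫ x : Fin (M + 1) → Space n, gibbsWeight α β x) -
      (∫ a : Space n, edgeWeight α (M * β) a * Real.exp (-γ * corrPotential μ a)) *
        ∫ y : Fin M → Space n, gibbsWeight α β y| ≤
      ε * (∫ y : Fin M → Space n, gibbsWeight α β y) *
        ∫ a : Space n, edgeWeight α (M * β) a := by
  have h := S.abs_integral_insertion_sub_le C (ρ := fun _ => 1) measurable_const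
    (fun _ => zero_le_one) (fun _ => le_rfl) (φ := fun _ => 1) measurable_const (by simp) 0
  simpa using h

/-- Quantitative Poisson approximation of the thinned partition function. -/
theorem abs_thin_sub_exp_le (S : Solution α γ L μ) (C : Controlled α γ μ M β ε)
    (hε : 0 ≤ ε) (hχ : Measurable χ) (h0 : ∀ a, 0 ≤ χ a) (h1 : ∀ a, χ a ≤ 1) {l : ℝ} (hl : 0 ≤ l) :
    |(∫ x : Fin (M + 1) → Space n, thin χ 1 x * gibbsWeight α β x) /
        (∫ x : Fin (M + 1) → Space n, gibbsWeight α β x) - Real.exp (-l)| ≤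
      ((M + 1) * ε * (∫ a, χ a * edgeWeight α (M * β) a) +
        |(M + 1) * (∫ a, χ a * edgeWeight α (M * β) a * Real.exp (-γ * corrPotential μ a)) -
          l * ∫ a : Space n, edgeWeight α (M * β) a * Real.exp (-γ * corrPotential μ a)| +
        l * (ε * (∫ a : Space n, edgeWeight α (M * β) a) +
          ∫ a, χ a * edgeWeight α (M * β) a * Real.exp (-γ * corrPotential μ a))) *
      ((∫ y : Fin M → Space n, gibbsWeight α β y) /
        ∫ x : Fin (M + 1) → Space n, gibbsWeight α β x) := by
  set z := ∫ y : Fin M → Space n, gibbsWeight α β y with hz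
  set z' := ∫ y : Fin (M + 1) → Space n, gibbsWeight α β y with hz'
  set κ := ∫ a, χ a * edgeWeight α (M * β) a with hκ
  set Λ := ∫ a, χ a * edgeWeight α (M * β) a * Real.exp (-γ * corrPotential μ a) with hΛ
  set E := ∫ a : Space n, edgeWeight α (M * β) a with hE
  set c := ∫ a : Space n, edgeWeight α (M * β) a * Real.exp (-γ * corrPotential μ a) with hc
  have hzp : 0 < z := C.pos
  have hzp' : 0 < z' := C.pos_succ
  have hχi := S.integrable_mul_edgeWeight hχ h0 h1 (M * β)
  have h1i := S.integrable_mul_edgeWeight (ρ := fun _ => 1) measurable_const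
    (fun _ => zero_le_one) (fun _ => le_rfl) (M * β)
  simp only [one_mul] at h1i
  have hΛ0 : 0 ≤ Λ := integral_nonneg fun a =>
    mul_nonneg (mul_nonneg (h0 a) (edgeWeight_pos _ _ _).le) (Real.exp_pos _).le
  have hκ0 : 0 ≤ κ := integral_nonneg fun a => mul_nonneg (h0 a) (edgeWeight_pos _ _ _).le
  refine abs_sub_exp_le_of_hasDerivAt (G := fun t =>
    (∫ x : Fin (M + 1) → Space n, thin χ t x * gibbsWeight α β x) / z')
    (G' := fun t => (-∑ k : Fin (M + 1), ∫ x : Fin (M + 1) → Space n,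
      χ (x k) * thin χ t (fun j => x (k.succAbove j)) * gibbsWeight α β x) / z') hl ?_
    (fun t ht => (hasDerivAt_integral_thin S.alpha_pos C.integrable_succ hχ h0 h1 (by
      rw [abs_of_nonneg ht.1]
      linarith [ht.2])).div_const z') fun t ht => ?_
  · simp only [thin_zero, one_mul]
    exact div_self hzp'.ne'
  -- Both the derivative and the thinned integral reduce to this M-particle quantity: J is close to
  -- (M+1)Λg and A to (c - tΛ)g. Eliminating g leaves the differential inequality, with l compared
  -- to (M+1)Λ/c.
  set g := ∫ y : Fin M → Space n, thin χ t y * gibbsWeight α β y with hg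
  set A := ∫ x : Fin (M + 1) → Space n, thin χ t x * gibbsWeight α β x with hA
  have hgz : |g| ≤ z := by
    rw [← Real.norm_eq_abs]
    refine norm_integral_le_of_norm_le C.integrable (ae_of_all _ fun y => ?_)
    rw [Real.norm_eq_abs, abs_mul, abs_of_nonneg (gibbsWeight_nonneg _ _ _)]
    exact mul_le_of_le_one_left (gibbsWeight_nonneg _ _ _) (abs_thin_le_one h0 h1 ht.1 ht.2 y)
  have hJ : ∀ k : Fin (M + 1), |(∫ x : Fin (M + 1) → Space n,
      χ (x k) * thin χ t (fun j => x (k.succAbove j)) * gibbsWeight α β x) - Λ * g| ≤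
      ε * z * κ := fun k =>
    S.abs_integral_insertion_sub_le C hχ h0 h1 (measurable_thin hχ t)
      (abs_thin_le_one h0 h1 ht.1 ht.2) k
  set J := ∑ k : Fin (M + 1), ∫ x : Fin (M + 1) → Space n,
      χ (x k) * thin χ t (fun j => x (k.succAbove j)) * gibbsWeight α β x with hJdef
  have hJs : |J - (M + 1) * (Λ * g)| ≤ (M + 1) * (ε * z * κ) := by
    have e : J - (M + 1) * (Λ * g) = ∑ k : Fin (M + 1), ((∫ x : Fin (M + 1) → Space n,
        χ (x k) * thin χ t (fun j => x (k.succAbove j)) * gibbsWeight α β x) - Λ * g) := by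
      rw [Finset.sum_sub_distrib]
      simp [hJdef]
    rw [e]
    refine (Finset.abs_sum_le_sum_abs _ _).trans
      ((Finset.sum_le_sum fun k _ => hJ k).trans_eq ?_)
    simp
  have hρ : ∀ a, 0 ≤ 1 - t * χ a ∧ 1 - t * χ a ≤ 1 := fun a => by
    have := mul_le_one₀ ht.2 (h0 a) (h1 a)
    have := mul_nonneg ht.1 (h0 a)
    constructor <;> linarith
  have hAs : |A - (c - t * Λ) * g| ≤ ε * z * E := by
    have h := S.abs_integral_insertion_sub_le C (ρ := fun a => 1 - t * χ a)
      ((hχ.const_mul t).const_sub 1) (fun a => (hρ a).1) (fun a => (hρ a).2)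
      (measurable_thin hχ t) (abs_thin_le_one h0 h1 ht.1 ht.2) 0
    have e1 : ∫ a, (1 - t * χ a) * edgeWeight α (M * β) a * Real.exp (-γ * corrPotential μ a) =
        c - t * Λ := by
      rw [hc, hΛ, ← integral_const_mul, ← integral_sub h1i.2 (hχi.2.const_mul t)]
      refine integral_congr_ae (ae_of_all _ fun a => ?_)
      ring
    have e2 : ∫ a, (1 - t * χ a) * edgeWeight α (M * β) a ≤ E := by
      refine integral_mono (S.integrable_mul_edgeWeight ((hχ.const_mul t).const_sub 1)
        (fun a => (hρ a).1) (fun a => (hρ a).2) (M * β)).1 h1i.1 fun a => ?_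
      exact mul_le_of_le_one_left (edgeWeight_pos _ _ _).le (hρ a).2
    rw [e1] at h
    simp only [← thin_succAbove] at h
    exact h.trans (mul_le_mul_of_nonneg_left e2 (mul_nonneg hε hzp.le))
  have hAs2 : |A - c * g| ≤ ε * z * E + Λ * z := by
    have e : A - c * g = (A - (c - t * Λ) * g) + -(t * Λ * g) := by ring
    rw [e]
    refine (abs_add_le _ _).trans (add_le_add hAs ?_)
    rw [abs_neg, abs_mul, abs_of_nonneg (mul_nonneg ht.1 hΛ0)]
    exact mul_le_mul (mul_le_of_le_one_left hΛ0 ht.2) hgz (abs_nonneg _) hΛ0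
  have hfin : |-J + l * A| ≤ ((M + 1) * ε * κ + |(M + 1) * Λ - l * c| + l * (ε * E + Λ)) * z := by
    have e : -J + l * A = -(J - (M + 1) * (Λ * g)) + (-(((M + 1) * Λ - l * c) * g) +
      l * (A - c * g)) := by ring
    rw [e]
    refine (abs_add_le _ _).trans ((add_le_add ((abs_neg _).trans_le hJs)
      ((abs_add_le _ _).trans (add_le_add (?_ : _ ≤ |(M + 1) * Λ - l * c| * z)
        (?_ : _ ≤ l * (ε * z * E + Λ * z))))).trans_eq ?_)
    · rw [abs_neg, abs_mul]
      exact mul_le_mul_of_nonneg_left hgz (abs_nonneg _)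
    · rw [abs_mul, abs_of_nonneg hl]
      exact mul_le_mul_of_nonneg_left hAs2 hl
    · ring
  have e : -J / z' + l * (A / z') = (-J + l * A) / z' := by ring
  rw [e, abs_div, abs_of_pos hzp', ← mul_div_assoc]
  exact div_le_div_of_nonneg_right hfin hzp'.le

variable {b : ℕ → ℝ}

theorem eventually_controlled (S : Solution α γ L μ) (hb : ∀ N, 0 < b N)
    (hlim : Tendsto (fun N : ℕ => N * b N) atTop (𝓝 γ)) (hlim' : Tendsto b atTop (𝓝 0))
    (hε : 0 < ε) : ∀ᶠ M in atTop, Controlled α γ μ M (b M) ε := by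
  obtain ⟨M₀, δ, hδ, h⟩ := S.exists_integral_abs_insertionRatio_sub_le hε
  have h1 : ∀ᶠ M : ℕ in atTop, |M * b M - γ| ≤ δ := by
    have := (hlim.sub_const γ).abs
    rw [sub_self, abs_zero] at this
    exact this.eventually (ge_mem_nhds hδ)
  -- The same inverse temperature serves M and M + 1 particles; b → 0 makes the shift harmless.
  have h2 : ∀ᶠ M : ℕ in atTop, |((M + 1 : ℕ) : ℝ) * b M - γ| ≤ δ := by
    have := ((hlim.add hlim').sub_const γ).abs
    rw [add_zero, sub_self, abs_zero] at this
    refine (this.eventually (ge_mem_nhds hδ)).mono fun M hM => ?_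
    push_cast
    rwa [add_mul, one_mul]
  filter_upwards [h1, h2, eventually_ge_atTop M₀] with M hM1 hM2 hM
  obtain ⟨a1, a2, a3⟩ := h M hM (b M) (hb M) hM1
  obtain ⟨b1, b2, -⟩ := h (M + 1) (hM.trans (Nat.le_succ M)) (b M) (hb M) hM2
  exact ⟨a1, a2, b1, b2, fun x => (a3 x).1, fun x => (a3 x).2⟩

/-- The normalization of μ identifies the limit as L. By `abs_partition_sub_le` this integral
approximates the ratio of consecutive partition functions. -/
theorem tendsto_integral_edgeWeight (S : Solution α γ L μ)
    (hlim : Tendsto (fun N : ℕ => N * b N) atTop (𝓝 γ)) :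
    Tendsto (fun M : ℕ => ∫ a : Space n, edgeWeight α (M * b M) a *
      Real.exp (-γ * corrPotential μ a)) atTop (𝓝 L) := by
  obtain ⟨B, hB1, hB⟩ := S.exists_exp_corrPotential_le
  have hL : L = ∫ a : Space n, edgeWeight α γ a * Real.exp (-γ * corrPotential μ a) := by
    rw [← S.integral_exp_corrPotential.2]
    simp_rw [mul_comm]
  rw [hL]
  have h1 : ∀ᶠ M : ℕ in atTop, M * b M ≤ γ + 1 := hlim.eventually (ge_mem_nhds (by linarith))
  refine tendsto_integral_filter_of_dominated_convergence
    (fun a => edgeWeight α (γ + 1) a * B) ?_ ?_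
    ((edgeWeight_integrable S.alpha_pos _).mul_const B) ?_
  · exact Eventually.of_forall fun M => ((continuous_edgeWeight S.alpha_pos _).measurable.mul
      S.measurable_exp_corrPotential).aestronglyMeasurable
  · filter_upwards [h1] with M hM
    refine ae_of_all _ fun a => ?_
    rw [Real.norm_of_nonneg (mul_nonneg (edgeWeight_pos _ _ _).le (Real.exp_pos _).le)]
    exact mul_le_mul (edgeWeight_mono α hM a) (hB a).1 (Real.exp_pos _).le
      (edgeWeight_pos _ _ _).le
  · refine ae_of_all _ fun a => Tendsto.mul_const _ ?_
    exact (Real.continuous_exp.tendsto _).comp ((hlim.mul_const _).sub_const _)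

/-- In the bound of `abs_thin_sub_exp_le`, everything not proportional to ε vanishes as M grows, and
the coefficient of ε stays bounded. So ε is fixed first, from the target accuracy, and M is taken
large afterwards. The factor L in the hypothesis cancels against the partition ratio. -/
theorem tendsto_thin (S : Solution α γ L μ) (hb : ∀ N, 0 < b N)
    (hlim : Tendsto (fun N : ℕ => N * b N) atTop (𝓝 γ)) (hlim' : Tendsto b atTop (𝓝 0))
    {χ : ℕ → Space n → ℝ} (hχ : ∀ M, Measurable (χ M)) (h0 : ∀ M a, 0 ≤ χ M a)
    (h1 : ∀ M a, χ M a ≤ 1) {l : ℝ} (hl : 0 ≤ l)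
    (hχl : Tendsto (fun M : ℕ => (M + 1) * ∫ a, χ M a * edgeWeight α (M * b M) a *
      Real.exp (-γ * corrPotential μ a)) atTop (𝓝 (L * l))) :
    Tendsto (fun M : ℕ =>
      (∫ x : Fin (M + 1) → Space n, thin (χ M) 1 x * gibbsWeight α (b M) x) /
        ∫ x : Fin (M + 1) → Space n, gibbsWeight α (b M) x) atTop (𝓝 (Real.exp (-l))) := by
  obtain ⟨B, hB1, hB⟩ := S.exists_exp_corrPotential_le
  have hL := S.const_pos
  have hc := S.tendsto_integral_edgeWeight hlim
  set c : ℕ → ℝ := fun M => ∫ a : Space n, edgeWeight α (M * b M) a *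
    Real.exp (-γ * corrPotential μ a) with hcdef
  set Λ : ℕ → ℝ := fun M => ∫ a, χ M a * edgeWeight α (M * b M) a *
      Real.exp (-γ * corrPotential μ a) with hΛ
  set Emax := ∫ a : Space n, edgeWeight α (γ + 1) a with hEmax
  have hE0 : 0 ≤ Emax := integral_nonneg fun a => (edgeWeight_pos _ _ _).le
  have hΛ0 : Tendsto Λ atTop (𝓝 0) := by
    have h2 : Tendsto (fun M : ℕ => ((M : ℝ) + 1)⁻¹) atTop (𝓝 0) :=
      tendsto_inv_atTop_zero.comp (tendsto_atTop_add_const_right _ 1 tendsto_natCast_atTop_atTop)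
    have h3 := hχl.mul h2
    rw [mul_zero] at h3
    refine h3.congr fun M => ?_
    have : (M : ℝ) + 1 ≠ 0 := by positivity
    simp only [hΛ]
    rw [mul_comm, inv_mul_cancel_left₀ this]
  rw [Metric.tendsto_atTop']
  intro τ hτ
  set D := 2 / L * (B * (L * l) + l * Emax) with hD
  have hD0 : 0 ≤ D := by positivity
  -- The first bound keeps the ratio z/z' below 2/L, the second puts the limiting error below τ.
  set ε := min (L / (4 * (Emax + 1))) (τ / (2 * (D + 1))) with hε
  have hε0 : 0 < ε := by positivity
  have hεE : ε * Emax ≤ L / 4 := by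
    have h2 : ε ≤ L / (4 * (Emax + 1)) := min_le_left _ _
    rw [le_div_iff₀ (by positivity)] at h2
    nlinarith
  have hεD : ε * D ≤ τ / 2 := by
    have h2 : ε ≤ τ / (2 * (D + 1)) := min_le_right _ _
    rw [le_div_iff₀ (by positivity)] at h2
    nlinarith
  have hbound : Tendsto (fun M : ℕ => (ε * B * ((M + 1) * Λ M) + |(M + 1) * Λ M - l * c M| +
      l * (ε * Emax + Λ M)) * (2 / L)) atTop (𝓝 (ε * D)) := by
    have h2 := (((hχl.const_mul (ε * B)).add (hχl.sub (hc.const_mul l)).abs).add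
      ((hΛ0.const_add (ε * Emax)).const_mul l)).mul_const (2 / L)
    have e : (ε * B * (L * l) + |L * l - l * L| + l * (ε * Emax + 0)) * (2 / L) = ε * D := by
      rw [mul_comm l L, sub_self, abs_zero, hD]
      ring
    rw [e] at h2
    exact h2
  have hlt : ε * D < τ := by linarith
  have hev := hbound.eventually (gt_mem_nhds hlt)
  have hev2 : ∀ᶠ M : ℕ in atTop, M * b M ≤ γ + 1 := hlim.eventually (ge_mem_nhds (by linarith))
  have hev3 : ∀ᶠ M : ℕ in atTop, 3 * L / 4 ≤ c M := hc.eventually (le_mem_nhds (by linarith))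
  have hall := (S.eventually_controlled hb hlim hlim' hε0).and (hev.and (hev2.and hev3))
  obtain ⟨M₀, hM₀⟩ := eventually_atTop.1 hall
  refine ⟨M₀, fun M hM => ?_⟩
  obtain ⟨C, h2, h3, h4⟩ := hM₀ M (le_of_lt hM)
  rw [Real.dist_eq]
  refine (S.abs_thin_sub_exp_le C hε0.le (hχ M) (h0 M) (h1 M) hl).trans_lt (lt_of_le_of_lt ?_ h2)
  have hzp := C.pos
  have hzp' := C.pos_succ
  have hpart := S.abs_partition_sub_le C
  set z := ∫ y : Fin M → Space n, gibbsWeight α (b M) y with hz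
  set z' := ∫ y : Fin (M + 1) → Space n, gibbsWeight α (b M) y with hz'
  have hE : ∫ a : Space n, edgeWeight α (M * b M) a ≤ Emax :=
    integral_mono (edgeWeight_integrable S.alpha_pos _) (edgeWeight_integrable S.alpha_pos _)
      fun a => edgeWeight_mono α h3 a
  have hχi := S.integrable_mul_edgeWeight (hχ M) (h0 M) (h1 M) (M * b M)
  have hκ : ∫ a, χ M a * edgeWeight α (M * b M) a ≤ B * Λ M := by
    rw [hΛ, ← integral_const_mul]
    refine integral_mono hχi.1 (hχi.2.const_mul B) fun a => ?_
    have h5 : 0 ≤ χ M a * edgeWeight α (M * b M) a :=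
      mul_nonneg (h0 M a) (edgeWeight_pos _ _ _).le
    have h6 := mul_le_mul_of_nonneg_left (hB a).2 h5
    simp only
    linarith
  have hr : z / z' ≤ 2 / L := by
    rw [div_le_div_iff₀ hzp' hL]
    have h5 := (abs_le.1 hpart).1
    have h6 : ε * z * (∫ a : Space n, edgeWeight α (M * b M) a) ≤ z * (L / 4) := by
      calc ε * z * (∫ a : Space n, edgeWeight α (M * b M) a) ≤ ε * z * Emax := by gcongr
        _ = z * (ε * Emax) := by ring
        _ ≤ z * (L / 4) := by gcongr
    have h7 : 3 * L / 4 * z ≤ c M * z := by gcongr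
    linarith
  have hΛM : 0 ≤ Λ M := integral_nonneg fun a =>
    mul_nonneg (mul_nonneg (h0 M a) (edgeWeight_pos _ _ _).le) (Real.exp_pos _).le
  refine mul_le_mul ?_ hr (by positivity) (by positivity)
  refine add_le_add (add_le_add ?_ le_rfl) ?_
  · calc ((M : ℝ) + 1) * ε * ∫ a, χ M a * edgeWeight α (M * b M) a
        ≤ ((M : ℝ) + 1) * ε * (B * Λ M) := by gcongr
      _ = ε * B * ((M + 1) * Λ M) := by ring
  · gcongr

end Solution

end LogGas

/-! ### Asymptotics of the edge radius -/

namespace LogGas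

theorem abs_rpow_one_add_sub_le {α q : ℝ} (hα : 0 < α) (hq : |q| ≤ 1 / 2)
    (hq2 : 2 * α * |q| ≤ 1) :
    |(1 + q) ^ α - 1 - α * q| ≤ (4 * α ^ 2 + 2 * α) * q ^ 2 := by
  have hq' := abs_le.1 hq
  have hpos : 0 < 1 + q := by linarith
  have h1 : |Real.log (1 + q) - q| ≤ 2 * q ^ 2 := by
    have h := Real.abs_log_sub_add_sum_range_le (x := -q) (by rw [abs_neg]; linarith) 1
    simp only [Finset.range_one, Finset.sum_singleton, zero_add, pow_one, CharP.cast_eq_zero,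
      div_one, sub_neg_eq_add, abs_neg] at h
    have e : Real.log (1 + q) - q = -q + Real.log (1 + q) := by ring
    rw [e]
    refine h.trans ?_
    rw [div_le_iff₀ (by linarith), ← sq_abs q, one_add_one_eq_two]
    nlinarith [sq_nonneg |q|]
  have h0 : |Real.log (1 + q)| ≤ 2 * |q| := by
    have e : Real.log (1 + q) = (Real.log (1 + q) - q) + q := by ring
    rw [e]
    refine (abs_add_le _ _).trans ?_
    have : 2 * q ^ 2 ≤ |q| := by
      rw [← sq_abs q]
      nlinarith [abs_nonneg q]
    linarith
  set y := α * Real.log (1 + q) with hy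
  have hy1 : |y| ≤ 2 * α * |q| := by
    rw [hy, abs_mul, abs_of_pos hα]
    nlinarith
  have h2 := Real.abs_exp_sub_one_sub_id_le (hy1.trans hq2)
  have h3 : y ^ 2 ≤ 4 * α ^ 2 * q ^ 2 := by
    rw [← sq_abs y, ← sq_abs q]
    calc |y| ^ 2 ≤ (2 * α * |q|) ^ 2 := by gcongr
      _ = 4 * α ^ 2 * |q| ^ 2 := by ring
  have e : (1 + q) ^ α - 1 - α * q = (Real.exp y - 1 - y) + α * (Real.log (1 + q) - q) := by
    rw [Real.rpow_def_of_pos hpos, mul_comm (Real.log (1 + q)) α, hy]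
    ring
  rw [e]
  refine (abs_add_le _ _).trans ?_
  rw [abs_mul, abs_of_pos hα]
  nlinarith

/-- Applied with l = log N and q the relative shift of the radius: only the linear term of η^α
survives, because log N times the squared shift is negligible. -/
theorem tendsto_mul_rpow_one_add_sub {ι : Type*} {F : Filter ι} {α : ℝ} (hα : 0 < α)
    {q l : ι → ℝ} (hq : Tendsto q F (𝓝 0)) (hlq : Tendsto (fun i => l i * q i ^ 2) F (𝓝 0)) :
    Tendsto (fun i => l i * ((1 + q i) ^ α - 1 - α * q i)) F (𝓝 0) := by
  have hq1 : Tendsto (fun i => |q i|) F (𝓝 0) := by simpa using hq.abs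
  have h1 : ∀ᶠ i in F, |q i| ≤ 1 / 2 := hq1.eventually (ge_mem_nhds (by norm_num))
  have h2 : ∀ᶠ i in F, 2 * α * |q i| ≤ 1 := by
    have := hq1.const_mul (2 * α)
    rw [mul_zero] at this
    exact this.eventually (ge_mem_nhds one_pos)
  have h3 : Tendsto (fun i => (4 * α ^ 2 + 2 * α) * |l i * q i ^ 2|) F (𝓝 0) := by
    simpa using hlq.abs.const_mul (4 * α ^ 2 + 2 * α)
  refine squeeze_zero_norm' ?_ h3
  filter_upwards [h1, h2] with i hi1 hi2
  rw [Real.norm_eq_abs, abs_mul, abs_mul, abs_of_nonneg (sq_nonneg (q i))]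
  calc |l i| * |(1 + q i) ^ α - 1 - α * q i|
      ≤ |l i| * ((4 * α ^ 2 + 2 * α) * q i ^ 2) := by
        gcongr
        exact abs_rpow_one_add_sub_le hα hi1 hi2
    _ = _ := by ring

theorem tendsto_log_div_self : Tendsto (fun x : ℝ => Real.log x / x) atTop (𝓝 0) :=
  Real.isLittleO_log_id_atTop.tendsto_div_nhds_zero

theorem tendsto_log_div_sqrt : Tendsto (fun x : ℝ => Real.log x / √x) atTop (𝓝 0) := by
  have h := (isLittleO_log_rpow_atTop (r := 1 / 2) (by norm_num)).tendsto_div_nhds_zero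
  simpa only [← Real.sqrt_eq_rpow] using h

theorem tendsto_log_natCast : Tendsto (fun N : ℕ => Real.log N) atTop atTop :=
  Real.tendsto_log_atTop.comp tendsto_natCast_atTop_atTop

/-- The relative correction in the definition of `edgeRadius`. -/
noncomputable def edgeShift (n : ℕ) (α L l a : ℝ) : ℝ :=
  (a - n * (α - 1)) / α ^ 2 * (Real.log l / l) - Real.log (α ^ n * L) / (α * l)

theorem edgeRadius_eq (n N : ℕ) (α β L : ℝ) : edgeRadius n N α β L =
    Real.log N ^ (1 / α) * (1 + edgeShift n α L (Real.log N) (N * β)) := by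
  rw [edgeRadius, edgeShift, mul_comm β, add_sub_assoc]

section

variable {n : ℕ} {α L γ : ℝ} {a : ℕ → ℝ}

theorem tendsto_edgeShift (ha : Tendsto a atTop (𝓝 γ)) :
    Tendsto (fun N : ℕ => edgeShift n α L (Real.log N) (a N)) atTop (𝓝 0) := by
  have h1 := ((ha.sub_const ((n : ℝ) * (α - 1))).div_const (α ^ 2)).mul
    (tendsto_log_div_self.comp tendsto_log_natCast)
  have h2 := (tendsto_log_natCast.inv_tendsto_atTop).const_mul (Real.log (α ^ n * L) / α)
  have h3 := h1.sub h2
  rw [mul_zero, mul_zero, sub_zero] at h3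
  refine h3.congr fun N => ?_
  simp only [edgeShift, Function.comp_apply, Pi.inv_apply]
  ring

/-- With l = log N, the product is the square of a combination of (log l)/√l and 1/√l with
convergent coefficients. -/
theorem tendsto_log_mul_edgeShift_sq (ha : Tendsto a atTop (𝓝 γ)) :
    Tendsto (fun N : ℕ => Real.log N * edgeShift n α L (Real.log N) (a N) ^ 2) atTop (𝓝 0) := by
  have h1 := ((ha.sub_const ((n : ℝ) * (α - 1))).div_const (α ^ 2)).mul
    (tendsto_log_div_sqrt.comp tendsto_log_natCast)
  have h2 := ((Real.tendsto_sqrt_atTop.comp tendsto_log_natCast).inv_tendsto_atTop).const_mul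
    (Real.log (α ^ n * L) / α)
  have h3 := (h1.sub h2).pow 2
  rw [mul_zero, mul_zero, sub_zero, zero_pow two_ne_zero] at h3
  refine h3.congr' ?_
  filter_upwards [tendsto_log_natCast.eventually_gt_atTop 0] with N hN
  have hs : 0 < √(Real.log N) := Real.sqrt_pos.2 hN
  have e : √(Real.log N) ^ 2 = Real.log N := Real.sq_sqrt hN.le
  simp only [edgeShift, Function.comp_apply, Pi.inv_apply]
  rw [← e, Real.sqrt_sq hs.le]
  field_simp

theorem eventually_one_add_edgeShift_pos (ha : Tendsto a atTop (𝓝 γ)) :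
    ∀ᶠ N : ℕ in atTop, 1 / 2 < 1 + edgeShift n α L (Real.log N) (a N) := by
  have h := (tendsto_edgeShift (n := n) (α := α) (L := L) ha).const_add 1
  exact h.eventually (lt_mem_nhds (by norm_num))

end

section

variable {n : ℕ} {α L γ : ℝ} {β : ℕ → ℝ}

theorem tendsto_edgeRadius (hα : 0 < α) (hβ : Tendsto (fun N : ℕ => N * β N) atTop (𝓝 γ)) :
    Tendsto (fun N : ℕ => edgeRadius n N α (β N) L) atTop atTop := by
  simp_rw [edgeRadius_eq]
  have h1 : Tendsto (fun N : ℕ => Real.log N ^ (1 / α)) atTop atTop :=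
    (tendsto_rpow_atTop (by positivity)).comp tendsto_log_natCast
  have h2 := (tendsto_edgeShift (n := n) (α := α) (L := L) hβ).const_add 1
  rw [add_zero] at h2
  exact h1.atTop_mul_pos one_pos h2

theorem eventually_log_edgeRadius (hα : 0 < α)
    (hβ : Tendsto (fun N : ℕ => N * β N) atTop (𝓝 γ)) :
    ∀ᶠ N : ℕ in atTop, Real.log (edgeRadius n N α (β N) L) =
      1 / α * Real.log (Real.log N) +
        Real.log (1 + edgeShift n α L (Real.log N) (N * β N)) ∧
      edgeRadius n N α (β N) L ^ α =
        Real.log N * (1 + edgeShift n α L (Real.log N) (N * β N)) ^ α := by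
  filter_upwards [tendsto_log_natCast.eventually_gt_atTop 0,
    eventually_one_add_edgeShift_pos (n := n) (α := α) (L := L) hβ] with N hN hs
  have hs0 : 0 < 1 + edgeShift n α L (Real.log N) (N * β N) := by linarith
  have hl := Real.rpow_pos_of_pos hN (1 / α)
  rw [edgeRadius_eq, Real.log_mul hl.ne' hs0.ne', Real.log_rpow hN, Real.mul_rpow hl.le hs0.le,
    ← Real.rpow_mul hN.le, one_div_mul_cancel hα.ne', Real.rpow_one]
  exact ⟨rfl, rfl⟩

/-- The defining asymptotics of the radius. -/
theorem tendsto_edgeRadius_log (hα : 0 < α) (hL : 0 < L)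
    (hβ : Tendsto (fun N : ℕ => N * β N) atTop (𝓝 γ)) :
    Tendsto (fun N : ℕ => Real.log N + n * (-Real.log α +
      (1 - α) * Real.log (edgeRadius n N α (β N) L)) +
      N * β N * Real.log (edgeRadius n N α (β N) L) - edgeRadius n N α (β N) L ^ α)
      atTop (𝓝 (Real.log L)) := by
  have h1 := tendsto_edgeShift (n := n) (α := α) (L := L) hβ
  have h2 := tendsto_mul_rpow_one_add_sub hα h1 (tendsto_log_mul_edgeShift_sq hβ)
  have h3 : Tendsto (fun N : ℕ => Real.log (1 + edgeShift n α L (Real.log N) (N * β N)))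
      atTop (𝓝 0) := by
    have := (h1.const_add 1).log (by norm_num)
    simpa using this
  have h4 := ((hβ.sub_const ((n : ℝ) * (α - 1))).mul h3).sub h2
  have h5 := h4.add_const (Real.log L)
  rw [mul_zero, sub_zero, zero_add] at h5
  refine h5.congr' ?_
  filter_upwards [eventually_log_edgeRadius (n := n) (L := L) hα hβ,
    tendsto_log_natCast.eventually_gt_atTop 0] with N hN hl
  rw [hN.1, hN.2]
  have hD : Real.log (α ^ n * L) = n * Real.log α + Real.log L := by
    rw [Real.log_mul (by positivity) hL.ne', Real.log_pow]
  -- The shift is designed for this identity: it cancels the log log N terms and n log α, and leaves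
  -- log L.
  have hq : Real.log N * (α * edgeShift n α L (Real.log N) (N * β N)) =
      (N * β N - n * (α - 1)) * (1 / α * Real.log (Real.log N)) -
        (n * Real.log α + Real.log L) := by
    rw [edgeShift, hD]
    field_simp
  linear_combination hq

/-- β is O(1/N) while log η grows like log log N. The separated particle interacts with N - 1
others, and this bounds the effect of that missing unit. -/
theorem tendsto_beta_mul_log_edgeRadius (hα : 0 < α)
    (hβ : Tendsto (fun N : ℕ => N * β N) atTop (𝓝 γ)) :
    Tendsto (fun N : ℕ => β N * Real.log (edgeRadius n N α (β N) L)) atTop (𝓝 0) := by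
  have h1 := tendsto_edgeShift (n := n) (α := α) (L := L) hβ
  have h3 : Tendsto (fun N : ℕ => Real.log (1 + edgeShift n α L (Real.log N) (N * β N)))
      atTop (𝓝 0) := by
    have := (h1.const_add 1).log (by norm_num)
    simpa using this
  have hN : Tendsto (fun N : ℕ => (N : ℝ)⁻¹) atTop (𝓝 0) :=
    tendsto_inv_atTop_zero.comp tendsto_natCast_atTop_atTop
  have hll := (tendsto_log_div_self.comp tendsto_log_natCast).mul
    (tendsto_log_div_self.comp tendsto_natCast_atTop_atTop)
  have h4 := hβ.mul ((hll.const_mul (1 / α)).add (h3.mul hN))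
  simp only [mul_zero, add_zero] at h4
  refine h4.congr' ?_
  filter_upwards [eventually_log_edgeRadius (n := n) (L := L) hα hβ,
    tendsto_log_natCast.eventually_gt_atTop 0, eventually_gt_atTop 0] with N h hl hN0
  have hN' : (0 : ℝ) < N := Nat.cast_pos.2 hN0
  rw [h.1]
  simp only [Function.comp_apply]
  field_simp

end

end LogGas

/-! ### Rescaling of the one-point weight at the edge -/

namespace LogGas

variable {n : ℕ} {α η : ℝ} {υ : Space n} {ψ : Space n ≃ₗᵢ[ℝ] Space n}

theorem norm_zoom (hη : 0 < η) (u : Space n) :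
    ‖zoom α η υ ψ u‖ = η * ‖υ + (α⁻¹ * η ^ (-α)) • ψ u‖ := by
  rw [zoom, norm_smul, Real.norm_of_nonneg hη.le]

theorem integral_zoom (hα : 0 < α) (hη : 0 < η) (F : Space n → ℝ) :
    ∫ x, F x = (η * (α⁻¹ * η ^ (-α))) ^ n * ∫ u, F (zoom α η υ ψ u) := by
  have hs : 0 < η * (α⁻¹ * η ^ (-α)) := by positivity
  set s := η * (α⁻¹ * η ^ (-α)) with hsdef
  have h1 : ∀ u, F (zoom α η υ ψ u) = (fun v => F (η • υ + s • v)) (ψ u) := fun u => by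
    simp only [zoom, smul_add, smul_smul, hsdef]
  simp_rw [h1]
  have h2 : ∫ u, (fun v => F (η • υ + s • v)) (ψ u) = ∫ v, F (η • υ + s • v) :=
    MeasurePreserving.integral_comp (f := ψ) (g := fun v => F (η • υ + s • v))
      ψ.measurePreserving ψ.toHomeomorph.measurableEmbedding
  have h3 := Measure.integral_comp_smul (volume : Measure (Space n)) (fun v => F (η • υ + v)) s
  rw [h2, h3, integral_add_left_eq_self, finrank_euclideanSpace, Fintype.card_fin,
    abs_of_pos (by positivity), smul_eq_mul, ← mul_assoc, mul_inv_cancel₀ (by positivity), one_mul]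

theorem norm_add_smul_sq (hυ : ‖υ‖ = 1) (t : ℝ) (v : Space n) :
    ‖υ + t • v‖ ^ 2 = 1 + 2 * t * inner ℝ υ v + t ^ 2 * ‖v‖ ^ 2 := by
  rw [norm_add_sq_real, hυ, inner_smul_right, norm_smul, mul_pow, Real.norm_eq_abs, sq_abs]
  ring

theorem hasDerivAt_norm_add_smul_rpow (hυ : ‖υ‖ = 1) (α : ℝ) (v : Space n) :
    HasDerivAt (fun t : ℝ => ‖υ + t • v‖ ^ α) (α * inner ℝ υ v) 0 := by
  have h1 : (fun t : ℝ => ‖υ + t • v‖ ^ α) =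
      fun t => (1 + 2 * t * inner ℝ υ v + t ^ 2 * ‖v‖ ^ 2) ^ (α / 2) := by
    ext t
    rw [← norm_add_smul_sq hυ, ← Real.rpow_natCast, ← Real.rpow_mul (norm_nonneg _)]
    congr 1
    push_cast
    ring
  rw [h1]
  have h2 : HasDerivAt (fun t : ℝ => 1 + 2 * t * inner ℝ υ v + t ^ 2 * ‖v‖ ^ 2)
      (2 * inner ℝ υ v) 0 := by
    have a1 := (((hasDerivAt_id (0 : ℝ)).const_mul 2).mul_const (inner ℝ υ v)).const_add 1
    have a2 := ((hasDerivAt_id (0 : ℝ)).pow 2).mul_const (‖v‖ ^ 2)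
    refine (a1.add a2).congr_deriv ?_
    simp
  refine (h2.rpow_const (p := α / 2) (Or.inl (by simp))).congr_deriv ?_
  simp
  ring

/-- A difference quotient of t ↦ |υ + tv|^α at 0 along t = α⁻¹η^{-α}: the derivative is α⟨υ, v⟩, and
the α⁻¹ in the scaling removes the α. -/
theorem tendsto_rpow_mul_norm_rpow_sub {ι : Type*} {F : Filter ι} (hα : 0 < α) (hυ : ‖υ‖ = 1)
    {η : ι → ℝ} (hη : Tendsto η F atTop) (v : Space n) :
    Tendsto (fun i => η i ^ α * (‖υ + (α⁻¹ * η i ^ (-α)) • v‖ ^ α - 1)) F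
      (𝓝 (inner ℝ υ v)) := by
  have h1 := (hasDerivAt_norm_add_smul_rpow hυ α v).tendsto_slope_zero
  have h0 : Tendsto (fun i => η i ^ (-α)) F (𝓝 0) := (tendsto_rpow_neg_atTop hα).comp hη
  have h2 : Tendsto (fun i => α⁻¹ * η i ^ (-α)) F (𝓝[≠] 0) := by
    refine tendsto_nhdsWithin_iff.2 ⟨by simpa using h0.const_mul α⁻¹, ?_⟩
    filter_upwards [hη.eventually_gt_atTop 0] with i hi
    have : 0 < α⁻¹ * η i ^ (-α) := by positivity
    exact this.ne'
  have h3 := (h1.comp h2).const_mul α⁻¹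
  rw [← mul_assoc, inv_mul_cancel₀ hα.ne', one_mul] at h3
  refine h3.congr' ?_
  filter_upwards [hη.eventually_gt_atTop 0] with i hi
  simp only [Function.comp_apply, zero_add, zero_smul, add_zero, hυ, Real.one_rpow, smul_eq_mul]
  rw [mul_inv, inv_inv, Real.rpow_neg hi.le, inv_inv]
  field_simp

theorem tendsto_norm_add_smul {ι : Type*} {F : Filter ι} (hα : 0 < α) (hυ : ‖υ‖ = 1)
    {η : ι → ℝ} (hη : Tendsto η F atTop) (v : Space n) :
    Tendsto (fun i => ‖υ + (α⁻¹ * η i ^ (-α)) • v‖) F (𝓝 1) := by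
  have h0 : Tendsto (fun i => η i ^ (-α)) F (𝓝 0) := (tendsto_rpow_neg_atTop hα).comp hη
  have h1 := (((h0.const_mul α⁻¹).smul_const v).const_add υ).norm
  simpa [hυ] using h1

/-- Bernoulli's inequality for α ≥ 1 and monotonicity in the exponent for α ≤ 1, merged into one
linear bound for the domination below. -/
theorem one_sub_max_mul_le_rpow {y : ℝ} (hy0 : 0 ≤ y) (hy1 : y < 1) :
    1 - max 1 α * y ≤ (1 - y) ^ α := by
  rcases le_total 1 α with h | h
  · rw [max_eq_right h]
    have := one_add_mul_self_le_rpow_one_add (s := -y) (by linarith) h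
    rw [← sub_eq_add_neg] at this
    linarith
  · rw [max_eq_left h, one_mul]
    calc 1 - y = (1 - y) ^ (1 : ℝ) := (Real.rpow_one _).symm
      _ ≤ (1 - y) ^ α := Real.rpow_le_rpow_of_exponent_ge (by linarith) (by linarith) h

section Kernel

variable {L γ : ℝ} {β : ℕ → ℝ} [NeZero n]

/-- The rescaled weight at the edge, in exponential form. -/
theorem edge_kernel_eq (hα : 0 < α) {N : ℕ} (hN : 0 < N) (hη : 0 < η) (A B : ℝ) (u : Space n) :
    N * (η * (α⁻¹ * η ^ (-α))) ^ n * edgeWeight α (A - B) (zoom α η υ ψ u) =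
      Real.exp ((Real.log N + n * (-Real.log α + (1 - α) * Real.log η) + A * Real.log η - η ^ α) -
        B * Real.log η - η ^ α * (‖υ + (α⁻¹ * η ^ (-α)) • ψ u‖ ^ α - 1) +
        (A - B) * Real.log (‖υ + (α⁻¹ * η ^ (-α)) • ψ u‖ + η⁻¹)) := by
  have hN' : (0 : ℝ) < N := Nat.cast_pos.2 hN
  have hp : 0 < η * (α⁻¹ * η ^ (-α)) := by positivity
  have h1 : N * (η * (α⁻¹ * η ^ (-α))) ^ n =
      Real.exp (Real.log N + n * (-Real.log α + (1 - α) * Real.log η)) := by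
    rw [Real.exp_add, Real.exp_log hN', ← Real.rpow_natCast, Real.rpow_def_of_pos hp,
      Real.log_mul hη.ne' (by positivity), Real.log_mul (by positivity) (by positivity),
      Real.log_inv, Real.log_rpow hη]
    congr 2
    ring
  set ρ := ‖υ + (α⁻¹ * η ^ (-α)) • ψ u‖ with hρ
  have hρ0 : 0 ≤ ρ := norm_nonneg _
  have h2 : logWeight (zoom α η υ ψ u) = Real.log η + Real.log (ρ + η⁻¹) := by
    rw [logWeight, norm_zoom hη, ← Real.log_mul hη.ne' (by positivity), ← hρ]
    congr 1
    field_simp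
    ring
  have h3 : potential α (zoom α η υ ψ u) = η ^ α * ρ ^ α := by
    rw [potential, norm_zoom hη, Real.mul_rpow hη.le hρ0]
  rw [h1, edgeWeight, h2, h3, ← Real.exp_add]
  congr 1
  ring

/-- In the exponent of `edge_kernel_eq` the bracket tends to log L by the choice of radius, β log η
tends to 0, the radial expansion gives -⟨υ, ψu⟩ = -⟨e₁, u⟩, and the last logarithm tends to log 1.
-/
theorem tendsto_edge_kernel (hα : 0 < α) (hL : 0 < L) (hυ : ‖υ‖ = 1)
    (hψ : ψ (firstBasisVector n) = υ)
    (hβ : Tendsto (fun N : ℕ => N * β N) atTop (𝓝 γ)) (hβ0 : Tendsto β atTop (𝓝 0)) (u : Space n) :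
    Tendsto (fun N : ℕ => N * (edgeRadius n N α (β N) L *
        (α⁻¹ * edgeRadius n N α (β N) L ^ (-α))) ^ n *
        edgeWeight α (N * β N - β N) (zoom α (edgeRadius n N α (β N) L) υ ψ u)) atTop
      (𝓝 (L * Real.exp (-(inner ℝ (firstBasisVector n) u)))) := by
  have hη := tendsto_edgeRadius (n := n) (L := L) hα hβ
  have hin : inner ℝ (firstBasisVector n) u = inner ℝ υ (ψ u) := by
    rw [← hψ, LinearIsometryEquiv.inner_map_map]
  have h1 := (tendsto_edgeRadius_log (n := n) hα hL hβ).sub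
    (tendsto_beta_mul_log_edgeRadius (n := n) (L := L) hα hβ)
  have h2 := h1.sub (tendsto_rpow_mul_norm_rpow_sub hα hυ hη (ψ u))
  have h3 := ((tendsto_norm_add_smul hα hυ hη (ψ u)).add hη.inv_tendsto_atTop).log (by norm_num)
  have h4 := h2.add ((hβ.sub hβ0).mul h3)
  rw [sub_zero, add_zero, Real.log_one, mul_zero, add_zero] at h4
  have h5 := (Real.continuous_exp.tendsto _).comp h4
  have e : Real.exp (Real.log L - inner ℝ υ (ψ u)) =
      L * Real.exp (-(inner ℝ (firstBasisVector n) u)) := by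
    rw [sub_eq_add_neg, Real.exp_add, Real.exp_log hL, ← hin]
  rw [e] at h5
  refine h5.congr' ?_
  filter_upwards [hη.eventually_gt_atTop 0, eventually_gt_atTop 0] with N hN hN0
  rw [edge_kernel_eq hα hN0 hN]
  rfl

/-- Domination on bounded sets, to integrate the limit in `tendsto_edge_kernel`. -/
theorem exists_edge_kernel_le (hα : 0 < α) (hL : 0 < L) (hυ : ‖υ‖ = 1)
    (hβ : Tendsto (fun N : ℕ => N * β N) atTop (𝓝 γ))
    (hβp : ∀ N, 0 < β N) (R : ℝ) :
    ∃ C, ∀ᶠ N : ℕ in atTop, ∀ u, ‖u‖ ≤ R → N * (edgeRadius n N α (β N) L *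
        (α⁻¹ * edgeRadius n N α (β N) L ^ (-α))) ^ n *
        edgeWeight α (N * β N - β N) (zoom α (edgeRadius n N α (β N) L) υ ψ u) ≤ C := by
  have hη := tendsto_edgeRadius (n := n) (L := L) hα hβ
  have h1 := (tendsto_edgeRadius_log (n := n) hα hL hβ).sub
    (tendsto_beta_mul_log_edgeRadius (n := n) (L := L) hα hβ)
  have h0 : Tendsto (fun N : ℕ => α⁻¹ * edgeRadius n N α (β N) L ^ (-α) * R) atTop (𝓝 0) := by
    have := (((tendsto_rpow_neg_atTop hα).comp hη).const_mul α⁻¹).mul_const R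
    simpa using this
  have hb : ∀ᶠ N : ℕ in atTop, N * β N ≤ γ + 1 := hβ.eventually (ge_mem_nhds (by linarith))
  -- The limit log L - 0 with a margin of 1, then one summand for the radial term and one for the
  -- logarithmic term of `edge_kernel_eq`.
  refine ⟨Real.exp (Real.log L - 0 + 1 + max 1 α * R / α + (γ + 1) * 2), ?_⟩
  filter_upwards [hη.eventually_ge_atTop 1, eventually_gt_atTop 0, hb,
    h1.eventually (ge_mem_nhds (lt_add_one _)), h0.eventually (ge_mem_nhds (by norm_num :
      (0 : ℝ) < 1 / 2))] with N hN hN0 hbN h1N h0N u hu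
  have hηp : 0 < edgeRadius n N α (β N) L := by linarith
  rw [edge_kernel_eq hα hN0 hηp]
  refine Real.exp_le_exp.2 ?_
  set η := edgeRadius n N α (β N) L with hηdef
  set κ := α⁻¹ * η ^ (-α) with hκ
  have hκ0 : 0 < κ := by positivity
  have hN1 : (1 : ℝ) ≤ N := by exact_mod_cast hN0
  have hbp := hβp N
  have hκu : ‖κ • ψ u‖ ≤ κ * R := by
    rw [norm_smul, Real.norm_of_nonneg hκ0.le, LinearIsometryEquiv.norm_map]
    gcongr
  have hR0 : 0 ≤ κ * R := (norm_nonneg _).trans hκu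
  have hup : ‖υ + κ • ψ u‖ ≤ 3 / 2 := by
    refine (norm_add_le _ _).trans ?_
    rw [hυ]
    linarith
  have hlow : 1 - κ * R ≤ ‖υ + κ • ψ u‖ := by
    have := norm_sub_norm_le υ (-(κ • ψ u))
    rw [norm_neg, sub_neg_eq_add, hυ] at this
    linarith
  set ρ := ‖υ + κ • ψ u‖ with hρ
  have hρ0 : 0 ≤ ρ := norm_nonneg _
  have h2 : -(η ^ α * (ρ ^ α - 1)) ≤ max 1 α * R / α := by
    have h3 : 1 - max 1 α * (κ * R) ≤ ρ ^ α :=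
      (one_sub_max_mul_le_rpow hR0 (by linarith)).trans
        (Real.rpow_le_rpow (by linarith) hlow hα.le)
    have hηα : 0 < η ^ α := by positivity
    have h4 := mul_le_mul_of_nonneg_left h3 hηα.le
    have h5 : η ^ α * (max 1 α * (κ * R)) = max 1 α * R / α := by
      rw [hκ, Real.rpow_neg hηp.le]
      field_simp
    nlinarith
  have hA0 : 0 ≤ N * β N - β N := by nlinarith
  have h3 : (N * β N - β N) * Real.log (ρ + η⁻¹) ≤ (γ + 1) * 2 := by
    have hη1 : η⁻¹ ≤ 1 := inv_le_one_of_one_le₀ hN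
    have hηi : 0 < η⁻¹ := by positivity
    have h4 : Real.log (ρ + η⁻¹) ≤ 2 := by
      have := Real.log_le_sub_one_of_pos (by positivity : 0 < ρ + η⁻¹)
      linarith
    calc (N * β N - β N) * Real.log (ρ + η⁻¹) ≤ (N * β N - β N) * 2 := by gcongr
      _ ≤ (γ + 1) * 2 := by gcongr; linarith
  linarith

end Kernel

namespace Solution

variable [NeZero n] {γ L : ℝ} {μ : Measure (Space n)} {β : ℕ → ℝ}

theorem tendsto_corrPotential_zoom (S : Solution α γ L μ) (hυ : ‖υ‖ = 1) {η : ℕ → ℝ}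
    (hη : Tendsto η atTop atTop) (u : Space n) :
    Tendsto (fun N => corrPotential μ (zoom α (η N) υ ψ u)) atTop (𝓝 0) := by
  refine S.tendsto_corrPotential.comp ?_
  rw [← Metric.cobounded_eq_cocompact, ← tendsto_norm_atTop_iff_cobounded]
  have h1 := hη.atTop_mul_pos one_pos (tendsto_norm_add_smul S.alpha_pos hυ hη (ψ u))
  refine h1.congr' ?_
  filter_upwards [hη.eventually_gt_atTop 0] with N hN
  exact (norm_zoom hN u).symm

/-- Convergence of the rescaled one-point intensity. -/
theorem tendsto_integral_zoom (S : Solution α γ L μ) (hυ : ‖υ‖ = 1)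
    (hψ : ψ (firstBasisVector n) = υ)
    (hβ : Tendsto (fun N : ℕ => N * β N) atTop (𝓝 γ)) (hβ0 : Tendsto β atTop (𝓝 0))
    (hβp : ∀ N, 0 < β N) {φ : Space n → ℝ} (hφ : Measurable φ) (h0 : ∀ u, 0 ≤ φ u)
    (h1 : ∀ u, φ u ≤ 1) {R : ℝ} (hR : ∀ u, R < ‖u‖ → φ u = 0) :
    Tendsto (fun N : ℕ => N * ∫ a, φ (zoomInv α (edgeRadius n N α (β N) L) υ ψ a) *
      edgeWeight α (N * β N - β N) a * Real.exp (-γ * corrPotential μ a)) atTop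
      (𝓝 (L * ∫ u, φ u * Real.exp (-(inner ℝ (firstBasisVector n) u)))) := by
  have hα := S.alpha_pos
  have hη := tendsto_edgeRadius (n := n) (L := L) hα hβ
  obtain ⟨C, hC⟩ := exists_edge_kernel_le (n := n) (υ := υ) (ψ := ψ) hα S.const_pos
    hυ hβ hβp R
  obtain ⟨B, hB1, hB⟩ := S.exists_exp_corrPotential_le
  set η : ℕ → ℝ := fun N => edgeRadius n N α (β N) L with hηdef
  set K : ℕ → Space n → ℝ := fun N u => N * (η N * (α⁻¹ * η N ^ (-α))) ^ n *
    edgeWeight α (N * β N - β N) (zoom α (η N) υ ψ u) with hK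
  have hK0 : ∀ᶠ N in atTop, ∀ u, 0 ≤ K N u := by
    filter_upwards [hη.eventually_gt_atTop 0] with N hN u
    have := edgeWeight_pos α (N * β N - β N) (zoom α (η N) υ ψ u)
    have hN' : 0 < η N := hN
    positivity
  have hzm : ∀ N, Measurable (zoom α (η N) υ ψ) := fun N => by
    unfold zoom
    exact ((continuous_const.add
      (ψ.continuous.const_smul (α⁻¹ * η N ^ (-α)))).const_smul (η N)).measurable
  have hlim : Tendsto (fun N : ℕ => ∫ u, φ u * (K N u *
      Real.exp (-γ * corrPotential μ (zoom α (η N) υ ψ u)))) atTop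
      (𝓝 (∫ u, φ u * (L * Real.exp (-(inner ℝ (firstBasisVector n) u)) *
        Real.exp (-γ * 0)))) := by
    refine tendsto_integral_filter_of_dominated_convergence
      ((Metric.closedBall (0 : Space n) R).indicator fun _ => C * B) ?_ ?_ ?_ ?_
    · refine Eventually.of_forall fun N => (hφ.mul (Measurable.mul ?_ ?_)).aestronglyMeasurable
      · exact ((continuous_edgeWeight hα _).measurable.comp (hzm N)).const_mul _
      · exact S.measurable_exp_corrPotential.comp (hzm N)
    · filter_upwards [hC, hK0] with N hCN hKN
      refine ae_of_all _ fun u => ?_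
      by_cases hu : ‖u‖ ≤ R
      · rw [Set.indicator_of_mem (by simpa using hu), Real.norm_of_nonneg
          (mul_nonneg (h0 u) (mul_nonneg (hKN u) (Real.exp_pos _).le))]
        have h2 : K N u * Real.exp (-γ * corrPotential μ (zoom α (η N) υ ψ u)) ≤ C * B :=
          mul_le_mul (hCN u hu) (hB _).1 (Real.exp_pos _).le ((hKN u).trans (hCN u hu))
        refine (mul_le_of_le_one_left (mul_nonneg (hKN u) (Real.exp_pos _).le) (h1 u)).trans h2
      · rw [hR u (not_le.1 hu), zero_mul, norm_zero,
          Set.indicator_of_notMem (by simpa using hu)]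
    · exact (integrable_indicator_iff Metric.isClosed_closedBall.measurableSet).2
        (integrableOn_const (by exact (measure_closedBall_lt_top).ne))
    · refine ae_of_all _ fun u => Tendsto.const_mul _ (Tendsto.mul ?_ ?_)
      · exact tendsto_edge_kernel hα S.const_pos hυ hψ hβ hβ0 u
      · exact (Real.continuous_exp.tendsto _).comp
          ((S.tendsto_corrPotential_zoom hυ hη u).const_mul _)
  have e1 : ∫ u, φ u * (L * Real.exp (-(inner ℝ (firstBasisVector n) u)) * Real.exp (-γ * 0)) =
      L * ∫ u, φ u * Real.exp (-(inner ℝ (firstBasisVector n) u)) := by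
    rw [← integral_const_mul]
    refine integral_congr_ae (ae_of_all _ fun u => ?_)
    simp only [mul_zero, Real.exp_zero, mul_one]
    ring
  rw [e1] at hlim
  refine hlim.congr' ?_
  filter_upwards [hη.eventually_gt_atTop 0] with N hN
  have hN' : 0 < η N := hN
  rw [integral_zoom (υ := υ) (ψ := ψ) hα hN'
    (fun a => φ (zoomInv α (edgeRadius n N α (β N) L) υ ψ a) *
    edgeWeight α (N * β N - β N) a * Real.exp (-γ * corrPotential μ a)),
    ← mul_assoc, ← integral_const_mul]
  refine integral_congr_ae (ae_of_all _ fun u => ?_)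
  simp only [hK]
  rw [zoomInv_zoom hα hN']
  ring

end Solution

end LogGas

/-! ### Laplace functional of the edge process -/

namespace LogGas

/-- The function `t ↦ e^{-t}` on `[0, ∞]`. -/
noncomputable def expNeg (t : ℝ≥0∞) : ℝ≥0∞ := EReal.exp (-(t : EReal))

theorem expNeg_eq_inv (t : ℝ≥0∞) : expNeg t = (EReal.exp (t : EReal))⁻¹ := EReal.exp_neg _

theorem one_le_exp_coe (t : ℝ≥0∞) : 1 ≤ EReal.exp (t : EReal) :=
  EReal.one_le_exp_iff.2 (EReal.coe_ennreal_nonneg t)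

theorem expNeg_le_one (t : ℝ≥0∞) : expNeg t ≤ 1 := by
  rw [expNeg_eq_inv]
  exact ENNReal.inv_le_one.2 (one_le_exp_coe t)

theorem expNeg_zero : expNeg 0 = 1 := by simp [expNeg]

theorem expNeg_add (s t : ℝ≥0∞) : expNeg (s + t) = expNeg s * expNeg t := by
  have hs : EReal.exp (s : EReal) ≠ 0 := (zero_lt_one.trans_le (one_le_exp_coe s)).ne'
  have ht : EReal.exp (t : EReal) ≠ 0 := (zero_lt_one.trans_le (one_le_exp_coe t)).ne'
  rw [expNeg_eq_inv, expNeg_eq_inv, expNeg_eq_inv, EReal.coe_ennreal_add, EReal.exp_add,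
    ENNReal.mul_inv (Or.inl hs) (Or.inr ht)]

theorem expNeg_sum {ι : Type*} (s : Finset ι) (f : ι → ℝ≥0∞) :
    expNeg (∑ i ∈ s, f i) = ∏ i ∈ s, expNeg (f i) := by
  classical
  induction s using Finset.induction_on with
  | empty => simp [expNeg_zero]
  | insert a s ha ih => rw [Finset.sum_insert ha, Finset.prod_insert ha, expNeg_add, ih]

theorem expNeg_ofReal {t : ℝ} (ht : 0 ≤ t) :
    expNeg (ENNReal.ofReal t) = ENNReal.ofReal (Real.exp (-t)) := by
  rw [expNeg, EReal.coe_ennreal_ofReal, max_eq_left ht, ← EReal.coe_neg, EReal.exp_coe]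

theorem expNeg_coe (t : ℝ≥0) : expNeg t = ENNReal.ofReal (Real.exp (-t)) := by
  rw [← expNeg_ofReal t.coe_nonneg, ENNReal.ofReal_coe_nnreal]

theorem continuous_expNeg : Continuous expNeg :=
  ENNReal.continuous_exp.comp (continuous_neg.comp continuous_coe_ennreal_ereal)

section Simple

variable {n : ℕ} {ι : Type*}

/-- Passes from points listed by an index to the set of points, as the simplicity clause of a point
process requires. -/
theorem sum_dirac_range {p : ι → Space n} (hp : Function.Injective p) :
    (Measure.sum fun q : Set.range p => Measure.dirac (q : Space n)) =
      Measure.sum fun i => Measure.dirac (p i) := by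
  ext s hs
  rw [Measure.sum_apply _ hs, Measure.sum_apply _ hs]
  exact ((Equiv.ofInjective p hp).tsum_eq
    fun q : Set.range p => (Measure.dirac (q : Space n)) s).symm

end Simple

section Gibbs

variable {n N : ℕ} [NeZero n] {α β : ℝ}

theorem partitionFunction_eq (hβ : 0 < β)
    (hI : Integrable (gibbsWeight α β : (Fin N → Space n) → ℝ)) :
    partitionFunction n N α β = ENNReal.ofReal (∫ x : Fin N → Space n, gibbsWeight α β x) := by
  rw [partitionFunction, ofReal_integral_eq_lintegral_ofReal hI
    (ae_of_all _ fun x => gibbsWeight_nonneg _ _ _)]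
  exact lintegral_congr fun x => exp_neg_energy α hβ x

theorem gibbs_eq (n N : ℕ) (α : ℝ) (hβ : 0 < β) : gibbs n N α β = (partitionFunction n N α β)⁻¹ •
    (volume : Measure (Fin N → Space n)).withDensity fun x =>
      ENNReal.ofReal (gibbsWeight α β x) := by
  rw [gibbs]
  congr 2
  ext1 x
  exact exp_neg_energy α hβ x

theorem isProbabilityMeasure_gibbs (hβ : 0 < β)
    (hI : Integrable (gibbsWeight α β : (Fin N → Space n) → ℝ))
    (hz : 0 < ∫ x : Fin N → Space n, gibbsWeight α β x) :
    IsProbabilityMeasure (gibbs n N α β) := by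
  refine ⟨?_⟩
  rw [gibbs, Measure.smul_apply, withDensity_apply _ MeasurableSet.univ, setLIntegral_univ,
    smul_eq_mul]
  refine ENNReal.inv_mul_cancel ?_ ?_ <;> rw [partitionFunction_eq hβ hI]
  · simpa using hz
  · exact ENNReal.ofReal_ne_top

/-- The Gibbs weight vanishes at collisions because β > 0. -/
theorem ae_injective_gibbs (hα : 0 < α) (hβ : 0 < β) :
    ∀ᵐ x ∂(gibbs n N α β), Function.Injective x := by
  rw [gibbs_eq n N α hβ]
  refine Measure.ae_smul_measure ?_ _
  rw [ae_withDensity_iff (measurable_gibbsWeight hα β).ennreal_ofReal]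
  refine ae_of_all _ fun x hx => ?_
  by_contra h
  exact hx (by rw [gibbsWeight, pairProd_of_not_injective hβ h, zero_mul, ENNReal.ofReal_zero])

variable {η : ℝ} {υ : Space n} {ψ : Space n ≃ₗᵢ[ℝ] Space n}

theorem measurable_zoomInv : Measurable (zoomInv α η υ ψ) := by
  unfold zoomInv
  exact (ψ.symm.continuous.comp (((continuous_id.const_smul η⁻¹).sub
    continuous_const).const_smul (α * η ^ α))).measurable

theorem injective_zoomInv (hα : 0 < α) (hη : 0 < η) : Function.Injective (zoomInv α η υ ψ) :=
  Function.LeftInverse.injective fun y => zoom_zoomInv hα hη υ ψ y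

theorem measurable_edgeProcess :
    Measurable (edgeProcess (N := N) α η υ ψ) := by
  refine Measure.measurable_of_measurable_coe _ fun s hs => ?_
  simp only [edgeProcess, Measure.finsetSum_apply, Measure.dirac_apply' _ hs]
  refine Finset.measurable_fun_sum _ fun j _ => ?_
  exact (measurable_one.indicator hs).comp (measurable_zoomInv.comp (measurable_pi_apply j))

theorem isPointProcess_edgeProcess (hα : 0 < α) (hβ : 0 < β) (hη : 0 < η)
    (hI : Integrable (gibbsWeight α β : (Fin N → Space n) → ℝ))
    (hz : 0 < ∫ x : Fin N → Space n, gibbsWeight α β x) :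
    IsPointProcess (gibbs n N α β) (edgeProcess α η υ ψ) := by
  refine ⟨isProbabilityMeasure_gibbs hβ hI hz, measurable_edgeProcess, ?_⟩
  filter_upwards [ae_injective_gibbs hα hβ] with x hx
  refine ⟨Set.range fun j => zoomInv α η υ ψ (x j), fun K _ => (Set.finite_range _).inter_of_left K,
    ?_⟩
  rw [sum_dirac_range (p := fun j => zoomInv α η υ ψ (x j))
    ((injective_zoomInv hα hη).comp hx), edgeProcess, Measure.sum_fintype]

/-- Each particle contributes e^{-f} = 1 - χ, so the Laplace functional is the thinned partition
function at t = 1 over the full one. -/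
theorem laplace_gibbs (hα : 0 < α) (hβ : 0 < β)
    (hI : Integrable (gibbsWeight α β : (Fin N → Space n) → ℝ))
    (hz : 0 < ∫ x : Fin N → Space n, gibbsWeight α β x) {f : Space n → ℝ≥0} (hf : Measurable f) :
    laplace (gibbs n N α β) (edgeProcess α η υ ψ) f = ENNReal.ofReal
      ((∫ x : Fin N → Space n, thin (fun a => 1 - Real.exp (-(f (zoomInv α η υ ψ a) : ℝ))) 1 x *
        gibbsWeight α β x) / ∫ x : Fin N → Space n, gibbsWeight α β x) := by
  set χ : Space n → ℝ := fun a => 1 - Real.exp (-(f (zoomInv α η υ ψ a) : ℝ)) with hχ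
  have hχm : Measurable χ :=
    ((hf.comp measurable_zoomInv).coe_nnreal_real.neg.exp).const_sub 1
  have hχ0 : ∀ a, 0 ≤ χ a := fun a => sub_nonneg.2 (Real.exp_le_one_iff.2 (by simp))
  have hχ1 : ∀ a, χ a ≤ 1 := fun a => sub_le_self _ (Real.exp_pos _).le
  have h1 : ∀ x : Fin N → Space n,
      EReal.exp (-((∫⁻ y, (f y : ℝ≥0∞) ∂(edgeProcess α η υ ψ x) : ℝ≥0∞) : EReal)) =
      ENNReal.ofReal (thin χ 1 x) := by
    intro x
    change expNeg _ = _
    rw [edgeProcess, lintegral_finsetSum_measure]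
    simp only [lintegral_dirac' _ hf.coe_nnreal_ennreal]
    rw [expNeg_sum, thin, ENNReal.ofReal_prod_of_nonneg fun j _ => by
      rw [one_mul]; linarith [hχ1 (x j)]]
    refine Finset.prod_congr rfl fun j _ => ?_
    rw [expNeg_coe, one_mul, hχ, sub_sub_cancel]
  have hthin : ∀ x : Fin N → Space n, 0 ≤ thin χ 1 x := fun x =>
    Finset.prod_nonneg fun j _ => by rw [one_mul]; linarith [hχ1 (x j)]
  rw [laplace]
  simp_rw [h1]
  rw [gibbs_eq n N α hβ, lintegral_smul_measure, lintegral_withDensity_eq_lintegral_mul _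
    (measurable_gibbsWeight hα β).ennreal_ofReal (measurable_thin hχm 1).ennreal_ofReal,
    partitionFunction_eq hβ hI, div_eq_inv_mul, ENNReal.ofReal_mul (inv_nonneg.2 hz.le),
    ENNReal.ofReal_inv_of_pos hz, smul_eq_mul, ofReal_integral_eq_lintegral_ofReal
      (integrable_bdd_mul_gibbsWeight hI (measurable_thin hχm 1)
        (abs_thin_le_one hχ0 hχ1 zero_le_one le_rfl))
      (ae_of_all _ fun x => mul_nonneg (hthin x) (gibbsWeight_nonneg _ _ _))]
  congr 1
  refine lintegral_congr fun x => ?_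
  rw [Pi.mul_apply, ENNReal.ofReal_mul (hthin x), mul_comm]

end Gibbs

end LogGas

/-! ### Construction of the Poisson process -/

namespace LogGas

open ProbabilityTheory

section Poisson

variable {n : ℕ}

theorem ofReal_one_sub_exp_add_expNeg (t : ℝ≥0) :
    ENNReal.ofReal (1 - Real.exp (-(t : ℝ))) + expNeg t = 1 := by
  rw [expNeg_coe, ← ENNReal.ofReal_add (sub_nonneg.2 (Real.exp_le_one_iff.2 (by simp)))
    (Real.exp_pos _).le, sub_add_cancel, ENNReal.ofReal_one]

theorem lintegral_infinitePi_prod_range {X : Type*} [MeasurableSpace X] (κ : Measure X)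
    [IsProbabilityMeasure κ] {g : X → ℝ≥0∞} (hg : Measurable g) (N : ℕ) :
    ∫⁻ y, ∏ k ∈ Finset.range N, g (y k) ∂(Measure.infinitePi fun _ : ℕ => κ) =
      (∫⁻ x, g x ∂κ) ^ N := by
  rw [lintegral_prod_eq_prod_lintegral_of_indepFun (Finset.range N)
    (fun (k : ℕ) (y : ℕ → X) => g (y k)) (iIndepFun_infinitePi (X := fun _ => g) fun _ => hg)
    fun k => hg.comp (measurable_pi_apply k)]
  have h : ∀ k : ℕ, ∫⁻ y, g (y k) ∂(Measure.infinitePi fun _ : ℕ => κ) = ∫⁻ x, g x ∂κ :=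
    fun k => (measurePreserving_eval_infinitePi (fun _ : ℕ => κ) k).lintegral_comp hg
  simp_rw [h]
  rw [Finset.prod_const, Finset.card_range]

/-- The generating function of the Poisson law at a is e^{-r(1-a)}; writing 1 - a as b avoids
subtraction in [0, ∞]. -/
theorem tsum_pow_mul_poisson (r : ℝ≥0) {a b : ℝ≥0∞} (hab : b + a = 1) :
    ∑' N : ℕ, a ^ N * poissonMeasure r {N} = expNeg (r * b) := by
  have ha : a ≠ ∞ := fun h => by simp [h] at hab
  have hb : b ≠ ∞ := fun h => by simp [h] at hab
  lift a to ℝ≥0 using ha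
  lift b to ℝ≥0 using hb
  have hab' : (b : ℝ) + a = 1 := by exact_mod_cast hab
  have h1 : ∀ N : ℕ, (a : ℝ≥0∞) ^ N * poissonMeasure r {N} =
      ENNReal.ofReal (Real.exp (-r) * ((a * r : ℝ) ^ N / N.factorial)) := by
    intro N
    rw [poissonMeasure_singleton, ← ENNReal.ofReal_coe_nnreal, ← ENNReal.ofReal_pow a.coe_nonneg,
      ← ENNReal.ofReal_mul (by positivity)]
    congr 1
    rw [mul_pow]
    ring
  have h2 : HasSum (fun N : ℕ => Real.exp (-r) * ((a * r : ℝ) ^ N / N.factorial))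
      (Real.exp (-r) * Real.exp (a * r)) := by
    have := NormedSpace.expSeries_div_hasSum_exp (𝔸 := ℝ) (a * r : ℝ)
    rw [← Real.exp_eq_exp_ℝ] at this
    exact this.mul_left _
  simp_rw [h1]
  rw [← ENNReal.ofReal_tsum_of_nonneg (fun N => by positivity) h2.summable, h2.tsum_eq,
    ← ENNReal.coe_mul, expNeg_coe, ← Real.exp_add]
  congr 2
  push_cast
  linear_combination (r : ℝ) * hab'

/-- The law of a Poisson number of particles together with independent positions. -/
noncomputable def cellLaw (r : ℝ≥0) (κ : Measure (Space n)) : Measure (ℕ × (ℕ → Space n)) :=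
  (poissonMeasure r).prod (Measure.infinitePi fun _ => κ)

instance (r : ℝ≥0) (κ : Measure (Space n)) [IsProbabilityMeasure κ] :
    IsProbabilityMeasure (cellLaw r κ) := by unfold cellLaw; infer_instance

/-- The law of independent cells. -/
noncomputable def poissonLaw (r : ℕ → ℝ≥0) (κ : ℕ → Measure (Space n)) :
    Measure (ℕ → ℕ × (ℕ → Space n)) :=
  Measure.infinitePi fun m => cellLaw (r m) (κ m)

instance (r : ℕ → ℝ≥0) (κ : ℕ → Measure (Space n)) [∀ m, IsProbabilityMeasure (κ m)] :
    IsProbabilityMeasure (poissonLaw r κ) := by unfold poissonLaw; infer_instance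

/-- The particles of all the cells. -/
noncomputable def poissonProcess (ω : ℕ → ℕ × (ℕ → Space n)) : Measure (Space n) :=
  Measure.sum fun i : Σ m, Fin (ω m).1 => Measure.dirac ((ω i.1).2 i.2)

theorem lintegral_poissonProcess {f : Space n → ℝ≥0∞} (hf : Measurable f)
    (ω : ℕ → ℕ × (ℕ → Space n)) :
    ∫⁻ x, f x ∂(poissonProcess ω) =
      ∑' m, ∑ k ∈ Finset.range (ω m).1, f ((ω m).2 k) := by
  rw [poissonProcess, lintegral_sum_measure]
  simp_rw [lintegral_dirac' _ hf]
  rw [ENNReal.tsum_sigma' (fun i : Σ m, Fin (ω m).1 => f ((ω i.1).2 i.2))]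
  refine tsum_congr fun m => ?_
  rw [tsum_fintype, Finset.sum_range]

theorem measurable_sum_cell {f : Space n → ℝ≥0∞} (hf : Measurable f) :
    Measurable fun s : ℕ × (ℕ → Space n) => ∑ k ∈ Finset.range s.1, f (s.2 k) :=
  measurable_from_prod_countable_right fun N =>
    Finset.measurable_fun_sum (Finset.range N) fun k _ => hf.comp (measurable_pi_apply k)

theorem measurable_poissonProcess : Measurable (poissonProcess (n := n)) := by
  refine Measure.measurable_of_measurable_coe _ fun s hs => ?_
  have h : ∀ ω : ℕ → ℕ × (ℕ → Space n), poissonProcess ω s =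
      ∑' m, ∑ k ∈ Finset.range (ω m).1, s.indicator 1 ((ω m).2 k) := fun ω => by
    rw [← lintegral_indicator_one hs, lintegral_poissonProcess (measurable_one.indicator hs)]
  simp_rw [h]
  exact Measurable.tsum fun m =>
    (measurable_sum_cell (measurable_one.indicator hs)).comp (measurable_pi_apply m)

theorem lintegral_cellLaw (r : ℝ≥0) (κ : Measure (Space n)) [IsProbabilityMeasure κ]
    {f : Space n → ℝ≥0} (hf : Measurable f) :
    ∫⁻ s, expNeg (∑ k ∈ Finset.range s.1, (f (s.2 k) : ℝ≥0∞)) ∂(cellLaw r κ) =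
      expNeg (r * ∫⁻ x, ENNReal.ofReal (1 - Real.exp (-(f x : ℝ))) ∂κ) := by
  have hm : Measurable fun x => expNeg (f x) :=
    continuous_expNeg.measurable.comp hf.coe_nnreal_ennreal
  have hm' : Measurable fun x => ENNReal.ofReal (1 - Real.exp (-(f x : ℝ))) :=
    (hf.coe_nnreal_real.neg.exp.const_sub 1).ennreal_ofReal
  have hab : ∫⁻ x, ENNReal.ofReal (1 - Real.exp (-(f x : ℝ))) ∂κ + ∫⁻ x, expNeg (f x) ∂κ = 1 := by
    rw [← lintegral_add_left hm']
    simp_rw [ofReal_one_sub_exp_add_expNeg]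
    rw [lintegral_one, measure_univ]
  have hS : Measurable fun s : ℕ × (ℕ → Space n) =>
      expNeg (∑ k ∈ Finset.range s.1, (f (s.2 k) : ℝ≥0∞)) :=
    continuous_expNeg.measurable.comp (measurable_sum_cell hf.coe_nnreal_ennreal)
  rw [cellLaw, lintegral_prod _ hS.aemeasurable]
  simp_rw [expNeg_sum]
  rw [lintegral_countable']
  simp_rw [lintegral_infinitePi_prod_range κ hm]
  exact tsum_pow_mul_poisson r hab

/-- Independence multiplies the Laplace functionals of finitely many cells. As their number grows,
dominated convergence handles the expectation and continuity of e^{-t} on [0, ∞] handles the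
exponent. -/
theorem laplace_poissonProcess (r : ℕ → ℝ≥0) (κ : ℕ → Measure (Space n))
    [∀ m, IsProbabilityMeasure (κ m)] {f : Space n → ℝ≥0} (hf : Measurable f) :
    laplace (poissonLaw r κ) poissonProcess f = expNeg
      (∫⁻ x, ENNReal.ofReal (1 - Real.exp (-(f x : ℝ))) ∂(Measure.sum fun m => r m • κ m)) := by
  set S : ℕ × (ℕ → Space n) → ℝ≥0∞ := fun s => ∑ k ∈ Finset.range s.1, (f (s.2 k) : ℝ≥0∞)
  have hS : Measurable S := measurable_sum_cell hf.coe_nnreal_ennreal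
  have hE : Measurable fun s => expNeg (S s) := continuous_expNeg.measurable.comp hS
  set B : ℕ → ℝ≥0∞ := fun m => r m * ∫⁻ x, ENNReal.ofReal (1 - Real.exp (-(f x : ℝ))) ∂(κ m)
  have h1 : ∀ M : ℕ, ∫⁻ ω, expNeg (∑ m ∈ Finset.range M, S (ω m)) ∂(poissonLaw r κ) =
      expNeg (∑ m ∈ Finset.range M, B m) := by
    intro M
    simp_rw [expNeg_sum]
    rw [poissonLaw, lintegral_prod_eq_prod_lintegral_of_indepFun (Finset.range M)
      (fun (m : ℕ) (ω : ℕ → ℕ × (ℕ → Space n)) => expNeg (S (ω m)))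
      (iIndepFun_infinitePi (X := fun _ s => expNeg (S s)) fun _ => hE)
      fun m => hE.comp (measurable_pi_apply m)]
    refine Finset.prod_congr rfl fun m _ => ?_
    rw [← lintegral_cellLaw (r m) (κ m) hf]
    exact (measurePreserving_eval_infinitePi (fun m => cellLaw (r m) (κ m)) m).lintegral_comp hE
  have h2 : Tendsto (fun M : ℕ => expNeg (∑ m ∈ Finset.range M, B m)) atTop
      (𝓝 (expNeg (∑' m, B m))) :=
    (continuous_expNeg.tendsto _).comp (ENNReal.tendsto_nat_tsum B)
  have h3 : Tendsto (fun M : ℕ => ∫⁻ ω, expNeg (∑ m ∈ Finset.range M, S (ω m)) ∂(poissonLaw r κ))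
      atTop (𝓝 (∫⁻ ω, expNeg (∑' m, S (ω m)) ∂(poissonLaw r κ))) := by
    refine tendsto_lintegral_of_dominated_convergence (fun _ => 1) (fun M => ?_)
      (fun M => ae_of_all _ fun ω => expNeg_le_one _) (by simp) (ae_of_all _ fun ω => ?_)
    · exact continuous_expNeg.measurable.comp
        (Finset.measurable_fun_sum _ fun m _ => hS.comp (measurable_pi_apply m))
    · exact (continuous_expNeg.tendsto _).comp (ENNReal.tendsto_nat_tsum _)
  simp_rw [h1] at h3
  rw [laplace, lintegral_sum_measure]
  change ∫⁻ ω, expNeg (∫⁻ x, (f x : ℝ≥0∞) ∂(poissonProcess ω)) ∂(poissonLaw r κ) = _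
  simp_rw [lintegral_poissonProcess hf.coe_nnreal_ennreal]
  rw [tendsto_nhds_unique h3 h2]
  congr 1
  refine tsum_congr fun m => ?_
  rw [lintegral_smul_measure]
  rfl

/-- The annulus `{m ≤ |x| < m + 1}`. -/
def annulus (n m : ℕ) : Set (Space n) := {x | (m : ℝ) ≤ ‖x‖ ∧ ‖x‖ < m + 1}

theorem mem_annulus {m : ℕ} {x : Space n} : x ∈ annulus n m ↔ ⌊‖x‖⌋₊ = m :=
  (Nat.floor_eq_iff (norm_nonneg x)).symm

theorem measurableSet_annulus (n m : ℕ) : MeasurableSet (annulus n m) :=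
  (measurableSet_le measurable_const measurable_norm).inter
    (measurableSet_lt measurable_norm measurable_const)

theorem ae_injective_infinitePi (κ : Measure (Space n)) [IsProbabilityMeasure κ]
    [NullSingletonClass κ] :
    ∀ᵐ y ∂(Measure.infinitePi fun _ : ℕ => κ), Function.Injective y := by
  have h : ∀ i j : ℕ, i ≠ j → ∀ᵐ y ∂(Measure.infinitePi fun _ : ℕ => κ), y i ≠ y j := by
    intro i j hij
    have hd : MeasurableSet {p : Space n × Space n | p.1 = p.2} :=
      measurableSet_eq_fun measurable_fst measurable_snd
    have h1 := Measure.infinitePi_map_eval_prod (P := fun _ : ℕ => κ) hij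
    have h2 : (κ.prod κ) {p : Space n × Space n | p.1 = p.2} = 0 := by
      rw [Measure.measure_prod_null hd]
      refine ae_of_all _ fun x => ?_
      have : Prod.mk x ⁻¹' {p : Space n × Space n | p.1 = p.2} = {x} := by
        ext y
        simp [eq_comm]
      change κ (Prod.mk x ⁻¹' {p : Space n × Space n | p.1 = p.2}) = 0
      rw [this, measure_singleton]
    rw [← h1, Measure.map_apply (by fun_prop) hd] at h2
    exact measure_eq_zero_iff_ae_notMem.1 h2
  have h' := ae_all_iff.2 fun i => ae_all_iff.2 fun j => ae_all_iff.2 (h i j)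
  filter_upwards [h'] with y hy i j hij
  by_contra hne
  exact hy i j hne hij

theorem ae_cellLaw (r : ℝ≥0) (κ : Measure (Space n)) [IsProbabilityMeasure κ]
    [NullSingletonClass κ] {m : ℕ}
    (hκ : ∀ᵐ x ∂κ, x ∈ annulus n m) :
    ∀ᵐ s ∂(cellLaw r κ), Function.Injective s.2 ∧ ∀ k, s.2 k ∈ annulus n m := by
  have h : ∀ᵐ y ∂(Measure.infinitePi fun _ : ℕ => κ),
      Function.Injective y ∧ ∀ k, y k ∈ annulus n m := by
    refine (ae_injective_infinitePi κ).and (ae_all_iff.2 fun k => ?_)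
    exact (measurePreserving_eval_infinitePi (fun _ : ℕ => κ) k).quasiMeasurePreserving.ae hκ
  exact (Measure.quasiMeasurePreserving_snd (μ := poissonMeasure r)).ae h

/-- Points of one cell are almost surely distinct since its law has no atoms, and different cells
occupy disjoint annuli. A bounded set meets finitely many annuli, each with finitely many points. -/
theorem isPointProcess_poissonProcess (r : ℕ → ℝ≥0) (κ : ℕ → Measure (Space n))
    [∀ m, IsProbabilityMeasure (κ m)] [∀ m, NullSingletonClass (κ m)]
    (hκ : ∀ m, ∀ᵐ x ∂(κ m), x ∈ annulus n m) :
    IsPointProcess (poissonLaw r κ) poissonProcess := by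
  refine ⟨inferInstance, measurable_poissonProcess, ?_⟩
  have h : ∀ᵐ ω ∂(poissonLaw r κ), ∀ m, Function.Injective (ω m).2 ∧
      ∀ k, (ω m).2 k ∈ annulus n m := ae_all_iff.2 fun m =>
    (measurePreserving_eval_infinitePi (fun m => cellLaw (r m) (κ m)) m).quasiMeasurePreserving.ae
      (ae_cellLaw (r m) (κ m) (hκ m))
  filter_upwards [h] with ω hω
  set p : (Σ m, Fin (ω m).1) → Space n := fun i => (ω i.1).2 i.2 with hp
  have hinj : Function.Injective p := by
    rintro ⟨m, k⟩ ⟨m', k'⟩ he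
    have hm : m = m' := by
      rw [← mem_annulus.1 ((hω m).2 k), ← mem_annulus.1 ((hω m').2 k')]
      exact congrArg (fun x => ⌊‖x‖⌋₊) he
    subst hm
    exact congrArg _ (Fin.ext ((hω m).1 he))
  refine ⟨Set.range p, fun K hK => ?_, (sum_dirac_range hinj).symm⟩
  obtain ⟨R, hR⟩ := hK.isBounded.exists_norm_le
  have hfin : (p '' {i | i.1 ≤ ⌊R⌋₊}).Finite := by
    refine Set.Finite.image _ ?_
    have : {i : Σ m, Fin (ω m).1 | i.1 ≤ ⌊R⌋₊} =
        ⋃ m ∈ Set.Iic ⌊R⌋₊, Set.range (Sigma.mk m) := by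
      ext ⟨m, k⟩
      simp
    rw [this]
    exact (Set.finite_Iic _).biUnion fun m _ => Set.finite_range _
  refine hfin.subset ?_
  rintro _ ⟨⟨i, rfl⟩, hi⟩
  refine ⟨i, ?_, rfl⟩
  have h1 := mem_annulus.1 ((hω i.1).2 i.2)
  rw [Set.mem_ofPred_eq, ← h1]
  exact Nat.floor_le_floor (hR _ hi)

theorem isPoissonProcess_poissonProcess (r : ℕ → ℝ≥0) (κ : ℕ → Measure (Space n))
    [∀ m, IsProbabilityMeasure (κ m)] [∀ m, NullSingletonClass (κ m)]
    (hκ : ∀ m, ∀ᵐ x ∂(κ m), x ∈ annulus n m) :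
    IsPoissonProcess (poissonLaw r κ) poissonProcess (Measure.sum fun m => r m • κ m) :=
  ⟨isPointProcess_poissonProcess r κ hκ, fun _ hf => laplace_poissonProcess r κ hf⟩

end Poisson

section EdgeIntensity

variable {n : ℕ} [NeZero n]

theorem continuous_edgeIntensity_density :
    Continuous fun x : Space n => Real.exp (-(inner ℝ (firstBasisVector n) x)) := by fun_prop

instance : IsLocallyFiniteMeasure (edgeIntensity n) :=
  IsLocallyFiniteMeasure.withDensity_ofReal continuous_edgeIntensity_density

theorem edgeIntensity_annulus_ne_zero (m : ℕ) : edgeIntensity n (annulus n m) ≠ 0 := by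
  have hac : (volume : Measure (Space n)) ≪ edgeIntensity n := by
    refine withDensity_absolutelyContinuous'
      continuous_edgeIntensity_density.measurable.ennreal_ofReal.aemeasurable
      (ae_of_all _ fun x => ?_)
    simp [Real.exp_pos]
  intro h
  have h0 := hac h
  have hopen : IsOpen {x : Space n | (m : ℝ) < ‖x‖ ∧ ‖x‖ < m + 1} :=
    (isOpen_lt continuous_const continuous_norm).inter (isOpen_lt continuous_norm continuous_const)
  have hsub : {x : Space n | (m : ℝ) < ‖x‖ ∧ ‖x‖ < m + 1} ⊆ annulus n m := fun x hx =>
    ⟨hx.1.le, hx.2⟩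
  refine (hopen.measure_pos volume ⟨((m : ℝ) + 1 / 2) • firstBasisVector n, ?_⟩).ne'
    (measure_mono_null hsub h0)
  have hn : ‖((m : ℝ) + 1 / 2) • firstBasisVector n‖ = m + 1 / 2 := by
    rw [norm_smul, firstBasisVector, PiLp.norm_single, norm_one, mul_one,
      Real.norm_of_nonneg (by positivity)]
  constructor <;> rw [hn] <;> linarith

theorem edgeIntensity_annulus_ne_top (m : ℕ) : edgeIntensity n (annulus n m) ≠ ∞ := by
  have h : annulus n m ⊆ Metric.closedBall 0 (m + 1) := fun x hx => by simpa using hx.2.le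
  exact ((measure_mono h).trans_lt (isCompact_closedBall (0 : Space n) (m + 1)).measure_lt_top).ne

theorem sum_restrict_annulus (θ : Measure (Space n)) :
    (Measure.sum fun m => θ.restrict (annulus n m)) = θ := by
  rw [← Measure.restrict_iUnion (fun i j hij => ?_) (measurableSet_annulus n)]
  · have : ⋃ m, annulus n m = Set.univ :=
      Set.eq_univ_of_forall fun x => Set.mem_iUnion.2 ⟨_, mem_annulus.2 rfl⟩
    rw [this, Measure.restrict_univ]
  · exact Set.disjoint_left.2 fun x hi hj => hij ((mem_annulus.1 hi).symm.trans (mem_annulus.1 hj))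

/-- The intensity has infinite total mass, so it is cut into annuli of finite positive mass. The
mass is the Poisson parameter of the cell and the normalized restriction is the law of its points.
-/
theorem exists_isPoissonProcess (n : ℕ) [NeZero n] :
    ∃ (P : Measure (ℕ → ℕ × (ℕ → Space n))) (Ξ : (ℕ → ℕ × (ℕ → Space n)) → Measure (Space n)),
      IsPoissonProcess P Ξ (edgeIntensity n) := by
  set κ : ℕ → Measure (Space n) := fun m => cond (edgeIntensity n) (annulus n m) with hκ
  set r : ℕ → ℝ≥0 := fun m => (edgeIntensity n (annulus n m)).toNNReal with hr
  have hsum : (Measure.sum fun m => r m • κ m) = edgeIntensity n := by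
    rw [← sum_restrict_annulus (edgeIntensity n)]
    congr 1
    ext1 m
    change ((edgeIntensity n (annulus n m)).toNNReal : ℝ≥0∞) • (edgeIntensity n (annulus n m))⁻¹ •
      (edgeIntensity n).restrict (annulus n m) = _
    rw [ENNReal.coe_toNNReal (edgeIntensity_annulus_ne_top m), smul_smul,
      ENNReal.mul_inv_cancel (edgeIntensity_annulus_ne_zero m) (edgeIntensity_annulus_ne_top m),
      one_smul]
  have i1 : ∀ m, IsProbabilityMeasure (κ m) := fun m =>
    cond_isProbabilityMeasure_of_finite (edgeIntensity_annulus_ne_zero m)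
      (edgeIntensity_annulus_ne_top m)
  have i0 : NullSingletonClass (edgeIntensity n) := by unfold edgeIntensity; infer_instance
  have i2 : ∀ m, NullSingletonClass (κ m) := fun m => by
    refine ⟨fun x => ?_⟩
    rw [hκ]
    exact cond_absolutelyContinuous (measure_singleton x)
  refine ⟨poissonLaw r κ, poissonProcess, ?_⟩
  have := isPoissonProcess_poissonProcess r κ fun m =>
    ae_cond_mem (measurableSet_annulus n m)
  rwa [hsum] at this

end EdgeIntensity

end LogGas

/-! ### Convergence of the edge process -/

namespace LogGas

variable {n : ℕ} [NeZero n]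

theorem lintegral_edgeIntensity {φ : Space n → ℝ} (hφ : Measurable φ) (h0 : ∀ u, 0 ≤ φ u)
    (h1 : ∀ u, φ u ≤ 1) {R : ℝ} (hR : ∀ u, R < ‖u‖ → φ u = 0) :
    ∫⁻ u, ENNReal.ofReal (φ u) ∂(edgeIntensity n) =
      ENNReal.ofReal (∫ u, φ u * Real.exp (-(inner ℝ (firstBasisVector n) u))) := by
  have hc := continuous_edgeIntensity_density (n := n)
  have hint : Integrable fun u : Space n =>
      φ u * Real.exp (-(inner ℝ (firstBasisVector n) u)) := by
    have hK : IntegrableOn (fun u : Space n => φ u * Real.exp (-(inner ℝ (firstBasisVector n) u)))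
        (Metric.closedBall 0 R) := by
      refine Integrable.bdd_mul (c := 1)
        (hc.continuousOn.integrableOn_compact (isCompact_closedBall 0 R))
        hφ.aestronglyMeasurable (ae_of_all _ fun u => ?_)
      rw [Real.norm_of_nonneg (h0 u)]
      exact h1 u
    refine (integrableOn_iff_integrable_of_support_subset fun u hu => ?_).1 hK
    by_contra hu'
    exact hu (by simp [hR u (by simpa using hu')])
  rw [edgeIntensity, lintegral_withDensity_eq_lintegral_mul _ hc.measurable.ennreal_ofReal
    hφ.ennreal_ofReal, ofReal_integral_eq_lintegral_ofReal hint
    (ae_of_all _ fun u => mul_nonneg (h0 u) (Real.exp_pos _).le)]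
  refine lintegral_congr fun u => ?_
  rw [Pi.mul_apply, ENNReal.ofReal_mul (h0 u), mul_comm]

variable {α γ L : ℝ} {μ : Measure (Space n)} {υ : Space n} {ψ : Space n ≃ₗᵢ[ℝ] Space n}

theorem tendsto_zero_of_tendsto_natCast_mul {β : ℕ → ℝ}
    (hβ : Tendsto (fun N : ℕ => (N : ℝ) * β N) atTop (𝓝 γ)) : Tendsto β atTop (𝓝 0) := by
  have h := hβ.mul tendsto_inv_atTop_nhds_zero_nat
  rw [mul_zero] at h
  refine h.congr' ?_
  filter_upwards [eventually_ge_atTop 1] with N hN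
  have : (N : ℝ) ≠ 0 := by positivity
  field_simp

theorem Solution.eventually_integrable_gibbsWeight (S : Solution α γ L μ) {β : ℕ → ℝ}
    (hp : ∀ N, 0 < β N) (hβ : Tendsto (fun N : ℕ => (N : ℝ) * β N) atTop (𝓝 γ)) :
    ∀ᶠ N in atTop, Integrable (gibbsWeight α (β N) : (Fin N → Space n) → ℝ) ∧
      0 < ∫ x : Fin N → Space n, gibbsWeight α (β N) x := by
  obtain ⟨M₀, δ, hδ, h⟩ := S.exists_gibbsWeight_le one_pos
  filter_upwards [eventually_ge_atTop M₀, Metric.tendsto_nhds.1 hβ δ hδ] with N hN hd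
  have h' := h N hN (β N) (hp N) (by simpa [Real.dist_eq] using hd.le)
  exact ⟨h'.1, h'.2.1⟩

/-- `tendsto_integral_zoom` supplies the limit L·l of N times the one-point integral of χ, and
`tendsto_thin` converts it into e^{-l}. Compact support of f makes χ live on a bounded window. -/
theorem Solution.tendsto_laplace (S : Solution α γ L μ) (hυ : ‖υ‖ = 1)
    (hψ : ψ (firstBasisVector n) = υ) {β : ℕ → ℝ} (hp : ∀ N, 0 < β N)
    (hβ : Tendsto (fun N : ℕ => (N : ℝ) * β N) atTop (𝓝 γ)) {f : Space n → ℝ≥0}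
    (hf : Continuous f) (hfc : HasCompactSupport f) :
    Tendsto (fun N => laplace (gibbs n N α (β N))
      (edgeProcess α (edgeRadius n N α (β N) L) υ ψ) f) atTop
      (𝓝 (expNeg (∫⁻ x, ENNReal.ofReal (1 - Real.exp (-(f x : ℝ))) ∂(edgeIntensity n)))) := by
  have hβ0 := tendsto_zero_of_tendsto_natCast_mul hβ
  set φ : Space n → ℝ := fun u => 1 - Real.exp (-(f u : ℝ)) with hφ
  have hφm : Measurable φ := hf.measurable.coe_nnreal_real.neg.exp.const_sub 1
  have hφ0 : ∀ u, 0 ≤ φ u := fun u => sub_nonneg.2 (Real.exp_le_one_iff.2 (by simp))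
  have hφ1 : ∀ u, φ u ≤ 1 := fun u => sub_le_self _ (Real.exp_pos _).le
  obtain ⟨R, hR⟩ : ∃ R : ℝ, ∀ u, R < ‖u‖ → φ u = 0 := by
    obtain ⟨R, hR⟩ := hfc.isCompact.isBounded.exists_norm_le
    refine ⟨R, fun u hu => ?_⟩
    have : f u = 0 := image_eq_zero_of_notMem_tsupport fun h => (hR u h).not_gt hu
    simp [hφ, this]
  set l : ℝ := ∫ u, φ u * Real.exp (-(inner ℝ (firstBasisVector n) u)) with hl
  have hl0 : 0 ≤ l := integral_nonneg fun u => mul_nonneg (hφ0 u) (Real.exp_pos _).le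
  rw [lintegral_edgeIntensity hφm hφ0 hφ1 hR, expNeg_ofReal hl0]
  have hzoom := S.tendsto_integral_zoom hυ hψ hβ hβ0 hp hφm hφ0 hφ1 hR
  -- Index shift N = M + 1: the inverse temperature belongs to N, but the separated particle
  -- interacts with M others, and Mβ_N = Nβ_N - β_N.
  have hlim : Tendsto (fun M : ℕ => (M : ℝ) * β (M + 1)) atTop (𝓝 γ) := by
    have h := ((tendsto_add_atTop_iff_nat 1).2 hβ).sub ((tendsto_add_atTop_iff_nat 1).2 hβ0)
    rw [sub_zero] at h
    refine h.congr fun M => ?_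
    push_cast
    ring
  have hthin := S.tendsto_thin (b := fun M => β (M + 1)) (fun M => hp _) hlim
    ((tendsto_add_atTop_iff_nat 1).2 hβ0)
    (χ := fun M a => φ (zoomInv α (edgeRadius n (M + 1) α (β (M + 1)) L) υ ψ a))
    (fun M => hφm.comp measurable_zoomInv) (fun M a => hφ0 _) (fun M a => hφ1 _) hl0 (by
      refine ((tendsto_add_atTop_iff_nat 1).2 hzoom).congr fun M => ?_
      have h : ((M + 1 : ℕ) : ℝ) * β (M + 1) - β (M + 1) = M * β (M + 1) := by push_cast; ring
      rw [h, Nat.cast_add_one])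
  refine (tendsto_add_atTop_iff_nat 1).1 ?_
  refine (ENNReal.continuous_ofReal.tendsto _ |>.comp hthin).congr' ?_
  filter_upwards [(tendsto_add_atTop_nat 1).eventually (S.eventually_integrable_gibbsWeight hp hβ)]
    with M hM
  exact (laplace_gibbs S.alpha_pos (hp _) hM.1 hM.2 hf.measurable).symm

end LogGas

theorem mainTheorem5 (n : ℕ) [NeZero n] (hn : n = 1 ∨ n = 2) (α γ : ℝ) (hα : 0 < α)
    (hγ : 0 ≤ γ) :
    ∃ (μ : ProbabilityMeasure (LogGas.Space n)) (L : ℝ),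
      (LogGas.IsEquilibrium α γ μ ∧
        ∀ ν : ProbabilityMeasure (LogGas.Space n), LogGas.IsEquilibrium α γ ν → ν = μ) ∧
      0 < L ∧
      LogGas.SelfConsistent α γ L (μ : Measure (LogGas.Space n)) ∧
      ∀ (υ : LogGas.Space n) (ψ : LogGas.Space n ≃ₗᵢ[ℝ] LogGas.Space n), ‖υ‖ = 1 →
        ψ (LogGas.firstBasisVector n) = υ →
        ∀ β : ℕ → ℝ, (∀ N, 0 < β N) →
          Tendsto (fun N : ℕ => (N : ℝ) * β N) atTop (𝓝 γ) →
          ∃ (Ω : Type) (_ : MeasurableSpace Ω) (P : Measure Ω)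
            (Ξ : Ω → Measure (LogGas.Space n)),
            LogGas.IsPoissonProcess P Ξ (LogGas.edgeIntensity n) ∧
            LogGas.ConvergesInDistribution
              (fun N => LogGas.gibbs n N α (β N))
              (fun N => LogGas.edgeProcess α (LogGas.edgeRadius n N α (β N) L) υ ψ)
              P Ξ := by
  obtain ⟨μ, L, hμ, hL, hsc, htame⟩ := LogGas.exists_equilibrium (n := n) hα hγ
  -- Tameness is not part of the conclusion, but every asymptotic estimate uses it, so it is carried
  -- along from the construction of μ.
  have S : LogGas.Solution α γ L (μ : Measure (LogGas.Space n)) :=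
    ⟨hα, hγ, hL, inferInstance, hsc, htame⟩
  refine ⟨μ, L, hμ, hL, hsc, fun υ ψ hυ hψ β hp hβ => ?_⟩
  obtain ⟨P, Ξ, hΞ⟩ := LogGas.exists_isPoissonProcess n
  refine ⟨_, _, P, Ξ, hΞ, ⟨?_, hΞ.isPointProcess, fun f hf hfc => ?_⟩⟩
  · filter_upwards [S.eventually_integrable_gibbsWeight hp hβ,
      (LogGas.tendsto_edgeRadius (n := n) (L := L) hα hβ).eventually_gt_atTop 0] with N hN hη
    exact LogGas.isPointProcess_edgeProcess hα (hp N) hη hN.1 hN.2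
  · rw [hΞ.laplace_eq f hf.measurable]
    exact S.tendsto_laplace hυ hψ hp hβ hf hfc
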